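/- **Multiplicative Hochschild Theorem.** Let $K$ be a field of characteristic $0$, let $\mathfrak g$ be a finite-dimensional Lie algebra over $K$ and $\mathfrak k\subset\mathfrak g$ a Lie subalgebra, and assume that $\mathfrak g$ is semisimple as a $\mathfrak k$-module under the adjoint action. A $(\mathfrak g,\mathfrak k)$-module is a $\mathfrak g$-module whose restriction to $\mathfrak k$ is locally finite and semisimple (i.e. a direct sum of finite-dimensional simple $\mathfrak k$-modules). The $(\mathfrak g,\mathfrak k)$-modules form a full abelian subcategory of the category of $\mathfrak g$-modules; $\operatorname{Ext}_{\mathfrak g,\mathfrak k}$ denotes the Ext-groups of this abelian category (morphisms to shifts in its derived category). For a $\mathfrak g$-module $V$ let $C^n(\mathfrak g,\mathfrak k;V)=\operatorname{Hom}_{\mathfrak k}(\Lambda^n(\mathfrak g/\mathfrak k),V)$, viewed as the space of alternating $n$-linear maps $\mathfrak g^n\to V$ which are $\mathfrak k$-equivariant and vanish as soon as one argument lies in $\mathfrak k$, with the differential $$(d\alpha)(x_0,\dots,x_n)=\sum_i(-1)^i\,x_i\cdot\alpha(\dots,\widehat{x_i},\dots)+\sum_{i<j}(-1)^{i+j}\alpha([x_i,x_j],\dots,\widehat{x_i},\dots,\widehat{x_j},\dots),$$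 and let $H^n_{CE}(\mathfrak g,\mathfrak k;V)$ be its cohomology. For $\alpha\in C^p(\mathfrak g,\mathfrak k;V)$ and $\beta\in C^q(\mathfrak g,\mathfrak k;K)$, $K$ being the trivial module, put $$(\alpha\wedge\beta)(x_1,\dots,x_{p+q})=\frac1{p!\,q!}\sum_{\sigma\in S_{p+q}}\operatorname{sgn}(\sigma)\,\beta(x_{\sigma(p+1)},\dots,x_{\sigma(p+q)})\,\alpha(x_{\sigma(1)},\dots,x_{\sigma(p)});$$ this induces the cup product $\cup:H^p_{CE}(\mathfrak g,\mathfrak k;V)\otimes H^q_{CE}(\mathfrak g,\mathfrak k;K)\to H^{p+q}_{CE}(\mathfrak g,\mathfrak k;V)$. For a $(\mathfrak g,\mathfrak k)$-module $V$ let $A^n(V)$ be the $\mathfrak k$-finite part (the largest submodule which is a $(\mathfrak g,\mathfrak k)$-module) of $\operatorname{Hom}_K(U(\mathfrak g)\otimes_{\mathfrak k}\Lambda^n(\mathfrak g/\mathfrak k),V)$, with the Chevalley–Eilenberg (Koszul) differential and the canonical augmentation $V\to A^0(V)$. Here the coefficient module is realized as the relative cochains of degree $n$ with values in $\operatorname{Hom}_K(U(\mathfrak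 g),V)$, on which $x\in\mathfrak g$ acts by $(x\cdot F)(u)=x F(u)-F(xu)$, with $U(\mathfrak g)$ acting on cochains by right translation $(wF)(u)=F(uw)$; the augmentation is $v\mapsto(u\mapsto uv)$. Then: 1. For every $(\mathfrak g,\mathfrak k)$-module $V$, $V\to A^\bullet(V)$ is an injective resolution of $V$ in the category of $(\mathfrak g,\mathfrak k)$-modules. 2. Let $\epsilon$ denote the counit of $U(\mathfrak g)$. Sending a relative cocycle $\alpha\in C^n(\mathfrak g,\mathfrak k;V)$ to the class in $\operatorname{Ext}^n_{\mathfrak g,\mathfrak k}(K,V)$ of the morphism $K\to A^n(V)$, $t\mapsto\big(x\mapsto(u\mapsto\epsilon(u)\,t\,\alpha(x))\big)$ for $x\in\mathfrak g^n$, $u\in U(\mathfrak g)$, induces for every $n$ and every $(\mathfrak g,\mathfrak k)$-module $V$ a $K$-linear isomorphism (Hochschild's isomorphism) $$\Phi_V:H^n_{CE}(\mathfrak g,\mathfrak k;V)\xrightarrow{\ \sim\ }\operatorname{Ext}^n_{\mathfrak g,\mathfrak k}(K,V).$$ 3. $\Phi$ is multiplicative: for every $(\mathfrak g,\mathfrak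 k)$-module $V$, all $p,q\ge0$, all $a\in H^p_{CE}(\mathfrak g,\mathfrak k;V)$ and $b\in H^q_{CE}(\mathfrak g,\mathfrak k;K)$, $$\Phi_V(a\cup b)=\Phi_V(a)\circ\Phi_K(b)\in\operatorname{Ext}^{p+q}_{\mathfrak g,\mathfrak k}(K,V),$$ where $\circ$ is the composition product $\operatorname{Ext}^p(K,V)\otimes\operatorname{Ext}^q(K,K)\to\operatorname{Ext}^{p+q}(K,V)$. -/

import Mathlib

open CategoryTheory

set_option linter.unusedSectionVars false

universe u

namespace RelLie

section Cochains

variable {K 𝔤 V : Type*} [Field K] [LieRing 𝔤] [LieAlgebra K 𝔤]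
  [AddCommGroup V] [Module K V] [LieRingModule 𝔤 V] [LieModule K 𝔤 V]

/-- The Lie derivative of a cochain:
`(L_x α)(v₁, …, vₙ) = x · α(v₁, …, vₙ) - ∑ⱼ α(v₁, …, [x, vⱼ], …, vₙ)`. -/
def lieDer {n : ℕ} (x : 𝔤) (α : 𝔤 [⋀^Fin n]→ₗ[K] V) : 𝔤 [⋀^Fin n]→ₗ[K] V :=
  { (LieModule.toEnd K 𝔤 V x).compMultilinearMap α.toMultilinearMap -
      ∑ j : Fin n, α.toMultilinearMap.compLinearMap
        (Function.update (fun _ => LinearMap.id) j (LieAlgebra.ad K 𝔤 x)) with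
    map_eq_zero_of_eq' := by
      intro v a b hab hne
      have key : ∀ j : Fin n, (fun i => (Function.update (fun _ => (LinearMap.id : 𝔤 →ₗ[K] 𝔤)) j
          (LieAlgebra.ad K 𝔤 x)) i (v i)) = Function.update v j ⁅x, v j⁆ := by
        intro j; ext i
        by_cases h : i = j
        · subst h; simp
        · simp [h]
      simp only [MultilinearMap.toFun_eq_coe, sub_apply, sum_apply,
        LinearMap.compMultilinearMap_apply, MultilinearMap.compLinearMap_apply, key,
        AlternatingMap.coe_multilinearMap]
      rw [α.map_eq_zero_of_eq v hab hne, map_zero, zero_sub, neg_eq_zero,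
        Fintype.sum_eq_add a b hne]
      · rw [hab]
        have h1 : Function.update v a ⁅x, v b⁆ ∘ Equiv.swap a b = Function.update v b ⁅x, v b⁆ := by
          ext i
          simp only [Function.comp]
          by_cases hia : i = a
          · subst hia; simp [hne, hne.symm, hab]
          by_cases hib : i = b
          · subst hib; simp
          · rw [Equiv.swap_apply_of_ne_of_ne hia hib]; simp [hia, hib]
        rw [← h1, α.map_swap _ hne, add_neg_cancel]
      · rintro j ⟨hja, hjb⟩
        exact α.map_eq_zero_of_eq _ (by simp [hja.symm, hjb.symm, hab]) hne }

theorem lieDer_apply {n : ℕ} (x : 𝔤) (α : 𝔤 [⋀^Fin n]→ₗ[K] V) (v : Fin n → 𝔤) :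
    lieDer x α v = ⁅x, α v⁆ - ∑ j : Fin n, α (Function.update v j ⁅x, v j⁆) := by
  have key : ∀ j : Fin n, (fun i => (Function.update (fun _ => (LinearMap.id : 𝔤 →ₗ[K] 𝔤)) j
      (LieAlgebra.ad K 𝔤 x)) i (v i)) = Function.update v j ⁅x, v j⁆ := by
    intro j; ext i
    by_cases h : i = j
    · subst h; simp
    · simp [h]
  change (((LieModule.toEnd K 𝔤 V x).compMultilinearMap α.toMultilinearMap -
      ∑ j : Fin n, α.toMultilinearMap.compLinearMap
        (Function.update (fun _ => LinearMap.id) j (LieAlgebra.ad K 𝔤 x)) :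
          MultilinearMap K (fun _ : Fin n => 𝔤) V)) v = _
  simp [key]

theorem lieDer_add {n : ℕ} (x : 𝔤) (α β : 𝔤 [⋀^Fin n]→ₗ[K] V) :
    lieDer x (α + β) = lieDer x α + lieDer x β := by
  ext v; simp [lieDer_apply, Finset.sum_add_distrib]; abel

theorem lieDer_smul {n : ℕ} (c : K) (x : 𝔤) (α : 𝔤 [⋀^Fin n]→ₗ[K] V) :
    lieDer x (c • α) = c • lieDer x α := by
  ext v; simp [lieDer_apply, Finset.smul_sum, smul_sub]

theorem lieDer_sub {n : ℕ} (x : 𝔤) (α β : 𝔤 [⋀^Fin n]→ₗ[K] V) :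
    lieDer x (α - β) = lieDer x α - lieDer x β := by
  ext v; simp [lieDer_apply, Finset.sum_sub_distrib]; abel

theorem lieDer_add_left {n : ℕ} (x y : 𝔤) (α : 𝔤 [⋀^Fin n]→ₗ[K] V) :
    lieDer (x + y) α = lieDer x α + lieDer y α := by
  ext v; simp [lieDer_apply, Finset.sum_add_distrib]; abel

theorem lieDer_smul_left {n : ℕ} (c : K) (x : 𝔤) (α : 𝔤 [⋀^Fin n]→ₗ[K] V) :
    lieDer (c • x) α = c • lieDer x α := by
  ext v; simp [lieDer_apply, Finset.smul_sum, smul_sub]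

theorem curryLeft_ext {n : ℕ} {α β : 𝔤 [⋀^Fin (n + 1)]→ₗ[K] V}
    (h : ∀ x, α.curryLeft x = β.curryLeft x) : α = β := by
  ext v
  have := congrArg (fun γ : 𝔤 [⋀^Fin n]→ₗ[K] V => γ (Fin.tail v)) (h (v 0))
  simpa [AlternatingMap.curryLeft_apply_apply, Matrix.vecCons] using this

theorem curryLeft_lieDer {n : ℕ} (x y : 𝔤) (α : 𝔤 [⋀^Fin (n + 1)]→ₗ[K] V) :
    (lieDer x α).curryLeft y = lieDer x (α.curryLeft y) - α.curryLeft ⁅x, y⁆ := by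
  ext v
  simp only [AlternatingMap.curryLeft_apply_apply, lieDer_apply, AlternatingMap.sub_apply,
    Fin.sum_univ_succ, Matrix.vecCons, Fin.update_cons_zero, Fin.cons_zero, Fin.cons_succ,
    Fin.cons_update]
  abel

/-- The Chevalley–Eilenberg coboundary formula. -/
def ceFun {n : ℕ} (α : 𝔤 [⋀^Fin n]→ₗ[K] V) (v : Fin (n + 1) → 𝔤) : V :=
  ∑ i : Fin (n + 1), (-1 : ℤ) ^ (i : ℕ) •
    (⁅v i, α (i.removeNth v)⁆ -
      ∑ j ∈ Finset.Ioi i, α (i.removeNth (Function.update v j ⁅v i, v j⁆)))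

theorem ceFun_zero (α : 𝔤 [⋀^Fin 0]→ₗ[K] V) (x : 𝔤) (v : Fin 0 → 𝔤) :
    ceFun α (Fin.cons x v) = lieDer x α v := by
  simp only [ceFun, lieDer_apply]
  simp

theorem ceFun_succ {n : ℕ} (α : 𝔤 [⋀^Fin (n + 1)]→ₗ[K] V) (x : 𝔤) (v : Fin (n + 1) → 𝔤) :
    ceFun α (Fin.cons x v) = lieDer x α v - ceFun (α.curryLeft x) v := by
  have h0 : (Finset.Ioi (0 : Fin (n + 2))) = Finset.univ.map (Fin.succEmb (n + 1)) := by
    ext j; simp [Fin.exists_succ_eq]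
  have hcons : ∀ (i : Fin (n + 1)) (w : Fin (n + 1) → 𝔤),
      i.succ.removeNth (Fin.cons x w : Fin (n + 2) → 𝔤) = Matrix.vecCons x (i.removeNth w) := by
    intro i w
    ext k
    refine Fin.cases ?_ (fun k => ?_) k
    · simp [Fin.removeNth]
    · simp [Fin.removeNth]
  rw [ceFun, Fin.sum_univ_succ, lieDer_apply, ceFun, sub_eq_add_neg (⁅x, α v⁆ - _),
    ← Finset.sum_neg_distrib]
  congr 1
  · rw [h0, Finset.sum_map]
    simp [← Fin.cons_update]
  · refine Finset.sum_congr rfl fun i _ => ?_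
    rw [← Fin.map_succEmb_Ioi, Finset.sum_map]
    simp only [Fin.cons_succ, Fin.val_succ, pow_succ, Fin.coe_succEmb, ← Fin.cons_update, hcons,
      AlternatingMap.curryLeft_apply_apply, mul_neg, mul_one, neg_smul]

theorem ceFun_add {n : ℕ} (α β : 𝔤 [⋀^Fin n]→ₗ[K] V) (v : Fin (n + 1) → 𝔤) :
    ceFun (α + β) v = ceFun α v + ceFun β v := by
  simp only [ceFun, AlternatingMap.add_apply, lie_add, Finset.sum_add_distrib]
  rw [← Finset.sum_add_distrib]
  refine Finset.sum_congr rfl fun i _ => ?_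
  rw [← smul_add]; congr 1; abel

theorem ceFun_smul {n : ℕ} (c : K) (α : 𝔤 [⋀^Fin n]→ₗ[K] V) (v : Fin (n + 1) → 𝔤) :
    ceFun (c • α) v = c • ceFun α v := by
  rw [ceFun, ceFun, Finset.smul_sum]
  refine Finset.sum_congr rfl fun i _ => ?_
  simp only [AlternatingMap.smul_apply, lie_smul]
  rw [smul_comm c, smul_sub c, Finset.smul_sum]

/-- An alternating map in `n + 1` variables from a family of alternating maps in `n` variables
that vanishes when the parameter is repeated as first argument. -/
def mkAlt {n : ℕ} (G : 𝔤 →ₗ[K] 𝔤 [⋀^Fin n]→ₗ[K] V)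
    (hG : ∀ (x : 𝔤) (w : Fin n → 𝔤) (j : Fin n), w j = x → G x w = 0) :
    𝔤 [⋀^Fin (n + 1)]→ₗ[K] V :=
  { (AlternatingMap.toMultilinearMapLM ∘ₗ G : 𝔤 →ₗ[K] MultilinearMap K (fun _ : Fin n => 𝔤) V
      ).uncurryLeft with
    map_eq_zero_of_eq' := by
      intro v a b hab hne
      change G (v 0) (Fin.tail v) = 0
      rcases Fin.eq_zero_or_eq_succ a with rfl | ⟨a, rfl⟩
      · rcases Fin.eq_zero_or_eq_succ b with rfl | ⟨b, rfl⟩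
        · exact absurd rfl hne
        · exact hG _ _ b hab.symm
      · rcases Fin.eq_zero_or_eq_succ b with rfl | ⟨b, rfl⟩
        · exact hG _ _ a hab
        · exact (G (v 0)).map_eq_zero_of_eq _ hab (fun h => hne (by rw [h])) }

theorem ceFun_exists : ∀ (n : ℕ) (α : 𝔤 [⋀^Fin n]→ₗ[K] V),
    ∃ β : 𝔤 [⋀^Fin (n + 1)]→ₗ[K] V, ∀ v, β v = ceFun α v
  | 0, α => by
    refine ⟨mkAlt ⟨⟨fun x => lieDer x α, fun x y => lieDer_add_left x y α⟩,
      fun c x => lieDer_smul_left c x α⟩ (fun _ _ j => j.elim0), fun v => ?_⟩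
    rw [← Fin.cons_self_tail v, ceFun_zero]; rfl
  | n + 1, α => by
    choose β hβ using fun x => ceFun_exists n (α.curryLeft x)
    have hz : ∀ (x : 𝔤) (w : Fin (n + 1) → 𝔤), w 0 = x → (lieDer x α - β x) w = 0 := by
      intro x w hw
      have e1 : lieDer x α w = lieDer x (α.curryLeft x) (Fin.tail w) := by
        have := congrArg (fun γ : 𝔤 [⋀^Fin n]→ₗ[K] V => γ (Fin.tail w)) (curryLeft_lieDer x x α)
        simpa [AlternatingMap.curryLeft_apply_apply, Matrix.vecCons, ← hw] using this
      rw [AlternatingMap.sub_apply, hβ, e1, sub_eq_zero]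
      conv_rhs => rw [← Fin.cons_self_tail w, hw]
      cases n with
      | zero => rw [ceFun_zero]
      | succ m =>
        rw [ceFun_succ, AlternatingMap.curryLeft_same]
        have : ceFun (0 : 𝔤 [⋀^Fin m]→ₗ[K] V) (Fin.tail w) = 0 := by
          simpa using ceFun_smul (0 : K) (0 : 𝔤 [⋀^Fin m]→ₗ[K] V) (Fin.tail w)
        rw [this, sub_zero]
    refine ⟨mkAlt ⟨⟨fun x => lieDer x α - β x, fun x y => ?_⟩, fun c x => ?_⟩ ?_, fun v => ?_⟩
    · ext v
      simp only [AlternatingMap.sub_apply, AlternatingMap.add_apply, lieDer_add_left, hβ, map_add,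
        ceFun_add]
      abel
    · ext v
      simp only [AlternatingMap.sub_apply, AlternatingMap.smul_apply, lieDer_smul_left, hβ,
        map_smul, ceFun_smul, RingHom.id_apply, smul_sub]
    · intro x w j hj
      change (lieDer x α - β x) w = 0
      by_cases h0 : j = 0
      · exact hz x w (h0 ▸ hj)
      · have := (lieDer x α - β x).map_swap w (i := 0) (j := j) (Ne.symm h0)
        rw [hz x _ (by simpa using hj)] at this
        exact neg_eq_zero.mp this.symm
    · rw [← Fin.cons_self_tail v, ceFun_succ, ← hβ]; rfl

/-- The Chevalley–Eilenberg coboundary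
`(dα)(v₀, …, vₙ) = ∑ᵢ (-1)ⁱ vᵢ · α(…, v̂ᵢ, …) + ∑_{i<j} (-1)^{i+j} α([vᵢ, vⱼ], …, v̂ᵢ, …, v̂ⱼ, …)`.
In `ceFun` the bracket `[vᵢ, vⱼ]` has been moved to the place of `vⱼ`, which costs the
sign `(-1)^{j-1}`. -/
def ceD (n : ℕ) : (𝔤 [⋀^Fin n]→ₗ[K] V) →ₗ[K] (𝔤 [⋀^Fin (n + 1)]→ₗ[K] V) where
  toFun α :=
    { toFun := ceFun α
      map_update_add' := by
        intro _ v i x y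
        obtain ⟨β, hβ⟩ := ceFun_exists n α
        simp only [← hβ]
        convert β.map_update_add v i x y
      map_update_smul' := by
        intro _ v i c x
        obtain ⟨β, hβ⟩ := ceFun_exists n α
        simp only [← hβ]
        convert β.map_update_smul v i c x
      map_eq_zero_of_eq' := by
        intro v i j hij hne
        obtain ⟨β, hβ⟩ := ceFun_exists n α
        simp only [← hβ]
        exact β.map_eq_zero_of_eq v hij hne }
  map_add' α β := by ext v; exact ceFun_add α β v
  map_smul' c α := by ext v; exact ceFun_smul c α v

theorem ceD_apply {n : ℕ} (α : 𝔤 [⋀^Fin n]→ₗ[K] V) (v : Fin (n + 1) → 𝔤) :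
    ceD n α v = ceFun α v := rfl

theorem curryLeft_ceD_zero (x : 𝔤) (α : 𝔤 [⋀^Fin 0]→ₗ[K] V) :
    (ceD 0 α).curryLeft x = lieDer x α := by
  ext v; exact ceFun_zero α x v

theorem curryLeft_ceD_succ {n : ℕ} (x : 𝔤) (α : 𝔤 [⋀^Fin (n + 1)]→ₗ[K] V) :
    (ceD (n + 1) α).curryLeft x = lieDer x α - ceD n (α.curryLeft x) := by
  ext v; exact ceFun_succ α x v

theorem lieDer_lie : ∀ {n : ℕ} (x y : 𝔤) (α : 𝔤 [⋀^Fin n]→ₗ[K] V),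
    lieDer ⁅x, y⁆ α = lieDer x (lieDer y α) - lieDer y (lieDer x α)
  | 0, x, y, α => by ext v; simp [lieDer_apply]
  | n + 1, x, y, α => by
    refine curryLeft_ext fun z => ?_
    have hsub : ∀ (β γ : 𝔤 [⋀^Fin (n + 1)]→ₗ[K] V),
      (β - γ).curryLeft z = β.curryLeft z - γ.curryLeft z := fun _ _ => rfl
    simp only [hsub, curryLeft_lieDer, lieDer_sub, lieDer_lie x y (α.curryLeft z), lie_lie,
      map_sub]
    abel

theorem ceD_lieDer : ∀ {n : ℕ} (x : 𝔤) (α : 𝔤 [⋀^Fin n]→ₗ[K] V),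
    ceD n (lieDer x α) = lieDer x (ceD n α)
  | 0, x, α => by
    refine curryLeft_ext fun z => ?_
    rw [curryLeft_lieDer, curryLeft_ceD_zero, curryLeft_ceD_zero, curryLeft_ceD_zero, lieDer_lie]
    abel
  | n + 1, x, α => by
    refine curryLeft_ext fun z => ?_
    rw [curryLeft_lieDer, curryLeft_ceD_succ, curryLeft_ceD_succ, curryLeft_ceD_succ, lieDer_lie,
      curryLeft_lieDer, map_sub, lieDer_sub, ceD_lieDer x (α.curryLeft z)]
    abel

theorem ceD_ceD : ∀ {n : ℕ} (α : 𝔤 [⋀^Fin n]→ₗ[K] V), ceD (n + 1) (ceD n α) = 0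
  | 0, α => by
    refine curryLeft_ext fun z => ?_
    rw [curryLeft_ceD_succ, curryLeft_ceD_zero, ceD_lieDer, sub_self]; rfl
  | n + 1, α => by
    refine curryLeft_ext fun z => ?_
    rw [curryLeft_ceD_succ, curryLeft_ceD_succ, map_sub, ceD_lieDer, ceD_ceD (α.curryLeft z)]
    simp

end Cochains

section Wedge

variable {K 𝔤 V W Z : Type*} [Field K] [LieRing 𝔤] [LieAlgebra K 𝔤]
  [AddCommGroup V] [Module K V] [AddCommGroup W] [Module K W] [AddCommGroup Z] [Module K Z]

/-- The multilinear map `(v₁, …, vₙ) ↦ B(α(v₁, …, v_p), β(v_{p+1}, …, vₙ))`, `n = p + q`. -/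
def tensorMul (B : V →ₗ[K] W →ₗ[K] Z) {p q n : ℕ} (h : p + q = n)
    (α : 𝔤 [⋀^Fin p]→ₗ[K] V) (β : 𝔤 [⋀^Fin q]→ₗ[K] W) :
    MultilinearMap K (fun _ : Fin n => 𝔤) Z :=
  (TensorProduct.lift B).compMultilinearMap
    ((MultilinearMap.domCoprod α.toMultilinearMap β.toMultilinearMap).domDomCongr
      (finSumFinEquiv.trans (finCongr h)))

theorem tensorMul_apply (B : V →ₗ[K] W →ₗ[K] Z) {p q n : ℕ} (h : p + q = n)
    (α : 𝔤 [⋀^Fin p]→ₗ[K] V) (β : 𝔤 [⋀^Fin q]→ₗ[K] W) (v : Fin n → 𝔤) :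
    tensorMul B h α β v = B (α fun i => v (Fin.cast h (Fin.castAdd q i)))
      (β fun j => v (Fin.cast h (Fin.natAdd p j))) := by
  simp [tensorMul]

/-- The exterior product of cochains relative to a bilinear map `B` of coefficients:
`(α ∧ β)(v₁, …, vₙ) = (1 / (p! q!)) ∑_σ sgn(σ) B(α(v_{σ 1}, …, v_{σ p}), β(v_{σ (p+1)}, …, v_{σ n}))`,
the sum being over all permutations of `1, …, n = p + q`. -/
noncomputable def wedge (B : V →ₗ[K] W →ₗ[K] Z) {p q n : ℕ} (h : p + q = n)
    (α : 𝔤 [⋀^Fin p]→ₗ[K] V) (β : 𝔤 [⋀^Fin q]→ₗ[K] W) : 𝔤 [⋀^Fin n]→ₗ[K] Z :=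
  ((p.factorial * q.factorial : ℕ) : K)⁻¹ • MultilinearMap.alternatization (tensorMul B h α β)

theorem alternatization_cons {n : ℕ} (m : MultilinearMap K (fun _ : Fin (n + 1) => 𝔤) Z)
    (x : 𝔤) (v : Fin n → 𝔤) :
    MultilinearMap.alternatization m (Fin.cons x v) =
      ∑ k : Fin (n + 1), ∑ e : Equiv.Perm (Fin n),
        (-1 : ℤ) ^ (k : ℕ) • (Equiv.Perm.sign e : ℤ) • m (k.insertNth x (v ∘ e)) := by
  rw [MultilinearMap.alternatization_apply, ← Fintype.sum_prod_type']
  symm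
  let F : Fin (n + 1) × Equiv.Perm (Fin n) → Equiv.Perm (Fin (n + 1)) :=
    fun a => Equiv.Perm.decomposeFin.symm (0, a.2) * a.1.cycleRange
  have hF : Function.Bijective F := by
    rw [Fintype.bijective_iff_injective_and_card]
    refine ⟨?_, ?_⟩
    · rintro ⟨k, e⟩ ⟨k', e'⟩ hk
      have hk0 : ∀ (k : Fin (n + 1)) (e : Equiv.Perm (Fin n)), F (k, e) k = 0 := by
        intro k e
        simp [F]
      have : k = k' := by
        apply (F (k, e)).injective
        rw [hk0, hk, hk0]
      subst this
      have h2 := mul_right_cancel hk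
      have h3 := Equiv.Perm.decomposeFin.symm.injective h2
      exact Prod.ext rfl (Prod.ext_iff.mp h3).2
    · simp [Fintype.card_perm, Nat.factorial_succ]
  refine Fintype.sum_bijective F hF _ _ ?_
  rintro ⟨k, e⟩
  have h1 : Equiv.Perm.sign (F (k, e)) = (-1) ^ (k : ℕ) * Equiv.Perm.sign e := by
    simp [F, Equiv.Perm.sign_mul, Fin.sign_cycleRange, mul_comm]
  rw [h1, mul_smul, MultilinearMap.domDomCongr_apply]
  have h2 : (fun i => (Fin.cons x v : Fin (n + 1) → 𝔤) (F (k, e) i)) = k.insertNth x (v ∘ e) := by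
    rw [← Fin.cons_comp_cycleRange]
    ext i
    simp only [F, Function.comp, Equiv.Perm.mul_apply]
    generalize k.cycleRange i = j
    refine Fin.cases ?_ (fun j => ?_) j
    · simp
    · simp
  rw [h2]
  simp [Units.smul_def]

theorem tensorMul_insertNth_left (B : V →ₗ[K] W →ₗ[K] Z) {p q n : ℕ} (h : p + 1 + q = n + 1)
    (h' : p + q = n) (α : 𝔤 [⋀^Fin (p + 1)]→ₗ[K] V) (β : 𝔤 [⋀^Fin q]→ₗ[K] W)
    (i : Fin (p + 1)) (x : 𝔤) (w : Fin n → 𝔤) :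
    tensorMul B h α β ((Fin.cast h (Fin.castAdd q i)).insertNth x w) =
      (-1 : ℤ) ^ (i : ℕ) • tensorMul B h' (α.curryLeft x) β w := by
  rw [tensorMul_apply, tensorMul_apply]
  have e1 : (fun a : Fin (p + 1) => ((Fin.cast h (Fin.castAdd q i)).insertNth x w : Fin (n + 1) → 𝔤)
      (Fin.cast h (Fin.castAdd q a))) =
      i.insertNth x (fun a => w (Fin.cast h' (Fin.castAdd q a))) := by
    ext a
    rcases Fin.eq_self_or_eq_succAbove i a with rfl | ⟨a, rfl⟩
    · simp
    · have : Fin.cast h (Fin.castAdd q (i.succAbove a)) =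
          (Fin.cast h (Fin.castAdd q i)).succAbove (Fin.cast h' (Fin.castAdd q a)) := by
        ext; simp only [Fin.succAbove, Fin.lt_def]; simp; split_ifs <;> simp
      rw [this]; simp
  have e2 : (fun b : Fin q => ((Fin.cast h (Fin.castAdd q i)).insertNth x w : Fin (n + 1) → 𝔤)
      (Fin.cast h (Fin.natAdd (p + 1) b))) = fun b => w (Fin.cast h' (Fin.natAdd p b)) := by
    ext b
    have : Fin.cast h (Fin.natAdd (p + 1) b) =
          (Fin.cast h (Fin.castAdd q i)).succAbove (Fin.cast h' (Fin.natAdd p b)) := by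
      ext; simp only [Fin.succAbove, Fin.lt_def]; simp; split_ifs <;> simp <;> omega
    rw [this]; simp
  rw [e1, e2, AlternatingMap.map_insertNth]
  simp

theorem tensorMul_insertNth_right (B : V →ₗ[K] W →ₗ[K] Z) {p q n : ℕ} (h : p + (q + 1) = n + 1)
    (h' : p + q = n) (α : 𝔤 [⋀^Fin p]→ₗ[K] V) (β : 𝔤 [⋀^Fin (q + 1)]→ₗ[K] W)
    (i : Fin (q + 1)) (x : 𝔤) (w : Fin n → 𝔤) :
    tensorMul B h α β ((Fin.cast h (Fin.natAdd p i)).insertNth x w) =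
      (-1 : ℤ) ^ (i : ℕ) • tensorMul B h' α (β.curryLeft x) w := by
  rw [tensorMul_apply, tensorMul_apply]
  have e1 : (fun a : Fin (q + 1) => ((Fin.cast h (Fin.natAdd p i)).insertNth x w : Fin (n + 1) → 𝔤)
      (Fin.cast h (Fin.natAdd p a))) =
      i.insertNth x (fun a => w (Fin.cast h' (Fin.natAdd p a))) := by
    ext a
    rcases Fin.eq_self_or_eq_succAbove i a with rfl | ⟨a, rfl⟩
    · simp
    · have : Fin.cast h (Fin.natAdd p (i.succAbove a)) =
          (Fin.cast h (Fin.natAdd p i)).succAbove (Fin.cast h' (Fin.natAdd p a)) := by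
        ext; simp only [Fin.succAbove, Fin.lt_def]; simp; split_ifs <;> simp <;> omega
      rw [this]; simp
  have e2 : (fun b : Fin p => ((Fin.cast h (Fin.natAdd p i)).insertNth x w : Fin (n + 1) → 𝔤)
      (Fin.cast h (Fin.castAdd (q + 1) b))) = fun b => w (Fin.cast h' (Fin.castAdd q b)) := by
    ext b
    have : Fin.cast h (Fin.castAdd (q + 1) b) =
          (Fin.cast h (Fin.natAdd p i)).succAbove (Fin.cast h' (Fin.castAdd q b)) := by
      ext; simp only [Fin.succAbove, Fin.lt_def]; simp; split_ifs <;> simp <;> omega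
    rw [this]; simp
  rw [e1, e2, AlternatingMap.map_insertNth]
  simp

theorem alternatization_tensorMul_cons (B : V →ₗ[K] W →ₗ[K] Z) {p q n : ℕ} (h : p + q = n + 1)
    (α : 𝔤 [⋀^Fin p]→ₗ[K] V) (β : 𝔤 [⋀^Fin q]→ₗ[K] W) (x : 𝔤) (v : Fin n → 𝔤) :
    MultilinearMap.alternatization (tensorMul B h α β) (Fin.cons x v) =
      (∑ i : Fin p, ∑ e : Equiv.Perm (Fin n), (-1 : ℤ) ^ (i : ℕ) • (Equiv.Perm.sign e : ℤ) •
        tensorMul B h α β ((Fin.cast h (Fin.castAdd q i)).insertNth x (v ∘ e))) +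
      (∑ i : Fin q, ∑ e : Equiv.Perm (Fin n), (-1 : ℤ) ^ (p + i : ℕ) • (Equiv.Perm.sign e : ℤ) •
        tensorMul B h α β ((Fin.cast h (Fin.natAdd p i)).insertNth x (v ∘ e))) := by
  rw [alternatization_cons, ← (finSumFinEquiv.trans (finCongr h)).sum_comp, Fintype.sum_sum_type]
  simp

theorem sum_left (B : V →ₗ[K] W →ₗ[K] Z) {p q n : ℕ} (h : p + 1 + q = n + 1)
    (h' : p + q = n) (α : 𝔤 [⋀^Fin (p + 1)]→ₗ[K] V) (β : 𝔤 [⋀^Fin q]→ₗ[K] W)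
    (x : 𝔤) (v : Fin n → 𝔤) :
    (∑ i : Fin (p + 1), ∑ e : Equiv.Perm (Fin n), (-1 : ℤ) ^ (i : ℕ) • (Equiv.Perm.sign e : ℤ) •
        tensorMul B h α β ((Fin.cast h (Fin.castAdd q i)).insertNth x (v ∘ e))) =
      ((p + 1 : ℕ) : K) • MultilinearMap.alternatization (tensorMul B h' (α.curryLeft x) β) v := by
  simp only [tensorMul_insertNth_left B h h']
  have : ∀ i : Fin (p + 1), (∑ e : Equiv.Perm (Fin n), (-1 : ℤ) ^ (i : ℕ) •
      (Equiv.Perm.sign e : ℤ) • (-1 : ℤ) ^ (i : ℕ) • tensorMul B h' (α.curryLeft x) β (v ∘ e)) =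
      MultilinearMap.alternatization (tensorMul B h' (α.curryLeft x) β) v := by
    intro i
    rw [MultilinearMap.alternatization_apply]
    refine Finset.sum_congr rfl fun e _ => ?_
    rw [smul_comm (Equiv.Perm.sign e : ℤ), smul_smul, ← mul_pow]
    simp [Units.smul_def, Function.comp_def]
  simp only [this, Finset.sum_const, Finset.card_univ, Fintype.card_fin, Nat.cast_smul_eq_nsmul]

theorem sum_right (B : V →ₗ[K] W →ₗ[K] Z) {p q n : ℕ} (h : p + (q + 1) = n + 1)
    (h' : p + q = n) (α : 𝔤 [⋀^Fin p]→ₗ[K] V) (β : 𝔤 [⋀^Fin (q + 1)]→ₗ[K] W)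
    (x : 𝔤) (v : Fin n → 𝔤) :
    (∑ i : Fin (q + 1), ∑ e : Equiv.Perm (Fin n), (-1 : ℤ) ^ (p + i : ℕ) •
        (Equiv.Perm.sign e : ℤ) •
        tensorMul B h α β ((Fin.cast h (Fin.natAdd p i)).insertNth x (v ∘ e))) =
      ((-1 : K) ^ p * ((q + 1 : ℕ) : K)) •
        MultilinearMap.alternatization (tensorMul B h' α (β.curryLeft x)) v := by
  simp only [tensorMul_insertNth_right B h h']
  have : ∀ i : Fin (q + 1), (∑ e : Equiv.Perm (Fin n), (-1 : ℤ) ^ (p + i : ℕ) •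
      (Equiv.Perm.sign e : ℤ) • (-1 : ℤ) ^ (i : ℕ) • tensorMul B h' α (β.curryLeft x) (v ∘ e)) =
      (-1 : K) ^ p • MultilinearMap.alternatization (tensorMul B h' α (β.curryLeft x)) v := by
    intro i
    rw [MultilinearMap.alternatization_apply, Finset.smul_sum]
    refine Finset.sum_congr rfl fun e _ => ?_
    rw [smul_comm (Equiv.Perm.sign e : ℤ), smul_smul, pow_add, mul_assoc, ← mul_pow]
    rcases Nat.even_or_odd p with hp | hp <;>
      simp [Units.smul_def, Function.comp_def, hp.neg_one_pow]
  simp only [this, Finset.sum_const, Finset.card_univ, Fintype.card_fin, ← Nat.cast_smul_eq_nsmul K]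
  rw [smul_smul, mul_comm]

variable [CharZero K]

theorem curryLeft_wedge_succ_succ (B : V →ₗ[K] W →ₗ[K] Z) {p q n : ℕ}
    (h : p + 1 + (q + 1) = n + 1) (h₁ : p + (q + 1) = n) (h₂ : p + 1 + q = n)
    (α : 𝔤 [⋀^Fin (p + 1)]→ₗ[K] V) (β : 𝔤 [⋀^Fin (q + 1)]→ₗ[K] W) (x : 𝔤) :
    (wedge B h α β).curryLeft x = wedge B h₁ (α.curryLeft x) β +
      (-1 : K) ^ (p + 1) • wedge B h₂ α (β.curryLeft x) := by
  ext v
  simp only [AlternatingMap.curryLeft_apply_apply, wedge, AlternatingMap.smul_apply, Matrix.vecCons,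
    AlternatingMap.add_apply, alternatization_tensorMul_cons]
  rw [sum_left B h h₁, sum_right B h h₂]
  have hp : ((p + 1 : ℕ) : K) ≠ 0 := by exact_mod_cast Nat.succ_ne_zero p
  have hq : ((q + 1 : ℕ) : K) ≠ 0 := by exact_mod_cast Nat.succ_ne_zero q
  have hpf : ((p.factorial : ℕ) : K) ≠ 0 := by exact_mod_cast Nat.factorial_ne_zero p
  have hqf : ((q.factorial : ℕ) : K) ≠ 0 := by exact_mod_cast Nat.factorial_ne_zero q
  simp only [Nat.factorial_succ, Nat.cast_mul, smul_add, smul_smul]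
  congr 2 <;> field_simp

theorem curryLeft_wedge_zero_succ (B : V →ₗ[K] W →ₗ[K] Z) {q n : ℕ}
    (h : 0 + (q + 1) = n + 1) (h₂ : 0 + q = n)
    (α : 𝔤 [⋀^Fin 0]→ₗ[K] V) (β : 𝔤 [⋀^Fin (q + 1)]→ₗ[K] W) (x : 𝔤) :
    (wedge B h α β).curryLeft x = wedge B h₂ α (β.curryLeft x) := by
  ext v
  simp only [AlternatingMap.curryLeft_apply_apply, wedge, AlternatingMap.smul_apply, Matrix.vecCons,
    alternatization_tensorMul_cons]
  rw [sum_right B h h₂]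
  have hq : ((q + 1 : ℕ) : K) ≠ 0 := by exact_mod_cast Nat.succ_ne_zero q
  have hqf : ((q.factorial : ℕ) : K) ≠ 0 := by exact_mod_cast Nat.factorial_ne_zero q
  simp only [Nat.factorial_succ, Nat.cast_mul, smul_smul, Finset.univ_eq_empty, Finset.sum_empty,
    zero_add]
  congr 1; simp; field_simp

theorem curryLeft_wedge_succ_zero (B : V →ₗ[K] W →ₗ[K] Z) {p n : ℕ}
    (h : p + 1 + 0 = n + 1) (h₁ : p + 0 = n)
    (α : 𝔤 [⋀^Fin (p + 1)]→ₗ[K] V) (β : 𝔤 [⋀^Fin 0]→ₗ[K] W) (x : 𝔤) :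
    (wedge B h α β).curryLeft x = wedge B h₁ (α.curryLeft x) β := by
  ext v
  simp only [AlternatingMap.curryLeft_apply_apply, wedge, AlternatingMap.smul_apply, Matrix.vecCons,
    alternatization_tensorMul_cons]
  rw [sum_left B h h₁]
  have hp : ((p + 1 : ℕ) : K) ≠ 0 := by exact_mod_cast Nat.succ_ne_zero p
  have hpf : ((p.factorial : ℕ) : K) ≠ 0 := by exact_mod_cast Nat.factorial_ne_zero p
  simp only [Nat.factorial_succ, Nat.cast_mul, smul_smul, Finset.univ_eq_empty, Finset.sum_empty,
    add_zero]
  congr 1; simp; field_simp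

theorem wedge_zero_zero (B : V →ₗ[K] W →ₗ[K] Z) (h : 0 + 0 = 0)
    (α : 𝔤 [⋀^Fin 0]→ₗ[K] V) (β : 𝔤 [⋀^Fin 0]→ₗ[K] W) (v : Fin 0 → 𝔤) :
    wedge B h α β v = B (α ![]) (β ![]) := by
  simp [wedge, MultilinearMap.alternatization_apply, tensorMul_apply, Subsingleton.elim _ ![]]

theorem wedge_add_left (B : V →ₗ[K] W →ₗ[K] Z) {p q n : ℕ} (h : p + q = n)
    (α α' : 𝔤 [⋀^Fin p]→ₗ[K] V) (β : 𝔤 [⋀^Fin q]→ₗ[K] W) :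
    wedge B h (α + α') β = wedge B h α β + wedge B h α' β := by
  have : tensorMul B h (α + α') β = tensorMul B h α β + tensorMul B h α' β := by
    ext v; simp [tensorMul_apply]
  rw [wedge, this, map_add, smul_add]; rfl

theorem wedge_add_right (B : V →ₗ[K] W →ₗ[K] Z) {p q n : ℕ} (h : p + q = n)
    (α : 𝔤 [⋀^Fin p]→ₗ[K] V) (β β' : 𝔤 [⋀^Fin q]→ₗ[K] W) :
    wedge B h α (β + β') = wedge B h α β + wedge B h α β' := by
  have : tensorMul B h α (β + β') = tensorMul B h α β + tensorMul B h α β' := by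
    ext v; simp [tensorMul_apply]
  rw [wedge, this, map_add, smul_add]; rfl

theorem wedge_smul_left (B : V →ₗ[K] W →ₗ[K] Z) {p q n : ℕ} (h : p + q = n) (c : K)
    (α : 𝔤 [⋀^Fin p]→ₗ[K] V) (β : 𝔤 [⋀^Fin q]→ₗ[K] W) :
    wedge B h (c • α) β = c • wedge B h α β := by
  ext v
  simp only [wedge, AlternatingMap.smul_apply, MultilinearMap.alternatization_apply,
    MultilinearMap.domDomCongr_apply, tensorMul_apply, map_smul, LinearMap.smul_apply]
  rw [smul_comm c]
  congr 1
  rw [Finset.smul_sum]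
  exact Finset.sum_congr rfl fun _ _ => smul_comm _ _ _

theorem wedge_smul_right (B : V →ₗ[K] W →ₗ[K] Z) {p q n : ℕ} (h : p + q = n) (c : K)
    (α : 𝔤 [⋀^Fin p]→ₗ[K] V) (β : 𝔤 [⋀^Fin q]→ₗ[K] W) :
    wedge B h α (c • β) = c • wedge B h α β := by
  ext v
  simp only [wedge, AlternatingMap.smul_apply, MultilinearMap.alternatization_apply,
    MultilinearMap.domDomCongr_apply, tensorMul_apply, map_smul, LinearMap.smul_apply]
  rw [smul_comm c]
  congr 1
  rw [Finset.smul_sum]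
  exact Finset.sum_congr rfl fun _ _ => smul_comm _ _ _

/-- The exterior product as a bilinear map. -/
noncomputable def wedgeₗ (B : V →ₗ[K] W →ₗ[K] Z) {p q n : ℕ} (h : p + q = n) :
    (𝔤 [⋀^Fin p]→ₗ[K] V) →ₗ[K] (𝔤 [⋀^Fin q]→ₗ[K] W) →ₗ[K] (𝔤 [⋀^Fin n]→ₗ[K] Z) :=
  LinearMap.mk₂ K (wedge B h) (wedge_add_left B h) (wedge_smul_left B h) (wedge_add_right B h)
    (fun c => wedge_smul_right B h c)

theorem wedgeₗ_apply (B : V →ₗ[K] W →ₗ[K] Z) {p q n : ℕ} (h : p + q = n)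
    (α : 𝔤 [⋀^Fin p]→ₗ[K] V) (β : 𝔤 [⋀^Fin q]→ₗ[K] W) :
    wedgeₗ B h α β = wedge B h α β := rfl

variable [LieRingModule 𝔤 V] [LieModule K 𝔤 V] [LieRingModule 𝔤 W] [LieModule K 𝔤 W]
  [LieRingModule 𝔤 Z] [LieModule K 𝔤 Z]

theorem lieDer_wedge (B : V →ₗ[K] W →ₗ[K] Z)
    (hB : ∀ (x : 𝔤) (v : V) (w : W), ⁅x, B v w⁆ = B ⁅x, v⁆ w + B v ⁅x, w⁆) (x : 𝔤) :
    ∀ {n p q : ℕ} (h : p + q = n) (α : 𝔤 [⋀^Fin p]→ₗ[K] V) (β : 𝔤 [⋀^Fin q]→ₗ[K] W),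
      lieDer x (wedge B h α β) = wedge B h (lieDer x α) β + wedge B h α (lieDer x β) := by
  intro n
  induction n with
  | zero =>
    intro p q h α β
    obtain rfl : p = 0 := by omega
    obtain rfl : q = 0 := by omega
    ext v
    simp [lieDer_apply, wedge_zero_zero, hB]
  | succ n ih =>
    intro p q h α β
    refine curryLeft_ext fun y => ?_
    rw [curryLeft_lieDer, AlternatingMap.curryLeft_add, LinearMap.add_apply]
    rcases p with _ | p <;> rcases q with _ | q
    · omega
    · have h₂ : 0 + q = n := by omega
      rw [curryLeft_wedge_zero_succ B h h₂, curryLeft_wedge_zero_succ B h h₂,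
        curryLeft_wedge_zero_succ B h h₂, curryLeft_wedge_zero_succ B h h₂, ih, curryLeft_lieDer]
      simp only [← wedgeₗ_apply, map_sub]
      abel
    · have h₁ : p + 0 = n := by omega
      rw [curryLeft_wedge_succ_zero B h h₁, curryLeft_wedge_succ_zero B h h₁,
        curryLeft_wedge_succ_zero B h h₁, curryLeft_wedge_succ_zero B h h₁, ih, curryLeft_lieDer]
      simp only [← wedgeₗ_apply, map_sub, LinearMap.sub_apply]
      abel
    · have h₁ : p + (q + 1) = n := by omega
      have h₂ : p + 1 + q = n := by omega
      rw [curryLeft_wedge_succ_succ B h h₁ h₂, curryLeft_wedge_succ_succ B h h₁ h₂,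
        curryLeft_wedge_succ_succ B h h₁ h₂, curryLeft_wedge_succ_succ B h h₁ h₂, lieDer_add,
        lieDer_smul, ih, ih, curryLeft_lieDer, curryLeft_lieDer]
      simp only [← wedgeₗ_apply, map_sub, LinearMap.sub_apply, smul_sub, smul_add]
      abel

/-- The Leibniz rule. -/
theorem ceD_wedge (B : V →ₗ[K] W →ₗ[K] Z)
    (hB : ∀ (x : 𝔤) (v : V) (w : W), ⁅x, B v w⁆ = B ⁅x, v⁆ w + B v ⁅x, w⁆) :
    ∀ {n p q : ℕ} (h : p + q = n) (h₁ : p + 1 + q = n + 1) (h₂ : p + (q + 1) = n + 1)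
      (α : 𝔤 [⋀^Fin p]→ₗ[K] V) (β : 𝔤 [⋀^Fin q]→ₗ[K] W),
      ceD n (wedge B h α β) = wedge B h₁ (ceD p α) β + (-1 : K) ^ p • wedge B h₂ α (ceD q β) := by
  intro n
  induction n with
  | zero =>
    intro p q h h₁ h₂ α β
    obtain rfl : p = 0 := by omega
    obtain rfl : q = 0 := by omega
    refine curryLeft_ext fun x => ?_
    rw [AlternatingMap.curryLeft_add, LinearMap.add_apply, AlternatingMap.curryLeft_smul,
      LinearMap.smul_apply, curryLeft_wedge_succ_zero B h₁ h, curryLeft_wedge_zero_succ B h₂ h,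
      curryLeft_ceD_zero, curryLeft_ceD_zero, curryLeft_ceD_zero, lieDer_wedge B hB]
    simp
  | succ n ih =>
    intro p q h h₁ h₂ α β
    refine curryLeft_ext fun x => ?_
    rw [AlternatingMap.curryLeft_add, LinearMap.add_apply, AlternatingMap.curryLeft_smul,
      LinearMap.smul_apply, curryLeft_ceD_succ, lieDer_wedge B hB]
    rcases p with _ | p <;> rcases q with _ | q
    · omega
    · have k₁ : 0 + q = n := by omega
      have k₂ : 0 + 1 + q = n + 1 := by omega
      rw [curryLeft_wedge_zero_succ B h k₁, ih k₁ k₂ h,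
        curryLeft_wedge_succ_succ B h₁ h k₂, curryLeft_wedge_zero_succ B h₂ h,
        curryLeft_ceD_zero, curryLeft_ceD_succ]
      simp only [← wedgeₗ_apply, map_sub, LinearMap.sub_apply, smul_sub, smul_add]
      simp
      abel
    · have k₁ : p + 0 = n := by omega
      have k₂ : p + (0 + 1) = n + 1 := by omega
      rw [curryLeft_wedge_succ_zero B h k₁, ih k₁ h k₂,
        curryLeft_wedge_succ_zero B h₁ h, curryLeft_wedge_succ_succ B h₂ k₂ h,
        curryLeft_ceD_zero, curryLeft_ceD_succ]
      simp only [← wedgeₗ_apply, map_sub, LinearMap.sub_apply, smul_sub, smul_add, smul_smul]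
      rw [← pow_add, Even.neg_one_pow (⟨p + 1, rfl⟩ : Even (p + 1 + (p + 1)))]
      rw [pow_succ]
      simp
      abel
    · have k₁ : p + (q + 1) = n := by omega
      have k₂ : p + 1 + q = n := by omega
      have k₃ : p + (q + 1 + 1) = n + 1 := by omega
      have k₄ : p + 1 + 1 + q = n + 1 := by omega
      rw [curryLeft_wedge_succ_succ B h k₁ k₂, map_add, map_smul, ih k₁ h k₃, ih k₂ k₄ h,
        curryLeft_wedge_succ_succ B h₁ h k₄, curryLeft_wedge_succ_succ B h₂ k₃ h,
        curryLeft_ceD_succ, curryLeft_ceD_succ]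
      simp only [← wedgeₗ_apply, map_sub, LinearMap.sub_apply, smul_sub, smul_add, smul_smul]
      rw [← pow_add, Even.neg_one_pow (⟨p + 1, rfl⟩ : Even (p + 1 + (p + 1)))]
      simp only [pow_succ]
      simp
      abel

end Wedge

section Relative

variable {K 𝔤 : Type*} [Field K] [LieRing 𝔤] [LieAlgebra K 𝔤] (𝔨 : LieSubalgebra K 𝔤)
variable (V : Type*) [AddCommGroup V] [Module K V] [LieRingModule 𝔤 V] [LieModule K 𝔤 V]

/-- The relative cochains `Cⁿ(𝔤, 𝔨; V) = Hom_𝔨(Λⁿ(𝔤/𝔨), V)`: the alternating maps `𝔤ⁿ → V` that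
vanish as soon as one argument is in `𝔨` and that are `𝔨`-equivariant. -/
def relCochain (n : ℕ) : Submodule K (𝔤 [⋀^Fin n]→ₗ[K] V) where
  carrier := {α | (∀ v : Fin n → 𝔤, (∃ i, v i ∈ 𝔨) → α v = 0) ∧ ∀ x ∈ 𝔨, lieDer x α = 0}
  zero_mem' := ⟨fun _ _ => rfl, fun x _ => by ext v; simp [lieDer_apply]⟩
  add_mem' := fun {α β} hα hβ => ⟨fun v hv => by simp [hα.1 v hv, hβ.1 v hv],
    fun x hx => by rw [lieDer_add, hα.2 x hx, hβ.2 x hx, add_zero]⟩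
  smul_mem' := fun c α hα => ⟨fun v hv => by simp [hα.1 v hv],
    fun x hx => by rw [lieDer_smul, hα.2 x hx, smul_zero]⟩

variable {V} in
theorem mem_relCochain {n : ℕ} {α : 𝔤 [⋀^Fin n]→ₗ[K] V} : α ∈ relCochain 𝔨 V n ↔
    (∀ v : Fin n → 𝔤, (∃ i, v i ∈ 𝔨) → α v = 0) ∧ ∀ x ∈ 𝔨, lieDer x α = 0 := Iff.rfl

variable {V} in
theorem vanish_of_curryLeft {n : ℕ} {α : 𝔤 [⋀^Fin (n + 1)]→ₗ[K] V}
    (h : ∀ x ∈ 𝔨, α.curryLeft x = 0) (v : Fin (n + 1) → 𝔤) (hv : ∃ i, v i ∈ 𝔨) : α v = 0 := by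
  have h0 : ∀ w : Fin (n + 1) → 𝔤, w 0 ∈ 𝔨 → α w = 0 := by
    intro w hw
    have := congrArg (fun γ : 𝔤 [⋀^Fin n]→ₗ[K] V => γ (Fin.tail w)) (h _ hw)
    simpa [AlternatingMap.curryLeft_apply_apply, Matrix.vecCons] using this
  obtain ⟨i, hi⟩ := hv
  by_cases hi0 : i = 0
  · exact h0 v (hi0 ▸ hi)
  · have := α.map_swap v (i := 0) (j := i) (Ne.symm hi0)
    rw [h0 _ (by simpa using hi)] at this
    exact neg_eq_zero.mp this.symm

variable {V} in
theorem curryLeft_eq_zero {n : ℕ} {α : 𝔤 [⋀^Fin (n + 1)]→ₗ[K] V} (hα : α ∈ relCochain 𝔨 V (n + 1))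
    {x : 𝔤} (hx : x ∈ 𝔨) : α.curryLeft x = 0 := by
  ext v
  exact hα.1 _ ⟨0, hx⟩

variable {V} in
theorem ceD_mem {n : ℕ} {α : 𝔤 [⋀^Fin n]→ₗ[K] V} (hα : α ∈ relCochain 𝔨 V n) :
    ceD n α ∈ relCochain 𝔨 V (n + 1) := by
  refine ⟨vanish_of_curryLeft 𝔨 fun x hx => ?_, fun x hx => ?_⟩
  · cases n with
    | zero => rw [curryLeft_ceD_zero, hα.2 x hx]
    | succ n => rw [curryLeft_ceD_succ, hα.2 x hx, curryLeft_eq_zero 𝔨 hα hx, map_zero, sub_zero]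
  · rw [← ceD_lieDer, hα.2 x hx, map_zero]

/-- Relative cocycles. -/
def relZ (n : ℕ) : Submodule K (𝔤 [⋀^Fin n]→ₗ[K] V) := relCochain 𝔨 V n ⊓ LinearMap.ker (ceD n)

/-- Relative coboundaries. -/
def relB : (n : ℕ) → Submodule K (𝔤 [⋀^Fin n]→ₗ[K] V)
  | 0 => ⊥
  | n + 1 => (relCochain 𝔨 V n).map (ceD n)

theorem relB_le_relZ : ∀ n : ℕ, relB 𝔨 V n ≤ relZ 𝔨 V n
  | 0 => bot_le
  | n + 1 => by
    rintro _ ⟨α, hα, rfl⟩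
    exact ⟨ceD_mem 𝔨 hα, ceD_ceD α⟩

/-- The relative Chevalley–Eilenberg cohomology `Hⁿ_CE(𝔤, 𝔨; V)`. -/
abbrev HCE (n : ℕ) : Type _ := relZ 𝔨 V n ⧸ (relB 𝔨 V n).comap (relZ 𝔨 V n).subtype

variable {V}
variable {W Z : Type*} [AddCommGroup W] [Module K W] [LieRingModule 𝔤 W] [LieModule K 𝔤 W]
  [AddCommGroup Z] [Module K Z] [LieRingModule 𝔤 Z] [LieModule K 𝔤 Z] [CharZero K]

theorem wedge_mem (B : V →ₗ[K] W →ₗ[K] Z)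
    (hB : ∀ (x : 𝔤) (v : V) (w : W), ⁅x, B v w⁆ = B ⁅x, v⁆ w + B v ⁅x, w⁆)
    {p q n : ℕ} (h : p + q = n) {α : 𝔤 [⋀^Fin p]→ₗ[K] V} {β : 𝔤 [⋀^Fin q]→ₗ[K] W}
    (hα : α ∈ relCochain 𝔨 V p) (hβ : β ∈ relCochain 𝔨 W q) :
    wedge B h α β ∈ relCochain 𝔨 Z n := by
  refine ⟨?_, fun x hx => ?_⟩
  · rintro v ⟨i, hi⟩
    rw [wedge, AlternatingMap.smul_apply, MultilinearMap.alternatization_apply]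
    rw [Finset.sum_eq_zero, smul_zero]
    intro σ _
    rw [MultilinearMap.domDomCongr_apply, tensorMul_apply]
    obtain ⟨j, rfl⟩ := σ.surjective i
    obtain ⟨j, rfl⟩ := (finSumFinEquiv.trans (finCongr h)).surjective j
    rcases j with j | j
    · rw [hα.1 _ ⟨j, hi⟩]; simp
    · rw [hβ.1 _ ⟨j, hi⟩]; simp
  · rw [lieDer_wedge B hB, hα.2 x hx, hβ.2 x hx, ← wedgeₗ_apply, ← wedgeₗ_apply]
    simp

theorem wedge_mem_relZ (B : V →ₗ[K] W →ₗ[K] Z)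
    (hB : ∀ (x : 𝔤) (v : V) (w : W), ⁅x, B v w⁆ = B ⁅x, v⁆ w + B v ⁅x, w⁆)
    {p q n : ℕ} (h : p + q = n) {α : 𝔤 [⋀^Fin p]→ₗ[K] V} {β : 𝔤 [⋀^Fin q]→ₗ[K] W}
    (hα : α ∈ relZ 𝔨 V p) (hβ : β ∈ relZ 𝔨 W q) : wedge B h α β ∈ relZ 𝔨 Z n := by
  refine ⟨wedge_mem 𝔨 B hB h hα.1 hβ.1, ?_⟩
  have h1 : ceD p α = 0 := hα.2
  have h2 : ceD q β = 0 := hβ.2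
  change ceD n (wedge B h α β) = 0
  rw [ceD_wedge B hB h (by omega) (by omega), h1, h2, ← wedgeₗ_apply, ← wedgeₗ_apply]
  simp

theorem wedge_mem_relB_left (B : V →ₗ[K] W →ₗ[K] Z)
    (hB : ∀ (x : 𝔤) (v : V) (w : W), ⁅x, B v w⁆ = B ⁅x, v⁆ w + B v ⁅x, w⁆)
    {p q n : ℕ} (h : p + q = n) {α : 𝔤 [⋀^Fin p]→ₗ[K] V} {β : 𝔤 [⋀^Fin q]→ₗ[K] W}
    (hα : α ∈ relB 𝔨 V p) (hβ : β ∈ relZ 𝔨 W q) : wedge B h α β ∈ relB 𝔨 Z n := by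
  have h2 : ceD q β = 0 := hβ.2
  cases p with
  | zero =>
    rw [(Submodule.mem_bot K).mp hα, ← wedgeₗ_apply, map_zero]
    exact Submodule.zero_mem _
  | succ p =>
    obtain ⟨γ, hγ, rfl⟩ := hα
    obtain ⟨m, rfl⟩ : ∃ m, n = m + 1 := ⟨p + q, by omega⟩
    have hm : p + q = m := by omega
    refine ⟨wedge B hm γ β, wedge_mem 𝔨 B hB hm hγ hβ.1, ?_⟩
    rw [ceD_wedge B hB hm h (by omega), h2, ← wedgeₗ_apply, ← wedgeₗ_apply]
    simp

theorem wedge_mem_relB_right (B : V →ₗ[K] W →ₗ[K] Z)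
    (hB : ∀ (x : 𝔤) (v : V) (w : W), ⁅x, B v w⁆ = B ⁅x, v⁆ w + B v ⁅x, w⁆)
    {p q n : ℕ} (h : p + q = n) {α : 𝔤 [⋀^Fin p]→ₗ[K] V} {β : 𝔤 [⋀^Fin q]→ₗ[K] W}
    (hα : α ∈ relZ 𝔨 V p) (hβ : β ∈ relB 𝔨 W q) : wedge B h α β ∈ relB 𝔨 Z n := by
  have h1 : ceD p α = 0 := hα.2
  cases q with
  | zero =>
    rw [(Submodule.mem_bot K).mp hβ, ← wedgeₗ_apply, map_zero]
    exact Submodule.zero_mem _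
  | succ q =>
    obtain ⟨γ, hγ, rfl⟩ := hβ
    obtain ⟨m, rfl⟩ : ∃ m, n = m + 1 := ⟨p + q, by omega⟩
    have hm : p + q = m := by omega
    refine ⟨(-1 : K) ^ p • wedge B hm α γ,
      Submodule.smul_mem _ _ (wedge_mem 𝔨 B hB hm hα.1 hγ), ?_⟩
    rw [map_smul, ceD_wedge B hB hm (by omega) h, h1, ← wedgeₗ_apply, ← wedgeₗ_apply]
    simp [smul_smul, ← mul_pow]

/-- The cohomology class of the exterior product of two relative cocycles. -/
noncomputable def cupZ (B : V →ₗ[K] W →ₗ[K] Z)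
    (hB : ∀ (x : 𝔤) (v : V) (w : W), ⁅x, B v w⁆ = B ⁅x, v⁆ w + B v ⁅x, w⁆)
    {p q n : ℕ} (h : p + q = n) : relZ 𝔨 V p →ₗ[K] relZ 𝔨 W q →ₗ[K] HCE 𝔨 Z n :=
  LinearMap.mk₂ K
    (fun α β => Submodule.Quotient.mk ⟨wedge B h α.1 β.1, wedge_mem_relZ 𝔨 B hB h α.2 β.2⟩)
    (fun α α' β => congrArg Submodule.Quotient.mk (Subtype.ext (wedge_add_left B h α.1 α'.1 β.1)))
    (fun c α β => congrArg Submodule.Quotient.mk (Subtype.ext (wedge_smul_left B h c α.1 β.1)))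
    (fun α β β' => congrArg Submodule.Quotient.mk (Subtype.ext (wedge_add_right B h α.1 β.1 β'.1)))
    (fun c α β => congrArg Submodule.Quotient.mk (Subtype.ext (wedge_smul_right B h c α.1 β.1)))

/-- The cup product `H^p_CE(𝔤, 𝔨; V) × H^q_CE(𝔤, 𝔨; W) → H^{p+q}_CE(𝔤, 𝔨; Z)` induced by the
exterior product of cochains, for a `𝔤`-invariant bilinear map `B : V × W → Z`. -/
noncomputable def cupHCE (B : V →ₗ[K] W →ₗ[K] Z)
    (hB : ∀ (x : 𝔤) (v : V) (w : W), ⁅x, B v w⁆ = B ⁅x, v⁆ w + B v ⁅x, w⁆)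
    {p q n : ℕ} (h : p + q = n) : HCE 𝔨 V p →ₗ[K] HCE 𝔨 W q →ₗ[K] HCE 𝔨 Z n :=
  Submodule.liftQ _
    (LinearMap.flip (Submodule.liftQ _ (LinearMap.flip (cupZ 𝔨 B hB h)) fun β hβ => by
      refine LinearMap.ext fun α => (Submodule.Quotient.mk_eq_zero _).mpr ?_
      exact wedge_mem_relB_right 𝔨 B hB h α.2 hβ)) fun α hα => by
    refine LinearMap.ext fun b => ?_
    obtain ⟨β, rfl⟩ := Submodule.Quotient.mk_surjective _ b
    exact (Submodule.Quotient.mk_eq_zero _).mpr (wedge_mem_relB_left 𝔨 B hB h hα β.2)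

theorem cupHCE_mk (B : V →ₗ[K] W →ₗ[K] Z)
    (hB : ∀ (x : 𝔤) (v : V) (w : W), ⁅x, B v w⁆ = B ⁅x, v⁆ w + B v ⁅x, w⁆)
    {p q n : ℕ} (h : p + q = n) (α : relZ 𝔨 V p) (β : relZ 𝔨 W q) :
    cupHCE 𝔨 B hB h (Submodule.Quotient.mk α) (Submodule.Quotient.mk β) =
      Submodule.Quotient.mk ⟨wedge B h α.1 β.1, wedge_mem_relZ 𝔨 B hB h α.2 β.2⟩ := rfl

end Relative

section Functoriality

variable {K 𝔤 V W : Type*} [Field K] [LieRing 𝔤] [LieAlgebra K 𝔤]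
  [AddCommGroup V] [Module K V] [LieRingModule 𝔤 V] [LieModule K 𝔤 V]
  [AddCommGroup W] [Module K W] [LieRingModule 𝔤 W] [LieModule K 𝔤 W]

theorem lieDer_comp (f : V →ₗ[K] W) (hf : ∀ (x : 𝔤) (v : V), f ⁅x, v⁆ = ⁅x, f v⁆) {n : ℕ} (x : 𝔤)
    (α : 𝔤 [⋀^Fin n]→ₗ[K] V) :
    lieDer x (f.compAlternatingMap α) = f.compAlternatingMap (lieDer x α) := by
  ext v; simp [lieDer_apply, hf]

theorem ceD_comp (f : V →ₗ[K] W) (hf : ∀ (x : 𝔤) (v : V), f ⁅x, v⁆ = ⁅x, f v⁆) {n : ℕ}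
    (α : 𝔤 [⋀^Fin n]→ₗ[K] V) :
    ceD n (f.compAlternatingMap α) = f.compAlternatingMap (ceD n α) := by
  ext v
  simp only [ceD_apply, LinearMap.compAlternatingMap_apply, ceFun, map_sum, map_zsmul, map_sub, hf]

theorem comp_mem (𝔨 : LieSubalgebra K 𝔤) (f : V →ₗ[K] W)
    (hf : ∀ (x : 𝔤) (v : V), f ⁅x, v⁆ = ⁅x, f v⁆) {n : ℕ}
    {α : 𝔤 [⋀^Fin n]→ₗ[K] V} (hα : α ∈ relCochain 𝔨 V n) :
    f.compAlternatingMap α ∈ relCochain 𝔨 W n :=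
  ⟨fun v hv => by simp [hα.1 v hv], fun x hx => by rw [lieDer_comp f hf, hα.2 x hx]; ext; simp⟩

end Functoriality

section LocFin

variable (K 𝔨 : Type*) [Field K] [LieRing 𝔨] [LieAlgebra K 𝔨]

/-- A locally finite semisimple `𝔨`-module, i.e. a direct sum of finite dimensional simple ones. -/
structure IsLocFinSemisimple (M : Type*) [AddCommGroup M] [Module K M] [LieRingModule 𝔨 M]
    [LieModule K 𝔨 M] : Prop where
  semisimple : ComplementedLattice (LieSubmodule K 𝔨 M)
  locallyFinite : ∀ m : M, ∃ N : LieSubmodule K 𝔨 M, m ∈ N ∧ FiniteDimensional K N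

variable {K 𝔨} {M N : Type*} [AddCommGroup M] [Module K M] [LieRingModule 𝔨 M] [LieModule K 𝔨 M]
  [AddCommGroup N] [Module K N] [LieRingModule 𝔨 N] [LieModule K 𝔨 N]

theorem IsLocFinSemisimple.of_injective (f : M →ₗ⁅K,𝔨⁆ N) (hf : Function.Injective f)
    (h : IsLocFinSemisimple K 𝔨 N) : IsLocFinSemisimple K 𝔨 M where
  semisimple := by
    refine ⟨fun P => ?_⟩
    obtain ⟨C, hC⟩ := h.semisimple.exists_isCompl (P.map f)
    refine ⟨C.comap f, ?_, ?_⟩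
    · rw [disjoint_iff, eq_bot_iff]
      rintro x ⟨hx, hx'⟩
      have : f x ∈ P.map f ⊓ C := ⟨⟨x, hx, rfl⟩, hx'⟩
      rw [hC.inf_eq_bot] at this
      exact (LieSubmodule.mem_bot _).mpr (hf (by simpa using this))
    · rw [codisjoint_iff, eq_top_iff]
      rintro x -
      have : f x ∈ P.map f ⊔ C := by rw [hC.sup_eq_top]; trivial
      obtain ⟨y, ⟨p, hp, rfl⟩, c, hc, hyc⟩ := (LieSubmodule.mem_sup _ _ _).mp this
      refine (LieSubmodule.mem_sup _ _ _).mpr ⟨p, hp, x - p, ?_, by abel⟩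
      have : f (x - p) = c := by rw [map_sub, ← hyc]; exact add_sub_cancel_left _ _
      simpa [this] using hc
  locallyFinite m := by
    obtain ⟨P, hP, hfin⟩ := h.locallyFinite (f m)
    refine ⟨P.comap f, hP, ?_⟩
    let g : (P.comap f) →ₗ[K] P :=
      (f : M →ₗ[K] N).restrict (p := (P.comap f : Submodule K M)) (q := (P : Submodule K N))
        fun x hx => hx
    exact FiniteDimensional.of_injective g fun x y hxy => Subtype.ext (hf (congrArg Subtype.val hxy))

theorem map_atom (f : M →ₗ⁅K,𝔨⁆ N) {A : LieSubmodule K 𝔨 M} (hA : IsAtom A) :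
    A.map f = ⊥ ∨ IsAtom (A.map f) := by
  by_cases h0 : A.map f = ⊥
  · exact Or.inl h0
  refine Or.inr ⟨h0, fun B hB => ?_⟩
  rcases hA.le_iff.mp (inf_le_right : B.comap f ⊓ A ≤ A) with h | h
  · rw [eq_bot_iff]
    intro b hb
    obtain ⟨a, ha, rfl⟩ := hB.le hb
    have : a ∈ B.comap f ⊓ A := ⟨hb, ha⟩
    rw [h] at this
    rw [(LieSubmodule.mem_bot a).mp this, map_zero]
    exact LieSubmodule.zero_mem _
  · exfalso
    apply hB.not_ge
    rintro _ ⟨a, ha, rfl⟩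
    have : a ∈ B.comap f ⊓ A := by rw [h]; exact ha
    exact this.1

/-- A module generated by the images of locally finite semisimple modules is locally finite
semisimple. -/
theorem IsLocFinSemisimple.of_iSup {ι : Type*} {P : ι → Type*} [∀ i, AddCommGroup (P i)]
    [∀ i, Module K (P i)] [∀ i, LieRingModule 𝔨 (P i)] [∀ i, LieModule K 𝔨 (P i)]
    (f : ∀ i, P i →ₗ⁅K,𝔨⁆ M) (hf : ⨆ i, (f i).range = ⊤)
    (h : ∀ i, IsLocFinSemisimple K 𝔨 (P i)) : IsLocFinSemisimple K 𝔨 M where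
  semisimple := by
    apply complementedLattice_of_sSup_atoms_eq_top
    rw [eq_top_iff, ← hf]
    refine iSup_le fun i => ?_
    have := (h i).semisimple
    have key : (⊤ : LieSubmodule K 𝔨 (P i)) ≤
        (sSup {a : LieSubmodule K 𝔨 M | IsAtom a}).comap (f i) := by
      rw [← sSup_atoms_eq_top]
      refine sSup_le fun A hA => ?_
      rw [← LieSubmodule.map_le_iff_le_comap]
      rcases map_atom (f i) hA with h0 | h0
      · rw [h0]; exact bot_le
      · exact le_sSup h0
    rintro _ ⟨x, rfl⟩
    exact key (LieSubmodule.mem_top x)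
  locallyFinite m := by
    have hm : m ∈ ⨆ i, (f i).range := by rw [hf]; trivial
    refine LieSubmodule.iSup_induction (fun i => (f i).range)
      (motive := fun m => ∃ N : LieSubmodule K 𝔨 M, m ∈ N ∧ FiniteDimensional K N) hm ?_ ?_ ?_
    · rintro i _ ⟨x, rfl⟩
      obtain ⟨Q, hQ, hfin⟩ := (h i).locallyFinite x
      refine ⟨Q.map (f i), ⟨x, hQ, rfl⟩, ?_⟩
      have : FiniteDimensional K ((Q : Submodule K (P i)).map (f i : P i →ₗ[K] M)) := inferInstance
      rw [← LieSubmodule.toSubmodule_map] at this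
      exact this
    · exact ⟨⊥, LieSubmodule.zero_mem _, inferInstanceAs (FiniteDimensional K (⊥ : Submodule K M))⟩
    · rintro x y ⟨Q, hQ, hfin⟩ ⟨Q', hQ', hfin'⟩
      refine ⟨Q ⊔ Q', add_mem ((le_sup_left : Q ≤ Q ⊔ Q') hQ)
        ((le_sup_right : Q' ≤ Q ⊔ Q') hQ'), ?_⟩
      have : FiniteDimensional K ((Q : Submodule K M) ⊔ (Q' : Submodule K M) : Submodule K M) :=
        Submodule.finiteDimensional_sup _ _
      rw [← LieSubmodule.sup_toSubmodule] at this
      exact this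

end LocFin

section Category

variable (K 𝔤 : Type u) [Field K] [LieRing 𝔤] [LieAlgebra K 𝔤] (𝔨 : LieSubalgebra K 𝔤)

/-- The universal enveloping algebra; `𝔤`-modules are treated as `U(𝔤)`-modules. -/
abbrev U : Type u := UniversalEnvelopingAlgebra K 𝔤

variable {K 𝔤}

section
attribute [local instance 100] LieRing.ofAssociativeRing

theorem ι_lie (x y : 𝔤) : UniversalEnvelopingAlgebra.ι K ⁅x, y⁆ =
    UniversalEnvelopingAlgebra.ι K x * UniversalEnvelopingAlgebra.ι K y -
      UniversalEnvelopingAlgebra.ι K y * UniversalEnvelopingAlgebra.ι K x := by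
  rw [LieHom.map_lie, LieRing.of_associative_ring_bracket]

end

instance moduleK (M : ModuleCat.{u} (U K 𝔤)) : Module K M := ModuleCat.moduleOfAlgebraModule M

instance towerK (M : ModuleCat.{u} (U K 𝔤)) : IsScalarTower K (U K 𝔤) M :=
  ModuleCat.isScalarTower_of_algebra_moduleCat M

/-- The underlying `𝔤`-module of a `U(𝔤)`-module. -/
instance lieRingModuleU (M : ModuleCat.{u} (U K 𝔤)) : LieRingModule 𝔤 M where
  bracket x m := UniversalEnvelopingAlgebra.ι K x • m
  add_lie x y m := by change _ • _ = _ • _ + _ • _; rw [map_add, add_smul]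
  lie_add x m n := smul_add _ _ _
  leibniz_lie x y m := by
    change _ • _ • _ = _ • _ + _ • _ • _
    rw [ι_lie, sub_smul, mul_smul, mul_smul]
    abel

theorem lie_def (M : ModuleCat.{u} (U K 𝔤)) (x : 𝔤) (m : M) :
    ⁅x, m⁆ = UniversalEnvelopingAlgebra.ι K x • m := rfl

instance lieModuleU (M : ModuleCat.{u} (U K 𝔤)) : LieModule K 𝔤 M where
  smul_lie c x m := by simp only [lie_def, map_smul, smul_assoc]
  lie_smul c x m := by
    simp only [lie_def]
    rw [← algebraMap_smul (U K 𝔤) c m, ← algebraMap_smul (U K 𝔤) c (_ • m), smul_smul, smul_smul,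
      Algebra.commutes]

/-- The restriction to `𝔨` of a morphism of `𝔤`-modules. -/
def resHom {M N : ModuleCat.{u} (U K 𝔤)} (f : M ⟶ N) : M →ₗ⁅K,𝔨⁆ N :=
  { f.hom.restrictScalars K with map_lie' := fun {_ m} => f.hom.map_smul _ m }

/-- `(𝔤, 𝔨)`-modules: the `𝔤`-modules that are locally finite and semisimple over `𝔨`. -/
def isGK : ObjectProperty (ModuleCat.{u} (U K 𝔤)) := fun M => IsLocFinSemisimple K 𝔨 M

/-- The category of `(𝔤, 𝔨)`-modules. -/
abbrev GKMod : Type (u + 1) := (isGK 𝔨).FullSubcategory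

theorem isGK_of_iSup {ι : Type*} {P : ι → ModuleCat.{u} (U K 𝔤)} {M : ModuleCat.{u} (U K 𝔤)}
    (f : ∀ i, P i ⟶ M) (hf : ⨆ i, LinearMap.range (f i).hom = ⊤) (h : ∀ i, isGK 𝔨 (P i)) :
    isGK 𝔨 M := by
  refine IsLocFinSemisimple.of_iSup (fun i => resHom 𝔨 (f i)) ?_ h
  rw [eq_top_iff]
  rintro m -
  have hm : m ∈ ⨆ i, LinearMap.range (f i).hom := by rw [hf]; trivial
  refine Submodule.iSup_induction (fun i => LinearMap.range (f i).hom)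
    (motive := fun m => m ∈ ⨆ i, (resHom 𝔨 (f i)).range) hm ?_ ?_ ?_
  · rintro i _ ⟨x, rfl⟩
    exact (le_iSup (fun i => (resHom 𝔨 (f i)).range) i) ⟨x, rfl⟩
  · exact LieSubmodule.zero_mem _
  · intro x y hx hy
    exact add_mem hx hy

instance : (isGK 𝔨).IsClosedUnderSubobjects where
  prop_of_mono f hf hY := IsLocFinSemisimple.of_injective (resHom 𝔨 f)
    ((ModuleCat.mono_iff_injective f).mp hf) hY

instance : (isGK 𝔨).IsClosedUnderQuotients where
  prop_of_epi {X Y} f hf hX := isGK_of_iSup 𝔨 (ι := Unit) (fun _ => f)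
    (by rw [iSup_const]; exact LinearMap.range_eq_top.mpr ((ModuleCat.epi_iff_surjective f).mp hf))
    fun _ => hX

instance : (isGK 𝔨).ContainsZero where
  exists_zero := ⟨ModuleCat.of (U K 𝔤) PUnit, ModuleCat.isZero_of_subsingleton _,
    isGK_of_iSup 𝔨 (ι := PEmpty.{1}) (P := fun i => i.elim) (fun i => i.elim)
      (Subsingleton.elim (α := Submodule (U K 𝔤) PUnit.{u + 1}) _ _) (fun i => i.elim)⟩

instance : (isGK 𝔨).IsClosedUnderFiniteProducts where
  isClosedUnderLimitsOfShape J _ := by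
    refine ⟨?_⟩
    rintro X ⟨p⟩
    classical
    have hpi : isGK 𝔨 (ModuleCat.of (U K 𝔤) (∀ j : J, p.diag.obj ⟨j⟩)) :=
      isGK_of_iSup 𝔨 (P := fun j : J => p.diag.obj ⟨j⟩)
        (fun j => ModuleCat.ofHom (LinearMap.single (U K 𝔤) (fun j : J => p.diag.obj ⟨j⟩) j))
        (LinearMap.iSup_range_single (R := U K 𝔤) (φ := fun j : J => p.diag.obj ⟨j⟩))
        fun j => p.prop_diag_obj ⟨j⟩
    let g : X ⟶ ModuleCat.of (U K 𝔤) (∀ j : J, p.diag.obj ⟨j⟩) :=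
      ModuleCat.ofHom (LinearMap.pi fun j => (p.π.app ⟨j⟩).hom)
    have : Mono g := by
      refine ⟨fun {Y} a b hab => p.isLimit.hom_ext fun ⟨j⟩ => ?_⟩
      ext y
      exact congrFun (congrArg (fun h : Y ⟶ _ => h.hom y) hab) j
    exact (isGK 𝔨).prop_of_mono g hpi

noncomputable instance : Abelian (GKMod 𝔨) := inferInstance

end Category

section Resolution

variable {K 𝔤 : Type u} [Field K] [LieRing 𝔤] [LieAlgebra K 𝔤] (𝔨 : LieSubalgebra K 𝔤)

/-- The largest `(𝔤, 𝔨)`-submodule of a `𝔤`-module (its `𝔨`-finite part). -/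
def gkPart (M : ModuleCat.{u} (U K 𝔤)) : Submodule (U K 𝔤) M :=
  sSup {N : Submodule (U K 𝔤) M | isGK 𝔨 (ModuleCat.of (U K 𝔤) N)}

theorem isGK_gkPart (M : ModuleCat.{u} (U K 𝔤)) :
    isGK 𝔨 (ModuleCat.of (U K 𝔤) (gkPart 𝔨 M)) := by
  let S := {N : Submodule (U K 𝔤) M // isGK 𝔨 (ModuleCat.of (U K 𝔤) N)}
  have hle : ∀ N : S, N.1 ≤ gkPart 𝔨 M := fun N => le_sSup N.2
  refine isGK_of_iSup 𝔨 (ι := S) (P := fun N => ModuleCat.of (U K 𝔤) N.1)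
    (fun N => ModuleCat.ofHom (Submodule.inclusion (hle N))) ?_ fun N => N.2
  apply Submodule.map_injective_of_injective (gkPart 𝔨 M).injective_subtype
  rw [Submodule.map_iSup, Submodule.map_top, Submodule.range_subtype]
  change _ = sSup _
  rw [sSup_eq_iSup']
  refine iSup_congr fun N => ?_
  rw [← LinearMap.range_comp]
  exact Submodule.range_subtype N.1

theorem range_le_gkPart {X M : ModuleCat.{u} (U K 𝔤)} (hX : isGK 𝔨 X) (f : X ⟶ M) :
    LinearMap.range f.hom ≤ gkPart 𝔨 M := by
  refine le_sSup ?_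
  let g : X ⟶ ModuleCat.of (U K 𝔤) (LinearMap.range f.hom) := ModuleCat.ofHom f.hom.rangeRestrict
  have : Epi g := (ModuleCat.epi_iff_surjective g).mpr f.hom.surjective_rangeRestrict
  exact (isGK 𝔨).prop_of_epi g hX

/-- The largest `(𝔤, 𝔨)`-submodule, as a `(𝔤, 𝔨)`-module. -/
def gkObj (M : ModuleCat.{u} (U K 𝔤)) : GKMod 𝔨 :=
  ⟨ModuleCat.of (U K 𝔤) (gkPart 𝔨 M), isGK_gkPart 𝔨 M⟩

/-- A morphism from a `(𝔤, 𝔨)`-module to a `𝔤`-module lands in the largest `(𝔤, 𝔨)`-submodule. -/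
def gkLift {X : GKMod 𝔨} {M : ModuleCat.{u} (U K 𝔤)} (f : X.obj ⟶ M) : X ⟶ gkObj 𝔨 M :=
  ObjectProperty.homMk (ModuleCat.ofHom (f.hom.codRestrict (gkPart 𝔨 M)
    fun x => range_le_gkPart 𝔨 X.property f ⟨x, rfl⟩))

/-- The inclusion of the largest `(𝔤, 𝔨)`-submodule. -/
def gkIncl (M : ModuleCat.{u} (U K 𝔤)) : (gkObj 𝔨 M).obj ⟶ M :=
  ModuleCat.ofHom (gkPart 𝔨 M).subtype

theorem gkLift_incl {X : GKMod 𝔨} {M : ModuleCat.{u} (U K 𝔤)} (f : X.obj ⟶ M) :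
    (gkLift 𝔨 f).hom ≫ gkIncl 𝔨 M = f := rfl

theorem gkHom_ext {X : GKMod 𝔨} {M : ModuleCat.{u} (U K 𝔤)} {f g : X ⟶ gkObj 𝔨 M}
    (h : f.hom ≫ gkIncl 𝔨 M = g.hom ≫ gkIncl 𝔨 M) : f = g := by
  apply ObjectProperty.hom_ext
  ext x
  exact Subtype.ext (congrArg (fun k : X.obj ⟶ M => k.hom x) h)

/-- The functoriality of the largest `(𝔤, 𝔨)`-submodule. -/
def gkMap {M N : ModuleCat.{u} (U K 𝔤)} (f : M ⟶ N) : gkObj 𝔨 M ⟶ gkObj 𝔨 N :=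
  gkLift 𝔨 (gkIncl 𝔨 M ≫ f)

/-- `Hom_K(U(𝔤), V)`. -/
def Coeff (V : ModuleCat.{u} (U K 𝔤)) : Type u := U K 𝔤 →ₗ[K] V

variable (V : ModuleCat.{u} (U K 𝔤))

instance : AddCommGroup (Coeff V) := inferInstanceAs (AddCommGroup (U K 𝔤 →ₗ[K] V))
instance : Module K (Coeff V) := inferInstanceAs (Module K (U K 𝔤 →ₗ[K] V))
instance : FunLike (Coeff V) (U K 𝔤) V := inferInstanceAs (FunLike (U K 𝔤 →ₗ[K] V) (U K 𝔤) V)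
instance : LinearMapClass (Coeff V) K (U K 𝔤) V :=
  inferInstanceAs (LinearMapClass (U K 𝔤 →ₗ[K] V) K (U K 𝔤) V)

variable {V}

@[ext] theorem Coeff.ext {F G : Coeff V} (h : ∀ u, F u = G u) : F = G := LinearMap.ext h
@[simp] theorem Coeff.add_apply (F G : Coeff V) (u : U K 𝔤) : (F + G) u = F u + G u := rfl
@[simp] theorem Coeff.smul_apply (c : K) (F : Coeff V) (u : U K 𝔤) : (c • F) u = c • F u := rfl
@[simp] theorem Coeff.zero_apply (u : U K 𝔤) : (0 : Coeff V) u = 0 := rfl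

/-- The action `(x · F)(u) = x · F(u) - F(x u)` of `𝔤` on `Hom_K(U(𝔤), V)`. -/
instance : LieRingModule 𝔤 (Coeff V) where
  bracket x F := (LieModule.toEnd K 𝔤 V x ∘ₗ F - F ∘ₗ LinearMap.mulLeft K
    (UniversalEnvelopingAlgebra.ι K x) : U K 𝔤 →ₗ[K] V)
  add_lie x y F := by
    refine LinearMap.ext fun u => ?_
    change ⁅x + y, F u⁆ - F (_ * u) = (⁅x, F u⁆ - F (_ * u)) + (⁅y, F u⁆ - F (_ * u))
    rw [map_add, add_mul, map_add, add_lie]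
    abel
  lie_add x F G := by
    refine LinearMap.ext fun u => ?_
    change ⁅x, F u + G u⁆ - (F (_ * u) + G (_ * u)) =
      (⁅x, F u⁆ - F (_ * u)) + (⁅x, G u⁆ - G (_ * u))
    rw [lie_add]
    abel
  leibniz_lie x y F := by
    refine LinearMap.ext fun u => ?_
    change ⁅x, ⁅y, F u⁆ - F (_ * u)⁆ - (⁅y, F (_ * u)⁆ - F (_ * (_ * u))) =
      (⁅⁅x, y⁆, F u⁆ - F (_ * u)) +
        (⁅y, ⁅x, F u⁆ - F (_ * u)⁆ - (⁅x, F (_ * u)⁆ - F (_ * (_ * u))))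
    rw [ι_lie, sub_mul, map_sub, lie_sub, lie_sub, lie_lie, mul_assoc, mul_assoc]
    abel

theorem Coeff.lie_apply (x : 𝔤) (F : Coeff V) (u : U K 𝔤) :
    ⁅x, F⁆ u = ⁅x, F u⁆ - F (UniversalEnvelopingAlgebra.ι K x * u) := rfl

instance : LieModule K 𝔤 (Coeff V) where
  smul_lie c x F := by ext u; simp [Coeff.lie_apply, smul_sub]
  lie_smul c x F := by ext u; simp [Coeff.lie_apply, smul_sub]

/-- The right translation `(w F)(u) = F(u w)`, which commutes with the action of `𝔤`. -/
def rightTrans (w : U K 𝔤) : Coeff V →ₗ[K] Coeff V where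
  toFun F := (LinearMap.comp (F : U K 𝔤 →ₗ[K] V) (LinearMap.mulRight K w) : U K 𝔤 →ₗ[K] V)
  map_add' _ _ := rfl
  map_smul' _ _ := rfl

@[simp] theorem rightTrans_apply (w : U K 𝔤) (F : Coeff V) (u : U K 𝔤) :
    rightTrans w F u = F (u * w) := rfl

theorem rightTrans_lie (w : U K 𝔤) (x : 𝔤) (F : Coeff V) :
    rightTrans w ⁅x, F⁆ = ⁅x, rightTrans w F⁆ := by
  ext u; simp [Coeff.lie_apply, mul_assoc]

variable (V) in
/-- The relative cochains with values in `Hom_K(U(𝔤), V)`, i.e. the coinduced module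
`Hom_𝔨(U(𝔤), Hom_K(Λⁿ(𝔤/𝔨), V))`, on which `U(𝔤)` acts by right translation. It is isomorphic to
`Hom_K(U(𝔤) ⊗_𝔨 Λⁿ(𝔤/𝔨), V)` with its usual `𝔤`-action. -/
def Coind (n : ℕ) : Type u := relCochain 𝔨 (Coeff V) n

instance (n : ℕ) : AddCommGroup (Coind 𝔨 V n) :=
  inferInstanceAs (AddCommGroup (relCochain 𝔨 (Coeff V) n))

instance (n : ℕ) : Module (U K 𝔤) (Coind 𝔨 V n) where
  smul w c := ⟨(rightTrans w).compAlternatingMap c.1, comp_mem 𝔨 _ (rightTrans_lie w) c.2⟩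
  one_smul c := Subtype.ext <| by
    ext v u; change c.1 v (u * 1) = _; rw [mul_one]
  mul_smul w w' c := Subtype.ext <| by
    ext v u; change c.1 v (u * (w * w')) = c.1 v (u * w * w'); rw [mul_assoc]
  smul_zero w := rfl
  smul_add w c c' := rfl
  add_smul w w' c := Subtype.ext <| by
    ext v u; change c.1 v (u * (w + w')) = c.1 v (u * w) + c.1 v (u * w'); rw [mul_add, map_add]
  zero_smul c := Subtype.ext <| by
    ext v u; change c.1 v (u * 0) = 0; rw [mul_zero, map_zero]

theorem Coind.smul_val {n : ℕ} (w : U K 𝔤) (c : Coind 𝔨 V n) :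
    (w • c).1 = (rightTrans w).compAlternatingMap c.1 := rfl

variable (V)

/-- The coinduced module `Coind 𝔨 V n` as an object of the category of `𝔤`-modules. -/
abbrev coind (n : ℕ) : ModuleCat.{u} (U K 𝔤) := ModuleCat.of (U K 𝔤) (Coind 𝔨 V n)

/-- The Chevalley–Eilenberg differential on the coinduced modules. -/
def coindD (n : ℕ) : coind 𝔨 V n ⟶ coind 𝔨 V (n + 1) :=
  ModuleCat.ofHom
    { toFun := fun c => ⟨ceD n c.1, ceD_mem 𝔨 c.2⟩
      map_add' := fun c c' => Subtype.ext (map_add (ceD n) c.1 c'.1)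
      map_smul' := fun w c => Subtype.ext (ceD_comp _ (rightTrans_lie w) c.1) }

theorem coindD_comp (n : ℕ) : coindD 𝔨 V n ≫ coindD 𝔨 V (n + 1) = 0 := by
  ext c
  exact Subtype.ext (ceD_ceD c.1)

/-- The complex `A(V)` of `(𝔤, 𝔨)`-modules: `Aⁿ(V)` is the `𝔨`-finite part of
`Hom_K(U(𝔤) ⊗_𝔨 Λⁿ(𝔤/𝔨), V)`. -/
noncomputable def resComplex : CochainComplex (GKMod 𝔨) ℕ :=
  CochainComplex.of (fun n => gkObj 𝔨 (coind 𝔨 V n)) (fun n => gkMap 𝔨 (coindD 𝔨 V n)) fun n =>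
    gkHom_ext 𝔨 (by
      change gkIncl 𝔨 _ ≫ coindD 𝔨 V n ≫ coindD 𝔨 V (n + 1) = _
      rw [coindD_comp]; rfl)

theorem resComplex_d (n : ℕ) :
    (resComplex 𝔨 V).d n (n + 1) = gkMap 𝔨 (coindD 𝔨 V n) :=
  CochainComplex.of_d (fun n => gkObj 𝔨 (coind 𝔨 V n)) (fun n => gkMap 𝔨 (coindD 𝔨 V n)) n

/-- The augmentation `V → A⁰(V)` before restricting to the `𝔨`-finite part: it sends `v` to the
function `u ↦ u v` on `U(𝔤)`. -/
def augm : V ⟶ coind 𝔨 V 0 :=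
  ModuleCat.ofHom
    { toFun := fun v => ⟨AlternatingMap.constOfIsEmpty K 𝔤 (Fin 0)
          (((LinearMap.toSpanSingleton (U K 𝔤) V v).restrictScalars K : U K 𝔤 →ₗ[K] V) : Coeff V),
        fun _ h => h.choose.elim0, fun x _ => by
          ext w u
          simp only [lieDer_apply, Finset.univ_eq_empty, Finset.sum_empty, sub_zero]
          change ⁅x, u • v⁆ - (UniversalEnvelopingAlgebra.ι K x * u) • v = 0
          rw [mul_smul, lie_def, sub_self]⟩
      map_add' := fun v v' => Subtype.ext <| by
        ext w u; exact smul_add u v v'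
      map_smul' := fun r v => Subtype.ext <| by
        ext w u; exact (mul_smul u r v).symm }

theorem augm_apply (v : V) (w : Fin 0 → 𝔤) (u : U K 𝔤) : ((augm 𝔨 V v).1 w : Coeff V) u = u • v :=
  rfl

theorem augm_coindD : augm 𝔨 V ≫ coindD 𝔨 V 0 = 0 := by
  ext v
  refine Subtype.ext (curryLeft_ext fun x => ?_)
  change (ceD 0 (augm 𝔨 V v).1).curryLeft x = 0
  rw [curryLeft_ceD_zero]
  ext w u
  simp only [lieDer_apply, Finset.univ_eq_empty, Finset.sum_empty, sub_zero]
  change ⁅x, u • v⁆ - (UniversalEnvelopingAlgebra.ι K x * u) • v = 0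
  rw [mul_smul, lie_def, sub_self]

/-- The augmentation `V → A(V)`, as a morphism of complexes from `V` in degree zero. -/
noncomputable def resAugm (V : GKMod 𝔨) :
    (CochainComplex.single₀ (GKMod 𝔨)).obj V ⟶ resComplex 𝔨 V.obj :=
  (CochainComplex.fromSingle₀Equiv (resComplex 𝔨 V.obj) V).symm
    ⟨(gkLift 𝔨 (augm 𝔨 V.obj) : V ⟶ gkObj 𝔨 (coind 𝔨 V.obj 0)), by
      rw [resComplex_d]
      refine gkHom_ext 𝔨 ?_
      exact augm_coindD 𝔨 V.obj⟩

/-- The augmented complex `V → A(V)` is an injective resolution in the category of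
`(𝔤, 𝔨)`-modules. -/
structure IsHochschildResolution (V : GKMod 𝔨) : Prop where
  injective : ∀ n, Injective ((resComplex 𝔨 V.obj).X n)
  quasiIso : QuasiIso (resAugm 𝔨 V)

variable {𝔨} in
/-- The injective resolution `V → A(V)`. -/
noncomputable def IsHochschildResolution.resolution {V : GKMod 𝔨}
    (hV : IsHochschildResolution 𝔨 V) : InjectiveResolution V where
  cocomplex := resComplex 𝔨 V.obj
  injective := hV.injective
  ι := resAugm 𝔨 V
  quasiIso := hV.quasiIso

section Counit
attribute [local instance 100] LieRing.ofAssociativeRing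

/-- The counit `U(𝔤) → K`. -/
def counit : U K 𝔤 →ₐ[K] K := UniversalEnvelopingAlgebra.lift K (0 : 𝔤 →ₗ⁅K⁆ K)

@[simp] theorem counit_ι (x : 𝔤) : counit (UniversalEnvelopingAlgebra.ι K x) = 0 := by
  rw [counit, UniversalEnvelopingAlgebra.lift_ι_apply]; rfl

end Counit

/-- The field `K`, on which `𝔤` acts by zero. -/
def Triv (K _𝔤 : Type u) : Type u := K

variable (K 𝔤) in
instance : AddCommGroup (Triv K 𝔤) := inferInstanceAs (AddCommGroup K)

instance : Module (U K 𝔤) (Triv K 𝔤) :=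
  Module.compHom K (counit : U K 𝔤 →ₐ[K] K).toRingHom

variable (K 𝔤) in
/-- The trivial `𝔤`-module `K`. -/
def triv : ModuleCat.{u} (U K 𝔤) := ModuleCat.of (U K 𝔤) (Triv K 𝔤)

variable (K 𝔤) in
/-- The identification of the underlying vector space of the trivial module with `K`. -/
def trivVal : triv K 𝔤 →ₗ[K] K where
  toFun t := t
  map_add' _ _ := rfl
  map_smul' c t := by
    change counit (algebraMap K (U K 𝔤) c) * _ = _
    rw [AlgHom.commutes]; rfl

theorem trivVal_smul (w : U K 𝔤) (t : triv K 𝔤) :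
    trivVal K 𝔤 (w • t) = counit w * trivVal K 𝔤 t := rfl

theorem triv_lie (x : 𝔤) (t : triv K 𝔤) : ⁅x, t⁆ = 0 := by
  change counit (UniversalEnvelopingAlgebra.ι K x) * trivVal K 𝔤 t = (0 : K)
  rw [counit_ι, zero_mul]

theorem isGK_triv : isGK 𝔨 (triv K 𝔤) where
  semisimple := by
    refine ⟨fun N => ?_⟩
    by_cases h : N = ⊥
    · exact ⟨⊤, by rw [h]; exact isCompl_bot_top⟩
    · have hN : N = ⊤ := by
        obtain ⟨t, ht, ht0⟩ : ∃ t ∈ N, t ≠ 0 := by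
          by_contra! h'
          exact h ((LieSubmodule.eq_bot_iff N).mpr h')
        rw [eq_top_iff]
        rintro s -
        have : s = (trivVal K 𝔤 s * (trivVal K 𝔤 t)⁻¹) • t := by
          have hinj : Function.Injective (trivVal K 𝔤) := fun _ _ h => h
          apply hinj
          rw [map_smul, smul_eq_mul, inv_mul_cancel_right₀]
          exact ht0
        rw [this]
        exact N.smul_mem _ ht
      exact ⟨⊥, by rw [hN]; exact isCompl_top_bot⟩
  locallyFinite m := by
    refine ⟨⊤, LieSubmodule.mem_top m, ?_⟩
    have hinj : Function.Injective ((trivVal K 𝔤).comp (Submodule.subtype ⊤)) :=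
      fun _ _ h => Subtype.ext h
    exact FiniteDimensional.of_injective _ hinj

/-- The trivial `(𝔤, 𝔨)`-module `K`. -/
def trivGK : GKMod 𝔨 := ⟨triv K 𝔤, isGK_triv 𝔨⟩

/-- The pairing `V × K → V`, `(v, t) ↦ t v`. -/
def trivPairing : V →ₗ[K] triv K 𝔤 →ₗ[K] V := ((LinearMap.lsmul K V).comp (trivVal K 𝔤)).flip

theorem trivPairing_apply (v : V) (t : triv K 𝔤) : trivPairing V v t = trivVal K 𝔤 t • v := rfl

theorem trivPairing_lie (x : 𝔤) (v : V) (t : triv K 𝔤) :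
    ⁅x, trivPairing V v t⁆ = trivPairing V ⁅x, v⁆ t + trivPairing V v ⁅x, t⁆ := by
  rw [triv_lie, map_zero, add_zero, trivPairing_apply, trivPairing_apply, lie_smul]

/-- The map `V → Hom_K(U(𝔤), V)` that sends `v` to the function `u ↦ ε(u) v`, `ε` being the counit.
It is `𝔤`-equivariant, and its image is the space of functions fixed by right translations. -/
def constMap : V →ₗ[K] Coeff V where
  toFun v := ((counit : U K 𝔤 →ₐ[K] K).toLinearMap.smulRight v : U K 𝔤 →ₗ[K] V)
  map_add' v w := Coeff.ext fun u => smul_add (counit u) v w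
  map_smul' c v := Coeff.ext fun u => smul_comm (counit u) c v

theorem constMap_apply (v : V) (u : U K 𝔤) : constMap V v u = counit u • v := rfl

theorem constMap_lie (x : 𝔤) (v : V) : constMap V ⁅x, v⁆ = ⁅x, constMap V v⁆ := by
  ext u
  rw [Coeff.lie_apply, constMap_apply, constMap_apply, constMap_apply, map_mul, counit_ι, zero_mul,
    zero_smul, sub_zero, lie_smul]

/-- A relative cochain with values in `V`, viewed as an invariant element of the coinduced module,
i.e. as a morphism from the trivial module to it. -/
def invHom {n : ℕ} (α : relCochain 𝔨 V n) : triv K 𝔤 ⟶ coind 𝔨 V n :=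
  ModuleCat.ofHom
    { toFun := fun t => ⟨(constMap V).compAlternatingMap (trivVal K 𝔤 t • α.1),
        comp_mem 𝔨 _ (constMap_lie V) (Submodule.smul_mem _ _ α.2)⟩
      map_add' := fun (t s : triv K 𝔤) => Subtype.ext <| by
        ext v u
        change counit u • (trivVal K 𝔤 (t + s) • α.1 v) =
          counit u • (trivVal K 𝔤 t • α.1 v) + counit u • (trivVal K 𝔤 s • α.1 v)
        rw [map_add, add_smul, smul_add]
      map_smul' := fun w (t : triv K 𝔤) => Subtype.ext <| by
        ext v u
        change counit u • (trivVal K 𝔤 (w • t) • α.1 v) =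
          counit (u * w) • (trivVal K 𝔤 t • α.1 v)
        rw [trivVal_smul, map_mul, smul_smul, smul_smul, mul_assoc] }

theorem invHom_apply {n : ℕ} (α : relCochain 𝔨 V n) (t : triv K 𝔤) (v : Fin n → 𝔤) (u : U K 𝔤) :
    ((invHom 𝔨 V α t).1 v : Coeff V) u = counit u • trivVal K 𝔤 t • α.1 v := rfl

/-- `invHom` as a linear map to the morphisms `K → Aⁿ(V)` of `(𝔤, 𝔨)`-modules. -/
def cochainHom (n : ℕ) :
    relCochain 𝔨 V n →ₗ[K] (trivGK 𝔨 ⟶ gkObj 𝔨 (coind 𝔨 V n)) where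
  toFun α := gkLift 𝔨 (invHom 𝔨 V α)
  map_add' α β := by
    refine gkHom_ext 𝔨 ?_
    ext t
    refine Subtype.ext ?_
    ext v u
    change counit u • trivVal K 𝔤 t • (α.1 v + β.1 v) =
      counit u • trivVal K 𝔤 t • α.1 v + counit u • trivVal K 𝔤 t • β.1 v
    rw [smul_add, smul_add]
  map_smul' c α := by
    refine gkHom_ext 𝔨 ?_
    ext t
    refine Subtype.ext ?_
    ext v u
    change counit u • trivVal K 𝔤 t • (c • α.1 v) =
      counit (u * algebraMap K (U K 𝔤) c) • trivVal K 𝔤 t • α.1 v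
    rw [map_mul, AlgHom.commutes, Algebra.algebraMap_self_apply, mul_smul, smul_comm c]

theorem cochainHom_comp_d {n : ℕ} (α : relCochain 𝔨 V n) :
    cochainHom 𝔨 V n α ≫ (resComplex 𝔨 V).d n (n + 1) =
      cochainHom 𝔨 V (n + 1) ⟨ceD n α.1, ceD_mem 𝔨 α.2⟩ := by
  rw [resComplex_d]
  refine gkHom_ext 𝔨 ?_
  ext t
  refine Subtype.ext ?_
  change ceD n ((constMap V).compAlternatingMap (trivVal K 𝔤 t • α.1)) =
    (constMap V).compAlternatingMap (trivVal K 𝔤 t • ceD n α.1)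
  rw [ceD_comp _ (constMap_lie V), map_smul]

instance : HasExt.{u + 1} (GKMod 𝔨) := HasExt.standard _

variable {𝔨 V} in
theorem ceD_relZ {n : ℕ} (α : relZ 𝔨 V n) : ceD n α.1 = 0 := α.2.2

/-- A relative cocycle as a relative cochain. -/
def relZIncl (n : ℕ) : relZ 𝔨 V n →ₗ[K] relCochain 𝔨 V n := Submodule.inclusion inf_le_left

variable {𝔨 V} in
theorem cochainHom_d_eq_zero {n : ℕ} (α : relZ 𝔨 V n) :
    cochainHom 𝔨 V n (relZIncl 𝔨 V n α) ≫ (resComplex 𝔨 V).d n (n + 1) = 0 := by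
  rw [cochainHom_comp_d]
  have : (⟨ceD n (relZIncl 𝔨 V n α).1, ceD_mem 𝔨 (relZIncl 𝔨 V n α).2⟩ :
    relCochain 𝔨 V (n + 1)) = 0 := Subtype.ext (ceD_relZ α)
  rw [this, map_zero]
  rfl

/-- Hochschild's map on cocycles: the class in `Extⁿ(K, V)` of the morphism `K → A(V)[n]` given by
a relative cocycle. -/
noncomputable def hochschildZ {V : GKMod 𝔨} (hV : IsHochschildResolution 𝔨 V) (n : ℕ) :
    relZ 𝔨 V.obj n →ₗ[K] Abelian.Ext (trivGK 𝔨) V n where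
  toFun α := hV.resolution.extMk (cochainHom 𝔨 V.obj n (relZIncl 𝔨 V.obj n α)) (n + 1) rfl
    (cochainHom_d_eq_zero α)
  map_add' α β := by
    refine Eq.trans ?_ (hV.resolution.add_extMk (cochainHom 𝔨 V.obj n (relZIncl 𝔨 V.obj n α))
      (cochainHom 𝔨 V.obj n (relZIncl 𝔨 V.obj n β)) (n + 1) rfl
      (cochainHom_d_eq_zero α) (cochainHom_d_eq_zero β)).symm
    congr 1
    rw [map_add, map_add]
    rfl
  map_smul' c α := by
    have h := hV.resolution.mk₀_comp_extMk (cochainHom 𝔨 V.obj n (relZIncl 𝔨 V.obj n α)) (n + 1)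
      rfl (cochainHom_d_eq_zero α) (c • 𝟙 (trivGK 𝔨))
    rw [Abelian.Ext.mk₀_smul, Abelian.Ext.smul_comp, Abelian.Ext.mk₀_id_comp] at h
    refine Eq.trans ?_ h.symm
    congr 1
    have h2 : (c • 𝟙 (trivGK 𝔨)) ≫ cochainHom 𝔨 V.obj n (relZIncl 𝔨 V.obj n α) =
        c • cochainHom 𝔨 V.obj n (relZIncl 𝔨 V.obj n α) := by
      rw [Linear.smul_comp, Category.id_comp]
    refine Eq.trans ?_ h2.symm
    rw [map_smul, map_smul]

/-- Hochschild's map `Φ_V : Hⁿ_CE(𝔤, 𝔨; V) → Extⁿ(K, V)`. -/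
noncomputable def hochschildMap {V : GKMod 𝔨} (hV : IsHochschildResolution 𝔨 V) (n : ℕ) :
    HCE 𝔨 V.obj n →ₗ[K] Abelian.Ext (trivGK 𝔨) V n :=
  Submodule.liftQ _ (hochschildZ 𝔨 hV n) fun α hα => by
    cases n with
    | zero =>
      have : α = 0 := Subtype.ext ((Submodule.mem_bot K).mp hα)
      rw [this]
      exact Submodule.zero_mem _
    | succ n =>
      obtain ⟨γ, hγ, hγα⟩ := hα
      refine (hV.resolution.extMk_eq_zero_iff _ (n + 1 + 1) rfl (cochainHom_d_eq_zero α) n rfl).mpr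
        ⟨cochainHom 𝔨 V.obj n ⟨γ, hγ⟩, ?_⟩
      refine (cochainHom_comp_d 𝔨 V.obj ⟨γ, hγ⟩).trans ?_
      congr 1
      exact Subtype.ext hγα

end Resolution

end RelLie

open RelLie

/-!
Write `U = U(𝔤)`. As `𝔤` is a semisimple `𝔨`-module, so is its submodule `𝔨`: the adjoint module
of `𝔨` is semisimple, i.e. `𝔨` is reductive.

**The `𝔨`-finite part.** Over a reductive Lie algebra, a finite dimensional module is semisimple as
soon as the center acts by semisimple endomorphisms (`complementedLattice_of_center`, proved with
Casimir operators and Fitting's lemma). Hence tensor products of finite dimensional semisimple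
modules are semisimple (`complementedLattice_tensor`), and in a `𝔤`-module the sum of all locally
finite semisimple `𝔨`-submodules is stable under `𝔤`: it is the `𝔨`-finite part
(`mem_gkPart_of_mem`).

**Injectivity.** By Frobenius reciprocity (`coindLift`) the morphisms from a `(𝔤, 𝔨)`-module to
`Aⁿ(V)` are `𝔨`-equivariant maps to relative cochains with values in `V`. These extend along
monomorphisms because `(𝔤, 𝔨)`-modules are semisimple over `𝔨` (`injective_gkObj_coind`).

**Exactness.** Cochains with values in `Hom_K(U, V)` are differential forms on a formal group, and
relative cochains are those that descend to the quotient by `𝔨`. Exactness is a Poincaré lemma for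
this formal homogeneous space, with a homotopy that commutes with the remaining action of `𝔨`. It
is built from a coordinate, a `𝔨`-equivariant map `e : U/U𝔨 → 𝔤` that lifts the identity of `𝔤/𝔨`
(`exists_coordinate`). It exists because `U/U𝔨` is a `(𝔤, 𝔨)`-module that contains `K ⊕ 𝔤/𝔨`, which is
the part of the Poincaré–Birkhoff–Witt theorem needed here (`eq_zero_and_mem_of_mem_span`). Contraction
with the radial vector field of this coordinate has an anticommutator with `d` which, on forms that
vanish to order `i`, is multiplication by minus the total degree up to higher order
(`euler_apply_word`). The total degree is positive and invertible in `K`, so successive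
approximation gives a primitive of each cocycle as a sum that is finite at each element of `U`
(`exists_primitive`). Since the homotopy is `𝔨`-equivariant, it preserves `𝔨`-finite parts
(`exact_coindD`).

**The comparison map.** A morphism `K → Aⁿ(V)` is an invariant of `Hom_K(U, V)`-valued cochains, and
it is determined by its value at `1 ∈ U`, a relative cochain with values in `V`
(`cochainHom_injective`, `cochainHom_surjective`). Since the extension groups are computed by the
injective resolution `A(V)`, Hochschild's map is bijective (`hochschildMap_bijective`).

**Multiplicativity.** For a cocycle `α` of degree `p`, the exterior product `F ↦ α ∧ F` maps `Aᵏ(K)` to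
`Aᵖ⁺ᵏ(V)`, commutes with the differentials up to the sign `(-1)ᵖ` by the Leibniz rule, and restricts to
`α` on the augmentation. So it is a morphism of complexes `A(K) → A(V)[p]` that represents the class of
`α`, and the composition product with that class is composition with this morphism
(`extMk_comp_extMk`). On the cochain `β` it gives `α ∧ β` (`cochainHom_wedgeHom`,
`hochschildMap_cupHCE`).
-/

namespace RelLie

/-! ### Casimir elements of Lie algebras with trivial radical -/

section Casimir

open LieAlgebra LieModule Module

variable {K L H : Type*} [Field K] [CharZero K] [LieRing L] [LieAlgebra K L]
  [FiniteDimensional K L] [AddCommGroup H] [Module K H] [LieRingModule L H] [LieModule K L H]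
  [FiniteDimensional K H]

section
attribute [local instance 100] LieRing.ofAssociativeRing

/-- A Lie algebra with a faithful finite dimensional module whose trace form vanishes is solvable:
by Cartan's criterion its derived algebra acts nilpotently. -/
theorem isSolvable_of_traceForm_eq_zero
    (hinj : ∀ x : L, toEnd K L H x = 0 → x = 0) (h : traceForm K L H = 0) : IsSolvable L := by
  have hnil := isNilpotent_derivedSeries_of_traceForm_eq_zero h
  set D := derivedSeries K L 1
  have hD : LieRing.IsNilpotent D := by
    rw [LieAlgebra.isNilpotent_iff_forall (R := K)]
    intro x
    obtain ⟨k, hk⟩ := LieAlgebra.ad_nilpotent_of_nilpotent (R := K)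
      ((LieModule.isNilpotent_iff_forall' (R := K)).mp hnil x)
    have hcomm : ∀ (m : ℕ) (y : D), toEnd K L H (((ad K D x) ^ m) y : D) =
        ((ad K (End K H) (toEnd K D H x)) ^ m) (toEnd K L H y) := by
      intro m
      induction m with
      | zero => intro y; rfl
      | succ m ih =>
        intro y
        rw [pow_succ, pow_succ, Module.End.mul_apply, Module.End.mul_apply, ih]
        congr 1
        exact LieHom.map_lie (toEnd K L H) (x : L) (y : L)
    refine ⟨k, LinearMap.ext fun y => Subtype.ext (hinj _ ?_)⟩
    rw [hcomm, hk]; rfl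
  obtain ⟨k, hk⟩ := IsSolvable.solvable K D
  refine IsSolvable.mk (R := K) (k := k + 1) ?_
  rw [LieIdeal.derivedSeries_eq_bot_iff] at hk
  rw [derivedSeries_def, derivedSeriesOfIdeal_add]
  exact hk

end

/-- The **Casimir operator** of a nontrivial finite dimensional module over a semisimple Lie algebra:
the sum of the products of dual bases for the trace form on the ideal complementary to the kernel.
Its trace is the dimension of that ideal. -/
theorem exists_casimir [HasTrivialRadical K L] (hH : ∃ x : L, toEnd K L H x ≠ 0) :
    ∃ c : End K H, (∀ x : L, Commute (toEnd K L H x) c) ∧ LinearMap.trace K H c ≠ 0 ∧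
      ∀ ρ : H →ₗ[K] K, (∀ (x : L) (h : H), ρ ⁅x, h⁆ = 0) → ∀ h, ρ (c h) = 0 := by
  classical
  set I : LieIdeal K L := LieModule.ker K L H with hI
  have memI : ∀ x, x ∈ I ↔ toEnd K L H x = 0 := fun x => by
    rw [hI, LieModule.mem_ker]
    exact ⟨fun h => LinearMap.ext h, fun h m => congrArg (fun f : End K H => f m) h⟩
  set J : LieIdeal K L := I.killingCompl
  have hIJ : IsCompl I J := I.isCompl_killingCompl
  set B := traceForm K L H
  have hBI : ∀ x y, y ∈ I → B x y = 0 := fun x y hy => by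
    rw [traceForm_apply_apply, (memI y).mp hy, LinearMap.comp_zero, map_zero]
  have hdec : ∀ y : L, ∃ a ∈ I, ∃ b ∈ J, a + b = y := fun y => by
    have : y ∈ I ⊔ J := by rw [hIJ.sup_eq_top]; trivial
    exact (LieSubmodule.mem_sup _ _ _).mp this
  -- The trace form is nondegenerate on the ideal `J` complementary to the kernel.
  have hJ : ∀ x ∈ J, (∀ y ∈ J, B x y = 0) → x = 0 := by
    let R : LieIdeal K L :=
      { J.toSubmodule ⊓ LinearMap.ker B with
        lie_mem := fun {x m} hm => by
          refine ⟨J.lie_mem hm.1, ?_⟩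
          have h2 : B m = 0 := hm.2
          change B ⁅x, m⁆ = 0
          ext y
          rw [← lie_skew, map_neg, LinearMap.neg_apply, traceForm_apply_lie_apply, h2]
          simp }
    have hR : R = ⊥ := by
      have : IsSolvable R := by
        refine isSolvable_of_traceForm_eq_zero (K := K) (H := H) ?_ ?_
        · rintro ⟨x, hx⟩ h0
          have h1 : x ∈ I := (memI x).mpr h0
          have h2 : x ∈ I ⊓ J := ⟨h1, hx.1⟩
          rw [hIJ.inf_eq_bot] at h2
          exact Subtype.ext ((LieSubmodule.mem_bot x).mp h2)
        · ext ⟨x, hx⟩ ⟨y, hy⟩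
          have h2 : B x = 0 := hx.2
          exact congrArg (fun f : L →ₗ[K] K => f y) h2
      exact HasTrivialRadical.eq_bot_of_isSolvable R
    intro x hx h
    have hxR : x ∈ R := by
      refine ⟨hx, ?_⟩
      change B x = 0
      ext y
      obtain ⟨a, ha, b, hb, rfl⟩ := hdec y
      rw [map_add, hBI x a ha, h b hb]; simp
    rw [hR] at hxR
    exact (LieSubmodule.mem_bot x).mp hxR
  let BJ : LinearMap.BilinForm K J := B.restrict J.toSubmodule
  have hsymm : BJ.IsSymm := ⟨fun x y => traceForm_comm K L H x y⟩
  have hBJ : BJ.Nondegenerate := by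
    refine (LinearMap.IsRefl.nondegenerate_iff_separatingLeft hsymm.isRefl).mpr ?_
    intro x hx
    exact Subtype.ext (hJ x x.2 fun y hy => hx ⟨y, hy⟩)
  let b := Module.finBasis K J
  let b' := BJ.dualBasis hBJ b
  let T : L →ₗ[K] End K H := (toEnd K L H : L →ₗ[K] End K H)
  have hT : ∀ x y : L, T ⁅x, y⁆ = T x * T y - T y * T x := fun x y => by
    ext h; exact lie_lie x y h
  have hbb' : ∀ i j, BJ (b' i) (b j) = if j = i then 1 else 0 :=
    LinearMap.BilinForm.apply_dualBasis_left hBJ b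
  have hb'repr : ∀ x i, b'.repr x i = BJ x (b i) :=
    LinearMap.BilinForm.dualBasis_repr_apply hBJ b
  have hbrepr : ∀ x i, b.repr x i = BJ (b' i) x := by
    intro x i
    have h := congrArg (BJ (b' i)) (b.sum_repr x)
    rw [← h, map_sum]
    simp only [map_smul, hbb', smul_eq_mul, mul_ite, mul_one, mul_zero, Finset.sum_ite_eq',
      Finset.mem_univ, if_true]
  let c : End K H := ∑ i, T (b i) * T (b' i)
  refine ⟨c, ?_, ?_, ?_⟩
  · intro x
    let br : J → J := fun y => ⟨⁅x, (y : L)⁆, J.lie_mem y.2⟩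
    have h1 : ∀ i, T ⁅x, (b i : L)⁆ = ∑ j, BJ (b' j) (br (b i)) • T (b j) := by
      intro i
      have := congrArg (fun y : J => T (y : L)) (b.sum_repr (br (b i)))
      simp only [hbrepr] at this
      rw [← show T ((br (b i) : J) : L) = T ⁅x, (b i : L)⁆ from rfl, ← this]
      simp [map_sum]
    have h2 : ∀ i, T ⁅x, (b' i : L)⁆ = ∑ j, BJ (br (b' i)) (b j) • T (b' j) := by
      intro i
      have := congrArg (fun y : J => T (y : L)) (b'.sum_repr (br (b' i)))
      simp only [hb'repr] at this
      rw [← show T ((br (b' i) : J) : L) = T ⁅x, (b' i : L)⁆ from rfl, ← this]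
      simp [map_sum]
    have h3 : ∀ i j, BJ (br (b' i)) (b j) = - BJ (b' i) (br (b j)) := by
      intro i j
      change B ⁅x, (b' i : L)⁆ (b j : L) = - B (b' i : L) ⁅x, (b j : L)⁆
      rw [← lie_skew, map_neg, LinearMap.neg_apply, traceForm_apply_lie_apply]
    have h4 : T x * c - c * T x = ∑ i, (T ⁅x, (b i : L)⁆ * T (b' i) + T (b i) * T ⁅x, (b' i : L)⁆) := by
      simp only [c, Finset.mul_sum, Finset.sum_mul, hT, ← Finset.sum_sub_distrib]
      refine Finset.sum_congr rfl fun i _ => ?_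
      noncomm_ring
    have h5 : T x * c - c * T x = 0 := by
      rw [h4, Finset.sum_add_distrib]
      simp only [h1, h2, h3, Finset.mul_sum, Finset.sum_mul, smul_mul_assoc, mul_smul_comm,
        neg_smul, mul_neg, Finset.sum_neg_distrib]
      rw [Finset.sum_comm, add_neg_cancel]
    exact sub_eq_zero.mp h5
  · have h1 : LinearMap.trace K H c = finrank K J := by
      simp only [c, map_sum]
      have : ∀ i, LinearMap.trace K H (T (b i) * T (b' i)) = 1 := by
        intro i
        have := hbb' i i
        rw [if_pos rfl] at this
        rw [← this, hsymm.eq]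
        rfl
      simp [this]
    rw [h1]
    obtain ⟨x, hx⟩ := hH
    obtain ⟨a, ha, y, hy, rfl⟩ := hdec x
    rw [map_add, (memI a).mp ha, zero_add] at hx
    have hy0 : y ≠ 0 := fun h => hx (by rw [h, map_zero])
    have : Nontrivial J := ⟨⟨⟨y, hy⟩, 0, fun h => hy0 (congrArg Subtype.val h)⟩⟩
    exact_mod_cast (finrank_pos (R := K) (M := J)).ne'
  · intro ρ hρ h
    simp only [c, LinearMap.sum_apply, map_sum, Module.End.mul_apply]
    exact Finset.sum_eq_zero fun i _ => hρ _ _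

end Casimir

/-! ### Complete reducibility over reductive Lie algebras -/

section Reductive

open LieAlgebra LieModule Module

variable {K L : Type*} [Field K] [CharZero K] [LieRing L] [LieAlgebra K L] [FiniteDimensional K L]

/-- Let `L` be the sum of a central ideal `Z` and an ideal `S` with trivial radical, and let `ρ` be a
nonzero `L`-invariant functional on a finite dimensional `L`-module on which `Z` acts by semisimple
endomorphisms. Then `ρ` is nonzero on the invariants. The proof cuts the module down by Fitting's
lemma, applied to an element of `Z` or to the Casimir operator of `S`. -/
theorem exists_invariant (Z S : LieIdeal K L) (hZS : Z ⊔ S = ⊤) [HasTrivialRadical K S]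
    (hZ : ∀ z ∈ Z, ∀ x : L, ⁅z, x⁆ = 0) (n : ℕ) :
    ∀ (H : Type*) [AddCommGroup H] [Module K H] [LieRingModule L H] [LieModule K L H]
      [FiniteDimensional K H], finrank K H = n → (∀ z ∈ Z, (toEnd K L H z).IsSemisimple) →
      ∀ ρ : H →ₗ[K] K, (∀ (x : L) (h : H), ρ ⁅x, h⁆ = 0) → ρ ≠ 0 →
        ∃ h : H, (∀ x : L, ⁅x, h⁆ = 0) ∧ ρ h = 1 := by
  induction n using Nat.strong_induction_on with
  | _ n ih =>
    intro H _ _ _ _ _ hn hss ρ hρ hρ0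
    -- An endomorphism that is not nilpotent and is killed by `ρ` reduces the dimension.
    have reduce : ∀ c : End K H, (∀ x : L, Commute (toEnd K L H x) c) → ¬ IsNilpotent c →
        (∀ h, ρ (c h) = 0) → ∃ h : H, (∀ x : L, ⁅x, h⁆ = 0) ∧ ρ h = 1 := by
      intro c hc hnil hρc
      obtain ⟨m, hm⟩ := (Filter.eventually_atTop.mp
        (LinearMap.eventually_isCompl_ker_pow_range_pow c))
      have hcompl := hm (m + 1) (Nat.le_succ m)
      let N : LieSubmodule K L H :=
        { LinearMap.ker (c ^ (m + 1)) with
          lie_mem := fun {x h} hh => by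
            have h1 : (c ^ (m + 1)) h = 0 := hh
            have := congrArg (fun f : End K H => f h) ((hc x).pow_right (m + 1)).eq
            change (c ^ (m + 1)) ⁅x, h⁆ = 0
            change ⁅x, (c ^ (m + 1)) h⁆ = (c ^ (m + 1)) ⁅x, h⁆ at this
            rw [← this, h1, lie_zero] }
      have hNlt : finrank K N < n := by
        rw [← hn]
        refine Submodule.finrank_lt fun htop => hnil ⟨m + 1, ?_⟩
        exact LinearMap.ker_eq_top.mp htop
      let ρN : N →ₗ[K] K := ρ ∘ₗ N.toSubmodule.subtype
      have hρN : ρN ≠ 0 := by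
        intro h0
        apply hρ0
        ext h
        have hh : h ∈ LinearMap.ker (c ^ (m + 1)) ⊔ LinearMap.range (c ^ (m + 1)) := by
          rw [hcompl.sup_eq_top]; trivial
        obtain ⟨a, ha, b, ⟨b', rfl⟩, rfl⟩ := Submodule.mem_sup.mp hh
        have h1 : ρ a = 0 := congrArg (fun f : N →ₗ[K] K => f ⟨a, ha⟩) h0
        rw [map_add, h1, pow_succ', Module.End.mul_apply, hρc]
        simp
      obtain ⟨h, hinv, hone⟩ := ih _ hNlt N rfl
        (fun z hz => (hss z hz).restrict (p := N.toSubmodule)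
          fun x hx => N.lie_mem hx)
        ρN (fun x h => hρ x h) hρN
      exact ⟨h, fun x => congrArg Subtype.val (hinv x), hone⟩
    by_cases h1 : ∃ z ∈ Z, toEnd K L H z ≠ 0
    · obtain ⟨z, hz, hz0⟩ := h1
      refine reduce (toEnd K L H z) (fun x => ?_) (fun hnil => hz0 ?_) fun h => hρ z h
      · ext h
        have := lie_lie z x h
        rw [hZ z hz x, zero_lie] at this
        exact (sub_eq_zero.mp this.symm).symm
      · exact Module.End.eq_zero_of_isNilpotent_isSemisimple hnil (hss z hz)
    push Not at h1
    have hdec : ∀ x : L, ∃ a ∈ Z, ∃ b ∈ S, a + b = x := fun x => by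
      have : x ∈ Z ⊔ S := by rw [hZS]; trivial
      exact (LieSubmodule.mem_sup _ _ _).mp this
    by_cases h2 : ∃ x : S, toEnd K S H x ≠ 0
    · obtain ⟨c, hc, htr, hcρ⟩ := exists_casimir (K := K) h2
      refine reduce c (fun x => ?_) (fun hnil => htr ?_) (hcρ ρ fun x h => hρ x h)
      · obtain ⟨a, ha, b, hb, rfl⟩ := hdec x
        rw [map_add, h1 a ha, zero_add]
        exact hc ⟨b, hb⟩
      · exact (LinearMap.isNilpotent_trace_of_isNilpotent hnil).eq_zero
    push Not at h2
    obtain ⟨h, hh⟩ : ∃ h, ρ h ≠ 0 := by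
      by_contra! h; exact hρ0 (LinearMap.ext h)
    refine ⟨(ρ h)⁻¹ • h, fun x => ?_, by rw [map_smul, smul_eq_mul, inv_mul_cancel₀ hh]⟩
    obtain ⟨a, ha, b, hb, rfl⟩ := hdec x
    have e1 : ⁅a, (ρ h)⁻¹ • h⁆ = 0 := congrArg (fun f : End K H => f _) (h1 a ha)
    have e2 : ⁅b, (ρ h)⁻¹ • h⁆ = 0 := congrArg (fun f : End K H => f _) (h2 ⟨b, hb⟩)
    rw [add_lie, e1, e2, add_zero]

theorem aeval_mulRight {A : Type*} [Ring A] [Algebra K A] (a : A) (p : Polynomial K) :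
    Polynomial.aeval (LinearMap.mulRight K a) p = LinearMap.mulRight K (Polynomial.aeval a p) := by
  ext x
  induction p using Polynomial.induction_on' with
  | add p q hp hq => simp only [map_add, LinearMap.add_apply, hp, hq, LinearMap.mulRight_apply, mul_add]
  | monomial n c =>
    simp [Polynomial.aeval_monomial, LinearMap.pow_mulRight, Module.algebraMap_end_apply,
      Algebra.smul_def]
    rw [← mul_assoc, Algebra.commutes]

/-- If `z` is a semisimple endomorphism, then so is `f ↦ z f - f z`. -/
theorem isSemisimple_mulLeft_sub_mulRight {E : Type*} [AddCommGroup E] [Module K E]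
    [FiniteDimensional K E] {z : End K E} (hz : z.IsSemisimple) :
    Module.End.IsSemisimple (LinearMap.mulLeft K z - LinearMap.mulRight K z) := by
  have hl : Module.End.IsSemisimple (LinearMap.mulLeft K z) := by
    refine Module.End.isSemisimple_of_squarefree_aeval_eq_zero hz.minpoly_squarefree ?_
    have : LinearMap.mulLeft K z = Algebra.lmul K (End K E) z := rfl
    rw [this, Polynomial.aeval_algHom_apply, minpoly.aeval, map_zero]
  have hr : Module.End.IsSemisimple (LinearMap.mulRight K z) := by
    refine Module.End.isSemisimple_of_squarefree_aeval_eq_zero hz.minpoly_squarefree ?_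
    rw [aeval_mulRight, minpoly.aeval, LinearMap.mulRight_zero_eq_zero]
  exact Module.End.IsSemisimple.sub_of_commute (LinearMap.commute_mulLeft_right z z) hl hr

/-- A finite dimensional module over a reductive Lie algebra is semisimple if the central part acts
by semisimple endomorphisms. For a semisimple Lie algebra this is **Weyl's theorem**. A complement
of a submodule `P` is the kernel of an invariant projection to `P`, which is found by
`exists_invariant` among the endomorphisms with image in `P` that are scalar on `P`. -/
theorem complementedLattice_of_center (Z S : LieIdeal K L) (hZS : Z ⊔ S = ⊤)
    [HasTrivialRadical K S] (hZ : ∀ z ∈ Z, ∀ x : L, ⁅z, x⁆ = 0)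
    (E : Type*) [AddCommGroup E] [Module K E] [LieRingModule L E] [LieModule K L E]
    [FiniteDimensional K E] (hE : ∀ z ∈ Z, (toEnd K L E z).IsSemisimple) :
    ComplementedLattice (LieSubmodule K L E) := by
  refine ⟨fun P => ?_⟩
  by_cases hP : P = ⊥
  · exact ⟨⊤, by rw [hP]; exact isCompl_bot_top⟩
  obtain ⟨e, heP, he0⟩ : ∃ e ∈ P, e ≠ 0 := by
    by_contra! h
    exact hP ((LieSubmodule.eq_bot_iff P).mpr h)
  let H : LieSubmodule K L (E →ₗ[K] E) :=
    { carrier := {f | (∀ v, f v ∈ P) ∧ ∃ a : K, ∀ v ∈ P, f v = a • v}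
      zero_mem' := ⟨fun v => P.zero_mem, 0, fun v _ => (zero_smul K v).symm⟩
      add_mem' := by
        rintro f g ⟨hf, a, ha⟩ ⟨hg, b, hb⟩
        exact ⟨fun v => P.add_mem (hf v) (hg v), a + b, fun v hv => by
          rw [LinearMap.add_apply, ha v hv, hb v hv, add_smul]⟩
      smul_mem' := by
        rintro c f ⟨hf, a, ha⟩
        exact ⟨fun v => P.smul_mem c (hf v), c * a, fun v hv => by
          rw [LinearMap.smul_apply, ha v hv, mul_smul]⟩
      lie_mem := by
        rintro x f ⟨hf, a, ha⟩
        refine ⟨fun v => ?_, 0, fun v hv => ?_⟩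
        · rw [LieHom.lie_apply]
          exact P.sub_mem (P.lie_mem (hf v)) (hf _)
        · rw [LieHom.lie_apply, ha v hv, ha _ (P.lie_mem hv), lie_smul, sub_self, zero_smul] }
  obtain ⟨l, hl⟩ := Module.Projective.exists_dual_eq_one K he0
  let ρ : H →ₗ[K] K := (l ∘ₗ LinearMap.applyₗ e) ∘ₗ H.toSubmodule.subtype
  have hρ : ∀ (x : L) (f : H), ρ ⁅x, f⁆ = 0 := by
    rintro x ⟨f, hf, a, ha⟩
    change l (⁅x, f⁆ e) = 0
    rw [LieHom.lie_apply, ha e heP, ha _ (P.lie_mem heP), lie_smul, sub_self, map_zero]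
  obtain ⟨π, hπ⟩ := P.toSubmodule.subtype.exists_leftInverse_of_injective
    (LinearMap.ker_eq_bot.mpr P.toSubmodule.injective_subtype)
  have hρ0 : ρ ≠ 0 := by
    intro h0
    have h1 : ρ ⟨P.toSubmodule.subtype ∘ₗ π, fun v => (π v).2, 1, fun v hv => by
      have := congrArg (fun f : P →ₗ[K] P => ((f ⟨v, hv⟩ : P) : E)) hπ
      exact (one_smul K v).symm ▸ this⟩ = 1 := by
      have := congrArg (fun f : P →ₗ[K] P => ((f ⟨e, heP⟩ : P) : E)) hπ
      change l (π e : E) = 1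
      rw [show (π e : E) = e from this, hl]
    rw [h0] at h1
    exact zero_ne_one h1
  obtain ⟨⟨f, hfP, a, ha⟩, hinv, hone⟩ := exists_invariant Z S hZS hZ _ H rfl (fun z hz => by
      have h2 : H.toSubmodule ∈ Module.End.invtSubmodule
          (LinearMap.mulLeft K (toEnd K L E z) - LinearMap.mulRight K (toEnd K L E z)) :=
        fun g hg => H.lie_mem (x := z) hg
      exact (isSemisimple_mulLeft_sub_mulRight (hE z hz)).restrict h2)
    ρ hρ hρ0
  have ha1 : a = 1 := by
    have h1 : l (f e) = 1 := hone
    rwa [ha e heP, map_smul, hl, smul_eq_mul, mul_one] at h1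
  have hf1 : ∀ v ∈ P, f v = v := fun v hv => by rw [ha v hv, ha1, one_smul]
  have hfx : ∀ (x : L) (v : E), f ⁅x, v⁆ = ⁅x, f v⁆ := by
    intro x v
    have h1 : ⁅x, f⁆ = 0 := congrArg Subtype.val (hinv x)
    have h2 := congrArg (fun g : E →ₗ[K] E => g v) h1
    rw [LieHom.lie_apply] at h2
    exact (sub_eq_zero.mp h2).symm
  refine ⟨{ LinearMap.ker f with
    lie_mem := fun {x v} hv => by
      have h1 : f v = 0 := hv
      change f ⁅x, v⁆ = 0
      rw [hfx, h1, lie_zero] }, ?_, ?_⟩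
  · rw [disjoint_iff, LieSubmodule.eq_bot_iff]
    rintro v ⟨hv, hv'⟩
    rw [← hf1 v hv]; exact hv'
  · rw [codisjoint_iff, eq_top_iff]
    rintro v -
    refine (LieSubmodule.mem_sup _ _ _).mpr ⟨f v, hfP v, v - f v, ?_, by abel⟩
    change f (v - f v) = 0
    rw [map_sub, hf1 _ (hfP v), sub_self]

/-- A central element acts semisimply on a finite dimensional semisimple module: a polynomial in it
that is nilpotent kills each simple submodule. -/
theorem isSemisimple_of_central {z : L} (hz : ∀ x : L, ⁅z, x⁆ = 0)
    (M : Type*) [AddCommGroup M] [Module K M] [LieRingModule L M] [LieModule K L M]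
    [FiniteDimensional K M] [ComplementedLattice (LieSubmodule K L M)] :
    (toEnd K L M z).IsSemisimple := by
  set f := toEnd K L M z
  have hfint : IsIntegral K f := Algebra.IsIntegral.isIntegral f
  have hcomm : ∀ x : L, Commute (toEnd K L M x) f := fun x => by
    ext h
    have := lie_lie z x h
    rw [hz x, zero_lie] at this
    exact (sub_eq_zero.mp this.symm).symm
  have hpcomm : ∀ (x : L) (p : Polynomial K), Commute (toEnd K L M x) (Polynomial.aeval f p) :=
    fun x p => by
      induction p using Polynomial.induction_on' with
      | add p q hp hq => rw [map_add]; exact hp.add_right hq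
      | monomial n c =>
        rw [Polynomial.aeval_monomial]
        exact (Algebra.commute_algebraMap_right c _).mul_right ((hcomm x).pow_right n)
  have hstab : ∀ (A : LieSubmodule K L M) (p : Polynomial K) (v : M), v ∈ A →
      Polynomial.aeval f p v ∈ A := fun A p v hv => by
    induction p using Polynomial.induction_on' with
    | add p q hp hq => rw [map_add]; exact A.add_mem hp hq
    | monomial n c =>
      rw [Polynomial.aeval_monomial, Module.End.mul_apply, Module.algebraMap_end_apply]
      refine A.smul_mem c ?_
      induction n with
      | zero => simpa using hv
      | succ n ih => rw [pow_succ', Module.End.mul_apply]; exact A.lie_mem ih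
  have key : ∀ p : Polynomial K, Polynomial.aeval f p * Polynomial.aeval f p = 0 →
      Polynomial.aeval f p = 0 := by
    intro p hp
    let N : LieSubmodule K L M :=
      { LinearMap.ker (Polynomial.aeval f p) with
        lie_mem := fun {x v} hv => by
          have h1 : Polynomial.aeval f p v = 0 := hv
          have := congrArg (fun g : End K M => g v) (hpcomm x p).eq
          change ⁅x, Polynomial.aeval f p v⁆ = Polynomial.aeval f p ⁅x, v⁆ at this
          change Polynomial.aeval f p ⁅x, v⁆ = 0
          rw [← this, h1, lie_zero] }
    have hN : N = ⊤ := by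
      rw [eq_top_iff, ← sSup_atoms_eq_top]
      refine sSup_le fun A hA => ?_
      rcases hA.le_iff.mp (inf_le_right : N ⊓ A ≤ A) with h | h
      · refine absurd ((LieSubmodule.eq_bot_iff A).mpr fun v hv => ?_) hA.1
        have h1 : Polynomial.aeval f p v ∈ N ⊓ A :=
          ⟨congrArg (fun g : End K M => g v) hp, hstab A p v hv⟩
        rw [h] at h1
        have h2 : v ∈ N ⊓ A := ⟨(LieSubmodule.mem_bot _).mp h1, hv⟩
        rw [h] at h2
        exact (LieSubmodule.mem_bot _).mp h2
      · exact h ▸ inf_le_left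
    ext v
    have : v ∈ N := by rw [hN]; trivial
    exact this
  refine Module.End.isSemisimple_of_squarefree_aeval_eq_zero (p := minpoly K f) ?_
    (minpoly.aeval K f)
  rintro a ⟨b, hb⟩
  have h1 : Polynomial.aeval f (a * b) = 0 := by
    apply key
    rw [← map_mul, show a * b * (a * b) = minpoly K f * b by rw [hb]; ring, map_mul, minpoly.aeval,
      zero_mul]
  obtain ⟨c, hc⟩ := minpoly.dvd K f h1
  have hab : a * b ≠ 0 := fun h => minpoly.ne_zero hfint (by rw [hb, mul_assoc, h, mul_zero])
  have h2 : a * c = 1 := by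
    apply mul_right_cancel₀ hab
    rw [one_mul]
    conv_rhs => rw [hc, hb]
    ring
  exact IsUnit.of_mul_eq_one c h2

/-- A polynomial may be evaluated after applying an algebra homomorphism, here given by a map and its
properties. -/
theorem aeval_map {A B : Type*} [Ring A] [Algebra K A] [Ring B] [Algebra K B] (F : A → B)
    (hadd : ∀ a b, F (a + b) = F a + F b) (hsmul : ∀ (c : K) a, F (c • a) = c • F a)
    (hmul : ∀ a b, F (a * b) = F a * F b) (hone : F 1 = 1) (a : A) (p : Polynomial K) :
    Polynomial.aeval (F a) p = F (Polynomial.aeval a p) :=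
  Polynomial.aeval_algHom_apply (AlgHom.ofLinearMap ⟨⟨F, hadd⟩, hsmul⟩ hone hmul) a p

open scoped TensorProduct in
/-- `z` acts on a tensor product as the sum of two commuting endomorphisms, which are semisimple if
`z` acts semisimply on both factors. -/
theorem isSemisimple_toEnd_tensor {z : L} (M N : Type*) [AddCommGroup M] [Module K M]
    [LieRingModule L M] [LieModule K L M] [FiniteDimensional K M] [AddCommGroup N] [Module K N]
    [LieRingModule L N] [LieModule K L N] [FiniteDimensional K N]
    (hM : (toEnd K L M z).IsSemisimple) (hN : (toEnd K L N z).IsSemisimple) :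
    (toEnd K L (M ⊗[K] N) z).IsSemisimple := by
  have h1 : Module.End.IsSemisimple ((toEnd K L M z).rTensor N) := by
    refine Module.End.isSemisimple_of_squarefree_aeval_eq_zero hM.minpoly_squarefree ?_
    have h := aeval_map (K := K) (A := End K M) (B := End K (M ⊗[K] N))
      (fun f => LinearMap.rTensor N f) (fun f g => LinearMap.rTensor_add N f g)
      (fun c f => LinearMap.rTensor_smul N c f) (fun f g => LinearMap.rTensor_mul N f g)
      (LinearMap.rTensor_id N M) (toEnd K L M z) (minpoly K (toEnd K L M z))
    rw [minpoly.aeval, LinearMap.rTensor_zero] at h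
    exact h
  have h2 : Module.End.IsSemisimple ((toEnd K L N z).lTensor M) := by
    refine Module.End.isSemisimple_of_squarefree_aeval_eq_zero hN.minpoly_squarefree ?_
    have h := aeval_map (K := K) (A := End K N) (B := End K (M ⊗[K] N))
      (fun f => LinearMap.lTensor M f) (fun f g => LinearMap.lTensor_add M f g)
      (fun c f => LinearMap.lTensor_smul M c f) (fun f g => LinearMap.lTensor_mul M f g)
      (LinearMap.lTensor_id M N) (toEnd K L N z) (minpoly K (toEnd K L N z))
    rw [minpoly.aeval, LinearMap.lTensor_zero] at h
    exact h
  have h3 : Commute ((toEnd K L M z).rTensor N) ((toEnd K L N z).lTensor M) := by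
    refine TensorProduct.ext' fun m n => ?_
    rfl
  have h4 : toEnd K L (M ⊗[K] N) z = (toEnd K L M z).rTensor N + (toEnd K L N z).lTensor M := by
    refine TensorProduct.ext' fun m n => ?_
    exact TensorProduct.LieModule.lie_tmul_right _ _ _
  rw [h4]
  exact Module.End.IsSemisimple.add_of_commute h3 h1 h2

end Reductive

/-! ### Tensor products of semisimple modules and `𝔨`-finite vectors -/

section Reductive

open LieAlgebra LieModule

variable {K L : Type*} [Field K] [CharZero K] [LieRing L] [LieAlgebra K L] [FiniteDimensional K L]

/-- A Lie algebra whose adjoint module is semisimple is the direct sum of its center and an ideal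
with trivial radical: an abelian ideal has a complementary ideal, hence is central. -/
theorem exists_hasTrivialRadical_compl_center (hL : ComplementedLattice (LieSubmodule K L L)) :
    ∃ S : LieIdeal K L, center K L ⊔ S = ⊤ ∧ HasTrivialRadical K S := by
  obtain ⟨S, hS⟩ := hL.exists_isCompl (center K L)
  refine ⟨S, hS.sup_eq_top, ?_⟩
  rw [hasTrivialRadical_iff_no_abelian_ideals]
  intro I hI
  let J : LieSubmodule K L L :=
    { I.toSubmodule.map (S.toSubmodule.subtype) with
      lie_mem := by
        rintro x _ ⟨j, hj, rfl⟩
        have hx : x ∈ center K L ⊔ S := by rw [hS.sup_eq_top]; trivial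
        obtain ⟨z, hz, s, hs, rfl⟩ := (LieSubmodule.mem_sup _ _ _).mp hx
        refine ⟨⁅(⟨s, hs⟩ : S), j⁆, I.lie_mem hj, ?_⟩
        change ⁅s, (j : L)⁆ = ⁅z + s, (j : L)⁆
        rw [add_lie, ← lie_skew z, show ⁅(j : L), z⁆ = 0 from hz j, neg_zero, zero_add] }
  obtain ⟨C, hC⟩ := hL.exists_isCompl J
  rw [LieSubmodule.eq_bot_iff]
  intro j hj
  have hjJ : (j : L) ∈ J := ⟨j, hj, rfl⟩
  have hjZ : (j : L) ∈ center K L := by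
    refine fun x => ?_
    have hx : x ∈ J ⊔ C := by rw [hC.sup_eq_top]; trivial
    obtain ⟨_, ⟨i, hi, rfl⟩, c, hc, rfl⟩ := (LieSubmodule.mem_sup _ _ _).mp hx
    have h1 : ⁅(i : L), (j : L)⁆ = 0 := by
      have := congrArg (fun a : I => ((a : S) : L)) (hI.trivial ⟨i, hi⟩ ⟨j, hj⟩)
      exact this
    have h2 : ⁅c, (j : L)⁆ ∈ J ⊓ C := by
      refine ⟨J.lie_mem hjJ, ?_⟩
      rw [← lie_skew]
      exact C.neg_mem (C.lie_mem hc)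
    rw [hC.inf_eq_bot] at h2
    change ⁅(i : L) + c, (j : L)⁆ = 0
    rw [add_lie, h1, (LieSubmodule.mem_bot _).mp h2, add_zero]
  have h3 : (j : L) ∈ center K L ⊓ S := ⟨hjZ, j.2⟩
  rw [hS.inf_eq_bot] at h3
  exact Subtype.ext ((LieSubmodule.mem_bot _).mp h3)

open scoped TensorProduct in
/-- **Chevalley's theorem** for a reductive Lie algebra: the tensor product of two finite
dimensional semisimple modules is semisimple. -/
theorem complementedLattice_tensor (hL : ComplementedLattice (LieSubmodule K L L))
    (M N : Type*) [AddCommGroup M] [Module K M]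
    [LieRingModule L M] [LieModule K L M] [FiniteDimensional K M] [AddCommGroup N] [Module K N]
    [LieRingModule L N] [LieModule K L N] [FiniteDimensional K N]
    (hM : ComplementedLattice (LieSubmodule K L M))
    (hN : ComplementedLattice (LieSubmodule K L N)) :
    ComplementedLattice (LieSubmodule K L (M ⊗[K] N)) := by
  obtain ⟨S, hS, hS'⟩ := exists_hasTrivialRadical_compl_center hL
  have hc : ∀ z ∈ center K L, ∀ x : L, ⁅z, x⁆ = 0 := fun z hz x => by
    rw [← lie_skew, show ⁅x, z⁆ = 0 from hz x, neg_zero]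
  exact complementedLattice_of_center (center K L) S hS hc _ fun z hz =>
    isSemisimple_toEnd_tensor M N (isSemisimple_of_central (hc z hz) M)
      (isSemisimple_of_central (hc z hz) N)

end Reductive

section GKPart

theorem IsLocFinSemisimple.range {K 𝔨 M N : Type*} [Field K] [LieRing 𝔨] [LieAlgebra K 𝔨]
    [AddCommGroup M] [Module K M] [LieRingModule 𝔨 M] [LieModule K 𝔨 M] [AddCommGroup N]
    [Module K N] [LieRingModule 𝔨 N] [LieModule K 𝔨 N] (f : M →ₗ⁅K,𝔨⁆ N)
    (h : IsLocFinSemisimple K 𝔨 M) : IsLocFinSemisimple K 𝔨 f.range := by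
  let g : M →ₗ⁅K,𝔨⁆ f.range :=
    { toFun := fun m => ⟨f m, ⟨m, rfl⟩⟩
      map_add' := fun _ _ => Subtype.ext (map_add f _ _)
      map_smul' := fun _ _ => Subtype.ext (map_smul f _ _)
      map_lie' := fun {_ _} => Subtype.ext (f.map_lie _ _) }
  refine IsLocFinSemisimple.of_iSup (ι := Unit) (fun _ => g) ?_ fun _ => h
  rw [iSup_const, eq_top_iff]
  rintro ⟨_, m, rfl⟩ -
  exact ⟨m, rfl⟩

variable {K 𝔤 : Type u} [Field K] [CharZero K] [LieRing 𝔤] [LieAlgebra K 𝔤]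
  [FiniteDimensional K 𝔤] (𝔨 : LieSubalgebra K 𝔤)

section
attribute [local instance 100] LieRing.ofAssociativeRing

/-- `𝔤` generates `U(𝔤)`: by the universal property, the identity of `U(𝔤)` factors through the
generated subalgebra. -/
theorem adjoin_range_ι {K 𝔤 : Type u} [Field K] [LieRing 𝔤] [LieAlgebra K 𝔤] :
    Algebra.adjoin K (Set.range (UniversalEnvelopingAlgebra.ι K : 𝔤 → U K 𝔤)) = ⊤ := by
  set S := Algebra.adjoin K (Set.range (UniversalEnvelopingAlgebra.ι K : 𝔤 → U K 𝔤))
  let j : 𝔤 →ₗ⁅K⁆ S :=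
    { toFun := fun x => ⟨UniversalEnvelopingAlgebra.ι K x, Algebra.subset_adjoin ⟨x, rfl⟩⟩
      map_add' := fun x y => Subtype.ext (map_add _ x y)
      map_smul' := fun c x => Subtype.ext (map_smul _ c x)
      map_lie' := fun {x y} => Subtype.ext (ι_lie x y) }
  have h : S.val.comp (UniversalEnvelopingAlgebra.lift K j) = AlgHom.id K (U K 𝔤) := by
    apply UniversalEnvelopingAlgebra.hom_ext
    ext x
    change ((UniversalEnvelopingAlgebra.lift K j (UniversalEnvelopingAlgebra.ι K x) : S) : U K 𝔤) = _
    rw [UniversalEnvelopingAlgebra.lift_ι_apply]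
    rfl
  rw [eq_top_iff]
  rintro u -
  rw [← AlgHom.id_apply (R := K) u, ← h]
  exact (UniversalEnvelopingAlgebra.lift K j u).2

end

/-- Induction on the algebra generators of `U(𝔤)`. -/
@[elab_as_elim]
theorem U_induction {K 𝔤 : Type u} [Field K] [LieRing 𝔤] [LieAlgebra K 𝔤] {p : U K 𝔤 → Prop}
    (scalar : ∀ c, p (algebraMap K (U K 𝔤) c)) (lie : ∀ x, p (UniversalEnvelopingAlgebra.ι K x))
    (mul : ∀ a b, p a → p b → p (a * b)) (add : ∀ a b, p a → p b → p (a + b)) (u : U K 𝔤) : p u := by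
  have hu : u ∈ Algebra.adjoin K (Set.range (UniversalEnvelopingAlgebra.ι K : 𝔤 → U K 𝔤)) := by
    rw [adjoin_range_ι]; trivial
  induction hu using Algebra.adjoin_induction with
  | mem _ h => obtain ⟨x, rfl⟩ := h; exact lie x
  | algebraMap c => exact scalar c
  | add a b _ _ ha hb => exact add a b ha hb
  | mul a b _ _ ha hb => exact mul a b ha hb

/-- A `K`-subspace of a `U(𝔤)`-module that is stable under `𝔤` is stable under `U(𝔤)`. -/
theorem smul_mem_of_lie_mem (M : ModuleCat.{u} (U K 𝔤)) (N : Submodule K M)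
    (h : ∀ (x : 𝔤), ∀ m ∈ N, ⁅x, m⁆ ∈ N) (u : U K 𝔤) : ∀ m ∈ N, u • m ∈ N := by
  induction u using U_induction with
  | scalar c => intro m hm; rw [algebraMap_smul]; exact N.smul_mem c hm
  | lie x => exact h x
  | mul a b ha hb => intro m hm; rw [mul_smul]; exact ha _ (hb m hm)
  | add a b ha hb => intro m hm; rw [add_smul]; exact N.add_mem (ha m hm) (hb m hm)

theorem isGK_of_mono_of_mem {X M : ModuleCat.{u} (U K 𝔤)} (i : X ⟶ M) (hi : Function.Injective i)
    (F : LieSubmodule K 𝔨 M) (hF : IsLocFinSemisimple K 𝔨 F) (h : ∀ x, i x ∈ F) : isGK 𝔨 X :=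
  hF.of_injective
    { toFun := fun x => ⟨i x, h x⟩
      map_add' := fun _ _ => Subtype.ext (map_add i.hom _ _)
      map_smul' := fun _ _ => Subtype.ext (map_smul (resHom 𝔨 i) _ _)
      map_lie' := fun {y x} => Subtype.ext ((resHom 𝔨 i).map_lie y x) }
    fun _ _ hxy => hi (congrArg (fun z : F => (z : M)) hxy)

/-- In a `𝔤`-module, every locally finite semisimple `𝔨`-submodule is in the `𝔨`-finite part: if
`N` is finite dimensional semisimple then so is `𝔤 · N`, a quotient of `𝔤 ⊗ N`, so the sum of all
these submodules is stable under `𝔤`. -/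
theorem mem_gkPart_of_mem (h𝔤 : ComplementedLattice (LieSubmodule K 𝔨 𝔤))
    {M : ModuleCat.{u} (U K 𝔤)} (N : LieSubmodule K 𝔨 M) (hN : IsLocFinSemisimple K 𝔨 N)
    {m : M} (hm : m ∈ N) : m ∈ gkPart 𝔨 M := by
  have h𝔤' : IsLocFinSemisimple K 𝔨 𝔤 :=
    ⟨h𝔤, fun _ => ⟨⊤, trivial, inferInstanceAs (FiniteDimensional K (⊤ : Submodule K 𝔤))⟩⟩
  have h𝔨 : ComplementedLattice (LieSubmodule K 𝔨 𝔨) :=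
    (h𝔤'.of_injective { (𝔨.toSubmodule.subtype) with map_lie' := rfl }
      Subtype.val_injective).semisimple
  let S := {P : LieSubmodule K 𝔨 M // IsLocFinSemisimple K 𝔨 P}
  let F : LieSubmodule K 𝔨 M := ⨆ P : S, P.1
  have hle : ∀ P : S, P.1 ≤ F := fun P => le_iSup (fun P : S => P.1) P
  have hF : IsLocFinSemisimple K 𝔨 F := by
    refine IsLocFinSemisimple.of_iSup (fun P : S => LieSubmodule.inclusion (hle P)) ?_ fun P => P.2
    rw [eq_top_iff]
    rintro ⟨m, hm⟩ -
    refine LieSubmodule.iSup_induction' (fun P : S => P.1)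
      (motive := fun m hm => (⟨m, hm⟩ : F) ∈ ⨆ P : S, (LieSubmodule.inclusion (hle P)).range)
      ?_ ?_ ?_ hm
    · intro P x hx
      exact (le_iSup (fun P : S => (LieSubmodule.inclusion (hle P)).range) P) ⟨⟨x, hx⟩, rfl⟩
    · exact LieSubmodule.zero_mem _
    · intro x y _ _ hx hy
      exact add_mem hx hy
  have hstab : ∀ (x : 𝔤), ∀ m ∈ F.toSubmodule, ⁅x, m⁆ ∈ F.toSubmodule := by
    intro x m hm
    obtain ⟨Q, hQ, hfin⟩ := hF.locallyFinite ⟨m, hm⟩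
    have hQs := (hF.of_injective Q.incl Subtype.val_injective).semisimple
    have hT := complementedLattice_tensor h𝔨 𝔤 Q h𝔤 hQs
    let a : TensorProduct K 𝔤 Q →ₗ⁅K,𝔨⁆ M :=
      { TensorProduct.lift ((LieModule.toEnd K 𝔤 M : 𝔤 →ₗ[K] _).compl₂
          (F.toSubmodule.subtype ∘ₗ Q.toSubmodule.subtype)) with
        map_lie' := by
          intro y t
          induction t with
          | zero => simp
          | add s t hs ht =>
            rw [lie_add]
            simp only [AddHom.toFun_eq_coe, LinearMap.coe_toAddHom, map_add, lie_add] at hs ht ⊢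
            rw [hs, ht]
          | tmul z q =>
            rw [TensorProduct.LieModule.lie_tmul_right]
            change ⁅⁅(y : 𝔤), z⁆, ((q : F) : M)⁆ + ⁅z, ⁅(y : 𝔤), ((q : F) : M)⁆⁆ = _
            exact (leibniz_lie (y : 𝔤) z ((q : F) : M)).symm }
    have ha : IsLocFinSemisimple K 𝔨 a.range :=
      IsLocFinSemisimple.range a
        ⟨hT, fun _ => ⟨⊤, trivial,
          inferInstanceAs (FiniteDimensional K (⊤ : Submodule K (TensorProduct K 𝔤 Q)))⟩⟩
    exact hle ⟨a.range, ha⟩ ⟨x ⊗ₜ ⟨⟨m, hm⟩, hQ⟩, rfl⟩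
  let F' : Submodule (U K 𝔤) M :=
    { F.toSubmodule.toAddSubmonoid with
      smul_mem' := fun u m hm => smul_mem_of_lie_mem M F.toSubmodule hstab u m hm }
  have hF' : isGK 𝔨 (ModuleCat.of (U K 𝔤) F') := by
    exact isGK_of_mono_of_mem 𝔨 (ModuleCat.ofHom F'.subtype) Subtype.val_injective F hF fun x => x.2
  exact le_sSup (α := Submodule (U K 𝔤) M) (a := F') hF' (hle ⟨N, hN⟩ hm)

/-- A `𝔨`-equivariant map from a locally finite semisimple `𝔨`-module to a `𝔤`-module lands in the
`𝔨`-finite part. -/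
theorem mem_gkPart_of_lieHom (h𝔤 : ComplementedLattice (LieSubmodule K 𝔨 𝔤))
    {M : ModuleCat.{u} (U K 𝔤)} {X : Type*} [AddCommGroup X] [Module K X] [LieRingModule 𝔨 X]
    [LieModule K 𝔨 X] (hX : IsLocFinSemisimple K 𝔨 X) (f : X →ₗ⁅K,𝔨⁆ M) (x : X) :
    f x ∈ gkPart 𝔨 M :=
  mem_gkPart_of_mem 𝔨 h𝔤 f.range (hX.range f) ⟨x, rfl⟩

end GKPart

/-! ### The induced module `U(𝔤) ⊗_{U(𝔨)} K` -/

namespace InducedModule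

variable {K 𝔤 ι κ : Type*} [Field K] [LieRing 𝔤] [LieAlgebra K 𝔤] [LinearOrder ι]
  (e : Module.Basis (ι ⊕ κ) K 𝔤)

theorem basis_induction {p : 𝔤 → Prop} (mem : ∀ i, p (e i)) (zero : p 0)
    (add : ∀ x y, p x → p y → p (x + y)) (smul : ∀ (c : K) x, p x → p (c • x)) (x : 𝔤) : p x := by
  have hx : x ∈ Submodule.span K (Set.range e) := by rw [e.span_eq]; trivial
  induction hx using Submodule.span_induction with
  | mem _ h => obtain ⟨i, rfl⟩ := h; exact mem i
  | zero => exact zero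
  | add x y _ _ hx hy => exact add x y hx hy
  | smul c x _ hx => exact smul c x hx

/-- The position of a basis element of `𝔤` in a non-decreasing word that starts with `m`: the
elements of the subalgebra, indexed by `κ`, come last. -/
def Low : ι ⊕ κ → ι → Prop
  | .inl j, m => j ≤ m
  | .inr _, _ => False

/-- The leading term of the action of a basis element on a monomial. -/
noncomputable def lead : ι ⊕ κ → Multiset ι → (Multiset ι →₀ K)
  | .inl j, b => Finsupp.single (j ::ₘ b) 1
  | .inr _, _ => 0

/-- For `p = (m, c)`: the monomial `b` is the product of `m` and `c`, its factor `m` is minimal, and in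
the non-decreasing word for the product of `i` and `b` the factor `m` precedes `i`. -/
def IsSplit (i : ι ⊕ κ) (b : Multiset ι) (p : ι × Multiset ι) : Prop :=
  b = p.1 ::ₘ p.2 ∧ (∀ a ∈ p.2, p.1 ≤ a) ∧ ¬ Low i p.1

theorem IsSplit.unique {i : ι ⊕ κ} {b : Multiset ι} {p q : ι × Multiset ι} (hp : IsSplit i b p)
    (hq : IsSplit i b q) : p = q := by
  obtain ⟨m, c⟩ := p
  obtain ⟨m', c'⟩ := q
  obtain ⟨rfl, h1, -⟩ := hp
  obtain ⟨h2, h3, -⟩ := hq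
  simp only at h1 h2 h3
  have h4 : m = m' := by
    apply le_antisymm
    · have : m' ∈ m ::ₘ c := by rw [h2]; exact Multiset.mem_cons_self _ _
      rcases Multiset.mem_cons.mp this with h | h
      · exact h.ge
      · exact h1 _ h
    · have : m ∈ m' ::ₘ c' := by rw [← h2]; exact Multiset.mem_cons_self _ _
      rcases Multiset.mem_cons.mp this with h | h
      · exact h.ge
      · exact h3 _ h
  subst h4
  rw [(Multiset.cons_inj_right m).mp h2]

/-- The linear extension of a map given on basis elements and monomials. -/
noncomputable def extend (A : ι ⊕ κ → Multiset ι → (Multiset ι →₀ K)) :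
    𝔤 →ₗ[K] (Multiset ι →₀ K) →ₗ[K] (Multiset ι →₀ K) :=
  e.constr K fun i => Finsupp.linearCombination K (A i)

theorem extend_apply (A : ι ⊕ κ → Multiset ι → (Multiset ι →₀ K)) (i : ι ⊕ κ) (b : Multiset ι) :
    extend e A (e i) (Finsupp.single b 1) = A i b := by
  simp [extend]

open Classical in
/-- The action of basis elements on monomials, computed in at most `n` steps. If `i` cannot be put in
front of `b = m c`, the rule is `i · (m c) = m · (i · c) + [i, m] · c`. The leading term of `i · c` is
split off in the first summand, since `m` can be put in front of it, so that the recursion only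
concerns monomials of lower degree. Monomials of degree at most `n` need `n` steps. -/
noncomputable def actOn : ℕ → ι ⊕ κ → Multiset ι → (Multiset ι →₀ K)
  | 0, i, b => lead i b
  | n + 1, i, b => if h : ∃ p, IsSplit i b p then
      lead i b + extend e (actOn n) (e (.inl h.choose.1))
          (actOn n i h.choose.2 - lead i h.choose.2) +
        extend e (actOn n) ⁅e i, e (.inl h.choose.1)⁆ (Finsupp.single h.choose.2 1)
    else lead i b

theorem actOn_succ (n : ℕ) {i : ι ⊕ κ} {b : Multiset ι} {p : ι × Multiset ι} (hp : IsSplit i b p) :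
    actOn e (n + 1) i b = lead i b + extend e (actOn e n) (e (.inl p.1))
          (actOn e n i p.2 - lead i p.2) +
        extend e (actOn e n) ⁅e i, e (.inl p.1)⁆ (Finsupp.single p.2 1) := by
  have h : ∃ p, IsSplit i b p := ⟨p, hp⟩
  have hq : h.choose = p := h.choose_spec.unique hp
  rw [actOn, dif_pos h, hq]

theorem actOn_of_not_split (n : ℕ) {i : ι ⊕ κ} {b : Multiset ι} (h : ¬ ∃ p, IsSplit i b p) :
    actOn e n i b = lead i b := by
  cases n with
  | zero => rfl
  | succ n => rw [actOn, dif_neg h]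

/-- The span of the monomials of degree at most `n`. -/
def fil (K ι : Type*) [Field K] (n : ℕ) : Submodule K (Multiset ι →₀ K) :=
  Finsupp.supported K K {b | b.card ≤ n}

theorem fil_mono {m n : ℕ} (h : m ≤ n) : fil K ι m ≤ fil K ι n :=
  Finsupp.supported_mono fun _ hb => le_trans hb h

theorem single_mem_fil {b : Multiset ι} {n : ℕ} (h : b.card ≤ n) (c : K) :
    Finsupp.single b c ∈ fil K ι n :=
  Finsupp.single_mem_supported K c h

theorem lead_mem_fil (i : ι ⊕ κ) (b : Multiset ι) : (lead i b : Multiset ι →₀ K) ∈ fil K ι (b.card + 1) := by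
  rcases i with j | k
  · exact single_mem_fil (by simp) 1
  · exact Submodule.zero_mem _

theorem fil_induction {n : ℕ} {p : (Multiset ι →₀ K) → Prop}
    (hp : ∀ b : Multiset ι, b.card ≤ n → p (Finsupp.single b 1)) (h0 : p 0)
    (hadd : ∀ v w, p v → p w → p (v + w)) (hsmul : ∀ (c : K) v, p v → p (c • v))
    {v : Multiset ι →₀ K} (hv : v ∈ fil K ι n) : p v := by
  rw [fil, Finsupp.supported_eq_span_single] at hv
  induction hv using Submodule.span_induction with
  | mem _ h => obtain ⟨b, hb, rfl⟩ := h; exact hp b hb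
  | zero => exact h0
  | add v w _ _ hv hw => exact hadd v w hv hw
  | smul c v _ hv => exact hsmul c v hv

theorem extend_mem_fil {A : ι ⊕ κ → Multiset ι → (Multiset ι →₀ K)} {k l : ℕ}
    (hA : ∀ i b, b.card ≤ k → A i b ∈ fil K ι l) (x : 𝔤) {v : Multiset ι →₀ K}
    (hv : v ∈ fil K ι k) : extend e A x v ∈ fil K ι l := by
  induction x using basis_induction e with
  | zero => simp
  | add x y hx hy => rw [map_add]; exact Submodule.add_mem _ hx hy
  | smul c x hx => rw [map_smul]; exact Submodule.smul_mem _ c hx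
  | mem i =>
    refine fil_induction (p := fun v => extend e A (e i) v ∈ fil K ι l) (fun b hb => ?_) ?_ ?_ ?_ hv
    · rw [extend_apply]; exact hA i b hb
    · simp
    · intro v w h1 h2; rw [map_add]; exact Submodule.add_mem _ h1 h2
    · intro c v h1; rw [map_smul]; exact Submodule.smul_mem _ c h1

theorem extend_congr {A B : ι ⊕ κ → Multiset ι → (Multiset ι →₀ K)} {k : ℕ}
    (h : ∀ i b, b.card ≤ k → A i b = B i b) (x : 𝔤) {v : Multiset ι →₀ K}
    (hv : v ∈ fil K ι k) : extend e A x v = extend e B x v := by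
  induction x using basis_induction e with
  | zero => simp
  | add x y hx hy => simp only [map_add, LinearMap.add_apply, hx, hy]
  | smul c x hx => simp only [map_smul, LinearMap.smul_apply, hx]
  | mem i =>
    refine fil_induction (p := fun v => extend e A (e i) v = extend e B (e i) v)
      (fun b hb => ?_) ?_ ?_ ?_ hv
    · rw [extend_apply, extend_apply, h i b hb]
    · simp
    · intro v w h1 h2; rw [map_add, map_add, h1, h2]
    · intro c v h1; rw [map_smul, map_smul, h1]

theorem actOn_sub_lead_mem (n : ℕ) : ∀ (i : ι ⊕ κ) (b : Multiset ι),
    actOn e n i b - lead i b ∈ fil K ι b.card := by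
  induction n with
  | zero => intro i b; simp [actOn]
  | succ n ih =>
    intro i b
    by_cases h : ∃ p, IsSplit i b p
    · obtain ⟨⟨m, c⟩, hp⟩ := h
      have hc : b.card = c.card + 1 := by rw [hp.1]; simp
      have h1 : ∀ i (d : Multiset ι), d.card ≤ c.card → actOn e n i d ∈ fil K ι b.card := by
        intro i d hd
        rw [← sub_add_cancel (actOn e n i d) (lead i d)]
        exact Submodule.add_mem _ (fil_mono (by omega) (ih i d))
          (fil_mono (by omega) (lead_mem_fil i d))
      rw [actOn_succ e n hp, add_assoc, add_sub_cancel_left]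
      exact Submodule.add_mem _ (extend_mem_fil e h1 _ (ih i c))
        (extend_mem_fil e h1 _ (single_mem_fil le_rfl 1))
    · rw [actOn_of_not_split e _ h, sub_self]; exact Submodule.zero_mem _

theorem actOn_succ_eq (n : ℕ) : ∀ (i : ι ⊕ κ) (b : Multiset ι), b.card ≤ n →
    actOn e (n + 1) i b = actOn e n i b := by
  induction n with
  | zero =>
    intro i b hb
    have : ¬ ∃ p, IsSplit i b p := by
      rintro ⟨p, hp⟩
      rw [hp.1] at hb
      simp at hb
    rw [actOn_of_not_split e _ this, actOn_of_not_split e _ this]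
  | succ n ih =>
    intro i b hb
    by_cases h : ∃ p, IsSplit i b p
    · obtain ⟨⟨m, c⟩, hp⟩ := h
      have hc : b.card = c.card + 1 := by rw [hp.1]; simp
      rw [actOn_succ e _ hp, actOn_succ e _ hp, ih i c (by omega),
        extend_congr e ih _ (fil_mono (by omega) (actOn_sub_lead_mem e n i c)),
        extend_congr e ih _ (single_mem_fil (by simp; omega) 1)]
    · rw [actOn_of_not_split e _ h, actOn_of_not_split e _ h]

theorem actOn_eq {n : ℕ} {i : ι ⊕ κ} {b : Multiset ι} (h : b.card ≤ n) :
    actOn e n i b = actOn e b.card i b := by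
  induction n, h using Nat.le_induction with
  | base => rfl
  | succ n hn ih => rw [actOn_succ_eq e n i b hn, ih]

/-- The action of `𝔤` on the module induced from the trivial module of the subalgebra indexed
by `κ`, a vector space with a basis of monomials in the elements indexed by `ι`. -/
noncomputable def act : 𝔤 →ₗ[K] (Multiset ι →₀ K) →ₗ[K] (Multiset ι →₀ K) :=
  extend e fun i b => actOn e b.card i b

theorem act_single_sub_lead_mem (i : ι ⊕ κ) (b : Multiset ι) :
    act e (e i) (Finsupp.single b 1) - lead i b ∈ fil K ι b.card := by
  rw [act, extend_apply]; exact actOn_sub_lead_mem e _ i b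

theorem act_low {j : ι} {b : Multiset ι} (h : ∀ a ∈ b, j ≤ a) :
    act e (e (.inl j)) (Finsupp.single b 1) = Finsupp.single (j ::ₘ b) 1 := by
  rw [act, extend_apply, actOn_of_not_split]
  · rfl
  · rintro ⟨p, hp, -, hn⟩
    exact hn (h p.1 (by rw [hp]; exact Multiset.mem_cons_self _ _))

theorem act_inr_zero (k : κ) : act e (e (.inr k)) (Finsupp.single 0 1) = 0 := by
  rw [act, extend_apply, actOn_of_not_split]
  · rfl
  · rintro ⟨p, hp, -⟩
    exact Multiset.zero_ne_cons hp

/-- The defining recursion of the action. -/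
theorem act_cons {i : ι ⊕ κ} {m : ι} {b : Multiset ι} (hm : ∀ a ∈ b, m ≤ a) (hi : ¬ Low i m) :
    act e (e i) (Finsupp.single (m ::ₘ b) 1) =
      act e (e (.inl m)) (act e (e i) (Finsupp.single b 1)) +
        act e ⁅e i, e (.inl m)⁆ (Finsupp.single b 1) := by
  have hp : IsSplit i (m ::ₘ b) (m, b) := ⟨rfl, hm, hi⟩
  have hcongr : ∀ i (c : Multiset ι), c.card ≤ b.card →
      actOn e b.card i c = actOn e c.card i c := fun i c hc => actOn_eq e hc
  have hlead : act e (e (.inl m)) (lead i b) = lead i (m ::ₘ b) := by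
    rcases i with j | k
    · have : m ≤ j := le_of_not_ge hi
      rw [lead, act_low, Multiset.cons_swap]
      · rfl
      · intro a ha
        rcases Multiset.mem_cons.mp ha with h | h
        · exact h ▸ this
        · exact hm a h
    · exact map_zero _
  conv_lhs => rw [act, extend_apply, Multiset.card_cons, actOn_succ e _ hp]
  rw [extend_congr e hcongr _ (actOn_sub_lead_mem e b.card i b),
    extend_congr e hcongr _ (single_mem_fil le_rfl 1), ← act, map_sub, hlead]
  rw [show actOn e b.card i b = act e (e i) (Finsupp.single b 1) by rw [act, extend_apply]]
  abel

/-- The commutation rule holds for basis elements at a monomial `b` if one of them can be put in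
front of `b`. -/
theorem act_comm_of_low {i : ι ⊕ κ} {m : ι} {b : Multiset ι} (hm : ∀ a ∈ b, m ≤ a)
    (hi : ¬ Low i m) : act e (e i) (act e (e (.inl m)) (Finsupp.single b 1)) =
      act e (e (.inl m)) (act e (e i) (Finsupp.single b 1)) +
        act e ⁅e i, e (.inl m)⁆ (Finsupp.single b 1) := by
  rw [act_low e hm, act_cons e hm hi]

theorem act_comm_fil {n : ℕ}
    (h : ∀ (i j : ι ⊕ κ) (b : Multiset ι), b.card ≤ n →
      act e (e i) (act e (e j) (Finsupp.single b 1)) =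
        act e (e j) (act e (e i) (Finsupp.single b 1)) + act e ⁅e i, e j⁆ (Finsupp.single b 1))
    (x y : 𝔤) {v : Multiset ι →₀ K} (hv : v ∈ fil K ι n) :
    act e x (act e y v) = act e y (act e x v) + act e ⁅x, y⁆ v := by
  refine fil_induction (p := fun v => act e x (act e y v) = act e y (act e x v) + act e ⁅x, y⁆ v)
    (fun b hb => ?_) ?_ ?_ ?_ hv
  · induction x using basis_induction e with
    | zero => simp
    | add x x' hx hx' =>
      simp only [map_add, LinearMap.add_apply, hx, hx', add_lie]; abel
    | smul c x hx => simp only [map_smul, LinearMap.smul_apply, hx, smul_lie, smul_add]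
    | mem i =>
      induction y using basis_induction e with
      | zero => simp
      | add y y' hy hy' =>
        simp only [map_add, LinearMap.add_apply, hy, hy', lie_add]; abel
      | smul c y hy => simp only [map_smul, LinearMap.smul_apply, hy, lie_smul, smul_add]
      | mem j => exact h i j b hb
  · simp
  · intro v w hv hw; simp only [map_add, hv, hw]; abel
  · intro c v hv; simp only [map_smul, hv, smul_add]

theorem exists_min_cons {b : Multiset ι} (hb : b ≠ 0) :
    ∃ m c, b = m ::ₘ c ∧ ∀ a ∈ c, m ≤ a := by
  obtain ⟨m, hm, hmin⟩ := Finset.exists_min_image b.toFinset id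
    (by rwa [Multiset.toFinset_nonempty])
  obtain ⟨c, rfl⟩ := Multiset.exists_cons_of_mem (Multiset.mem_toFinset.mp hm)
  exact ⟨m, c, rfl, fun a ha => hmin a (by simp [ha])⟩

variable (h𝔨 : ∀ k l : κ, ⁅e (.inr k), e (.inr l)⁆ ∈ Submodule.span K (Set.range (e ∘ .inr)))
include h𝔨

/-- The commutation rule, by induction on the degree of the monomial `b`: if no factor can be put in
front of `b = m c`, it is reduced to the monomial `c` by the Jacobi identity. -/
theorem act_comm_single (n : ℕ) : ∀ (i j : ι ⊕ κ) (b : Multiset ι), b.card = n →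
    act e (e i) (act e (e j) (Finsupp.single b 1)) =
      act e (e j) (act e (e i) (Finsupp.single b 1)) + act e ⁅e i, e j⁆ (Finsupp.single b 1) := by
  induction n using Nat.strong_induction_on with
  | _ n ih =>
    intro i j b hb
    have hflip : ∀ i j : ι ⊕ κ, act e (e i) (act e (e j) (Finsupp.single b 1)) =
        act e (e j) (act e (e i) (Finsupp.single b 1)) + act e ⁅e i, e j⁆ (Finsupp.single b 1) →
        act e (e j) (act e (e i) (Finsupp.single b 1)) =
        act e (e i) (act e (e j) (Finsupp.single b 1)) + act e ⁅e j, e i⁆ (Finsupp.single b 1) := by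
      intro i j h
      rw [h, ← lie_skew, map_neg, LinearMap.neg_apply]; abel
    -- the case that `m` can be put in front of `b`
    have hlow : ∀ (m : ι) (i : ι ⊕ κ), (∀ a ∈ b, m ≤ a) →
        (¬ Low i m ∨ ∃ l, i = .inl l ∧ ∀ a ∈ b, l ≤ a) →
        act e (e i) (act e (e (.inl m)) (Finsupp.single b 1)) =
        act e (e (.inl m)) (act e (e i) (Finsupp.single b 1)) +
          act e ⁅e i, e (.inl m)⁆ (Finsupp.single b 1) := by
      rintro m i hm (hi | ⟨l, rfl, hl⟩)
      · exact act_comm_of_low e hm hi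
      · rcases lt_trichotomy l m with h | rfl | h
        · exact hflip _ _ (act_comm_of_low e hl (not_le.mpr h))
        · simp
        · exact act_comm_of_low e hm (not_le.mpr h)
    by_cases h0 : b = 0
    · subst h0
      rcases i with i | k
      · refine hflip _ _ (hlow i j (by simp) ?_)
        rcases j with j | l
        · exact Or.inr ⟨j, rfl, by simp⟩
        · exact Or.inl id
      rcases j with j | l
      · exact hlow j _ (by simp) (Or.inl id)
      · rw [act_inr_zero, act_inr_zero, map_zero, map_zero, zero_add]
        have : ∀ x ∈ Submodule.span K (Set.range (e ∘ Sum.inr)), act e x (Finsupp.single 0 1) = 0 := by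
          intro x hx
          induction hx using Submodule.span_induction with
          | mem _ h => obtain ⟨k, rfl⟩ := h; exact act_inr_zero e k
          | zero => simp
          | add x y _ _ hx hy => rw [map_add, LinearMap.add_apply, hx, hy, add_zero]
          | smul c x _ hx => rw [map_smul, LinearMap.smul_apply, hx, smul_zero]
        exact (this _ (h𝔨 k l)).symm
    obtain ⟨m, c, rfl, hm⟩ := exists_min_cons h0
    have hmb : ∀ a ∈ m ::ₘ c, m ≤ a := by
      intro a ha
      rcases Multiset.mem_cons.mp ha with h | h
      · exact h.ge
      · exact hm a h
    have hc : c.card < n := by rw [← hb]; simp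
    have ihc : ∀ (x y : 𝔤) {v : Multiset ι →₀ K}, v ∈ fil K ι c.card →
        act e x (act e y v) = act e y (act e x v) + act e ⁅x, y⁆ v :=
      act_comm_fil e fun i j b hb => ih b.card (by omega) i j b rfl
    by_cases hi : Low i m
    · rcases i with i | k
      · have hib : ∀ a ∈ m ::ₘ c, i ≤ a := fun a ha => le_trans hi (hmb a ha)
        refine hflip _ _ (hlow i j hib ?_)
        by_cases hj : Low j m
        · rcases j with j | l
          · exact Or.inr ⟨j, rfl, fun a ha => le_trans hj (hmb a ha)⟩
          · exact hj.elim
        · rcases j with j | l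
          · exact Or.inl fun h => hj (le_trans h hi)
          · exact Or.inl id
      · exact hi.elim
    by_cases hj : Low j m
    · rcases j with j | k
      · have hjb : ∀ a ∈ m ::ₘ c, j ≤ a := fun a ha => le_trans hj (hmb a ha)
        refine hlow j i hjb (Or.inl ?_)
        rcases i with i | l
        · exact fun h => hi (le_trans h hj)
        · exact id
      · exact hj.elim
    have hz : Finsupp.single (m ::ₘ c) (1 : K) = act e (e (.inl m)) (Finsupp.single c 1) :=
      (act_low e hm).symm
    -- `m` commutes with `i` on the vector `j c`, whose leading term is `0` or starts with `m`
    have key : ∀ i j : ι ⊕ κ, ¬ Low i m → ¬ Low j m →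
        act e (e i) (act e (e (.inl m)) (act e (e j) (Finsupp.single c 1))) =
        act e (e (.inl m)) (act e (e i) (act e (e j) (Finsupp.single c 1))) +
          act e ⁅e i, e (.inl m)⁆ (act e (e j) (Finsupp.single c 1)) := by
      intro i j hi hj
      have h1 : act e (e i) (act e (e (.inl m)) (lead j c)) =
          act e (e (.inl m)) (act e (e i) (lead j c)) + act e ⁅e i, e (.inl m)⁆ (lead j c) := by
        rcases j with j | k
        · refine act_comm_of_low e (fun a ha => ?_) hi
          rcases Multiset.mem_cons.mp ha with h | h
          · exact h ▸ le_of_not_ge hj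
          · exact hm a h
        · simp [lead]
      have h2 := ihc (e i) (e (.inl m)) (act_single_sub_lead_mem e j c)
      simp only [map_sub] at h2
      rw [h1] at h2
      have h3 := congrArg (· + (act e (e (.inl m)) (act e (e i) (lead j c)) +
        act e ⁅e i, e (.inl m)⁆ (lead j c))) h2
      simp only [sub_add_cancel] at h3
      rw [h3]; abel
    have hs : Finsupp.single c (1 : K) ∈ fil K ι c.card := single_mem_fil le_rfl 1
    have expand : ∀ i j : ι ⊕ κ, ¬ Low i m → ¬ Low j m →
        act e (e i) (act e (e j) (Finsupp.single (m ::ₘ c) 1)) =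
        act e (e (.inl m)) (act e (e i) (act e (e j) (Finsupp.single c 1))) +
          act e ⁅e i, e (.inl m)⁆ (act e (e j) (Finsupp.single c 1)) +
          act e ⁅e j, e (.inl m)⁆ (act e (e i) (Finsupp.single c 1)) +
          act e ⁅e i, ⁅e j, e (.inl m)⁆⁆ (Finsupp.single c 1) := by
      intro i j hi hj
      rw [hz, ihc (e j) (e (.inl m)) hs, map_add, key i j hi hj,
        ihc (e i) ⁅e j, e (.inl m)⁆ hs]
      abel
    rw [expand i j hi hj, expand j i hj hi, hz, ihc ⁅e i, e j⁆ _ hs, ihc (e i) (e j) hs, map_add,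
      lie_lie (e i) (e j), map_sub, LinearMap.sub_apply]
    abel

attribute [local instance 100] LieRing.ofAssociativeRing

/-- The induced module, as a representation of `𝔤`. -/
noncomputable def rep : 𝔤 →ₗ⁅K⁆ Module.End K (Multiset ι →₀ K) :=
  { act e with
    map_lie' := by
      intro x y
      refine Finsupp.lhom_ext' fun b => LinearMap.ext_ring ?_
      have h := act_comm_fil e (n := b.card)
        (fun i j c _ => act_comm_single e h𝔨 c.card i j c rfl) x y
        (single_mem_fil (ι := ι) (b := b) le_rfl (1 : K))
      change act e ⁅x, y⁆ (Finsupp.single b 1) = act e x (act e y (Finsupp.single b 1)) -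
        act e y (act e x (Finsupp.single b 1))
      rw [h]; abel }

end InducedModule

/-! ### A coordinate map `U(𝔤) → 𝔤` that is equivariant for `𝔨` -/

section Coordinate

/-- An embedding into a semisimple module has a retraction that vanishes on a given submodule disjoint
from the image. -/
theorem exists_retraction {K L M P : Type*} [Field K] [LieRing L] [LieAlgebra K L]
    [AddCommGroup M] [Module K M] [LieRingModule L M] [LieModule K L M] [AddCommGroup P]
    [Module K P] [LieRingModule L P] [LieModule K L P]
    (hM : ComplementedLattice (LieSubmodule K L M)) (i : P →ₗ⁅K,L⁆ M) (hi : Function.Injective i)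
    (B : LieSubmodule K L M) (hB : Disjoint i.range B) :
    ∃ r : M →ₗ⁅K,L⁆ P, (∀ p, r (i p) = p) ∧ ∀ b ∈ B, r b = 0 := by
  obtain ⟨C', hC'⟩ := hM.exists_isCompl (i.range ⊔ B)
  have hd : Disjoint i.range (B ⊔ C') := hB.disjoint_sup_right_of_disjoint_sup_left hC'.disjoint
  have htop : i.range ⊔ (B ⊔ C') = ⊤ := by rw [← sup_assoc, hC'.sup_eq_top]
  have hex : ∀ m, ∃ p, m - i p ∈ B ⊔ C' := by
    intro m
    have hm : m ∈ i.range ⊔ (B ⊔ C') := by rw [htop]; trivial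
    obtain ⟨_, ⟨p, rfl⟩, c, hc, rfl⟩ := (LieSubmodule.mem_sup _ _ _).mp hm
    exact ⟨p, by rwa [add_sub_cancel_left]⟩
  choose r hr using hex
  have huniq : ∀ m p, m - i p ∈ B ⊔ C' → r m = p := by
    intro m p hp
    have h1 : i (r m - p) ∈ i.range ⊓ (B ⊔ C') := by
      refine ⟨⟨_, rfl⟩, ?_⟩
      have := sub_mem hp (hr m)
      rwa [sub_sub_sub_cancel_left, ← map_sub] at this
    rw [hd.eq_bot, LieSubmodule.mem_bot] at h1
    exact sub_eq_zero.mp (hi (h1.trans (map_zero i).symm))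
  refine ⟨{ toFun := r
            map_add' := fun m n => huniq _ _ ?_
            map_smul' := fun c m => huniq _ _ ?_
            map_lie' := fun {x m} => huniq _ _ ?_ },
    fun p => huniq _ _ ?_, fun b hb => huniq _ _ ?_⟩
  · rw [map_add, add_sub_add_comm]; exact add_mem (hr m) (hr n)
  · rw [RingHom.id_apply, map_smul, ← smul_sub]; exact (B ⊔ C').smul_mem c (hr m)
  · rw [LieModuleHom.map_lie, ← lie_sub]; exact (B ⊔ C').lie_mem (hr m)
  · rw [sub_self]; exact zero_mem _
  · rw [map_zero, sub_zero]; exact (le_sup_left : B ≤ B ⊔ C') hb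

section
attribute [local instance 100] LieRing.ofAssociativeRing

/-- The part of the **Poincaré–Birkhoff–Witt theorem** that is needed: `K ⊕ 𝔤/𝔨` is contained
in `U(𝔤)/U(𝔤)𝔨`. -/
theorem eq_zero_and_mem_of_mem_span {K 𝔤 : Type u} [Field K] [LieRing 𝔤] [LieAlgebra K 𝔤]
    (𝔨 : LieSubalgebra K 𝔤) {c : K} {x : 𝔤}
    (h : algebraMap K (U K 𝔤) c + UniversalEnvelopingAlgebra.ι K x ∈
      Submodule.span (U K 𝔤) (UniversalEnvelopingAlgebra.ι K '' (𝔨 : Set 𝔤))) :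
    c = 0 ∧ x ∈ 𝔨 := by
  obtain ⟨p, hp⟩ := Submodule.exists_isCompl 𝔨.toSubmodule
  let e := ((Module.Basis.ofVectorSpace K p).prod (Module.Basis.ofVectorSpace K 𝔨.toSubmodule)).map
    (Submodule.prodEquivOfIsCompl _ _ hp.symm)
  let ι := Module.Basis.ofVectorSpaceIndex K p
  let : LinearOrder ι := IsWellOrder.linearOrder WellOrderingRel
  have he : ∀ k, e (.inr k) = (Module.Basis.ofVectorSpace K 𝔨.toSubmodule k : 𝔤) := by
    intro k; simp [e]
  have hspan : Submodule.span K (Set.range (e ∘ Sum.inr)) = 𝔨.toSubmodule := by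
    have h1 : Set.range (e ∘ Sum.inr) =
        𝔨.toSubmodule.subtype '' Set.range (Module.Basis.ofVectorSpace K 𝔨.toSubmodule) := by
      rw [← Set.range_comp]
      exact congrArg Set.range (funext he)
    rw [h1, ← Submodule.map_span, Module.Basis.span_eq, Submodule.map_top, Submodule.range_subtype]
  have h𝔨 : ∀ k l, ⁅e (.inr k), e (.inr l)⁆ ∈ Submodule.span K (Set.range (e ∘ Sum.inr)) := by
    intro k l
    rw [hspan, he, he]
    exact 𝔨.lie_mem (SetLike.coe_mem _) (SetLike.coe_mem _)
  let ρ := UniversalEnvelopingAlgebra.lift K (InducedModule.rep e h𝔨)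
  let z : Multiset ι →₀ K := Finsupp.single 0 1
  have hρ : ∀ x, ρ (UniversalEnvelopingAlgebra.ι K x) z = InducedModule.act e x z := fun x => by
    change UniversalEnvelopingAlgebra.lift K (InducedModule.rep e h𝔨) _ z = _
    rw [UniversalEnvelopingAlgebra.lift_ι_apply]; rfl
  have hz : ∀ y ∈ 𝔨, InducedModule.act e y z = 0 := by
    intro y hy
    have hy' : y ∈ Submodule.span K (Set.range (e ∘ Sum.inr)) := by rw [hspan]; exact hy
    clear hy
    induction hy' using Submodule.span_induction with
    | mem _ h => obtain ⟨k, rfl⟩ := h; exact InducedModule.act_inr_zero e k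
    | zero => simp
    | add x y _ _ hx hy => rw [map_add, LinearMap.add_apply, hx, hy, add_zero]
    | smul c x _ hx => rw [map_smul, LinearMap.smul_apply, hx, smul_zero]
  have hJ : ∀ u ∈ Submodule.span (U K 𝔤) (UniversalEnvelopingAlgebra.ι K '' (𝔨 : Set 𝔤)),
      ρ u z = 0 := by
    intro u hu
    induction hu using Submodule.span_induction with
    | mem _ h => obtain ⟨y, hy, rfl⟩ := h; rw [hρ, hz y hy]
    | zero => simp
    | add u v _ _ hu hv => rw [map_add, LinearMap.add_apply, hu, hv, add_zero]
    | smul a u _ hu => rw [smul_eq_mul, map_mul, Module.End.mul_apply, hu, map_zero]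
  have h0 := hJ _ h
  rw [map_add, AlgHom.commutes, LinearMap.add_apply, hρ, Module.algebraMap_end_apply] at h0
  have hact : ∀ x, InducedModule.act e x z 0 = 0 ∧
      ∀ i, InducedModule.act e x z {i} = e.repr x (.inl i) := by
    intro x
    induction x using InducedModule.basis_induction e with
    | zero => simp
    | add x y hx hy => exact ⟨by simp [hx.1, hy.1], fun i => by simp [hx.2 i, hy.2 i]⟩
    | smul c x hx => exact ⟨by simp [hx.1], fun i => by simp [hx.2 i]⟩
    | mem i =>
      rcases i with j | k
      · rw [InducedModule.act_low e (by simp)]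
        refine ⟨by simp, fun i => ?_⟩
        classical
        rw [Module.Basis.repr_self, Finsupp.single_apply, Finsupp.single_apply]
        simp [Multiset.singleton_inj]
      · rw [InducedModule.act_inr_zero]; simp
  have hc : c = 0 := by
    have h1 := congrArg (fun v : Multiset ι →₀ K => v 0) h0
    simpa [z, (hact x).1] using h1
  refine ⟨hc, ?_⟩
  rw [← LieSubalgebra.mem_toSubmodule, ← hspan, ← e.linearCombination_repr x,
    Finsupp.linearCombination_apply]
  refine Submodule.sum_mem _ fun i _ => ?_
  rcases i with j | k
  · have h1 := congrArg (fun v : Multiset ι →₀ K => v {j}) h0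
    have h2 : InducedModule.act e x z {j} = 0 := by simpa [hc] using h1
    have h3 : e.repr x (.inl j) • e (.inl j) = 0 := by rw [← (hact x).2 j, h2, zero_smul]
    change e.repr x (.inl j) • e (.inl j) ∈ _
    rw [h3]
    exact Submodule.zero_mem _
  · exact Submodule.smul_mem _ _ (Submodule.subset_span ⟨k, rfl⟩)
end

variable {K 𝔤 : Type u} [Field K] [CharZero K] [LieRing 𝔤] [LieAlgebra K 𝔤]
  [FiniteDimensional K 𝔤] (𝔨 : LieSubalgebra K 𝔤)

/-- A `𝔨`-equivariant linear coordinate on `U(𝔤)/U(𝔤)𝔨` that extends the projection of `𝔤` to a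
`𝔨`-stable complement of `𝔨`. It exists because `U(𝔤)/U(𝔤)𝔨` is generated by an invariant of `𝔨`,
so that it is a semisimple `𝔨`-module. -/
theorem exists_coordinate (h𝔤 : ComplementedLattice (LieSubmodule K 𝔨 𝔤)) :
    ∃ e : U K 𝔤 →ₗ[K] 𝔤, e 1 = 0 ∧
      (∀ x, e (UniversalEnvelopingAlgebra.ι K x) - x ∈ 𝔨) ∧
      (∀ u, ∀ y ∈ 𝔨, e (u * UniversalEnvelopingAlgebra.ι K y) = 0) ∧
      ∀ u, ∀ y ∈ 𝔨, e (UniversalEnvelopingAlgebra.ι K y * u) = ⁅y, e u⁆ := by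
  let J : Submodule (U K 𝔤) (U K 𝔤) :=
    Submodule.span (U K 𝔤) (UniversalEnvelopingAlgebra.ι K '' (𝔨 : Set 𝔤))
  obtain ⟨Q, q, hq0, hq⟩ : ∃ (Q : ModuleCat.{u} (U K 𝔤)) (q : Q), (∀ u : U K 𝔤, u • q = 0 ↔ u ∈ J) ∧
      ∀ m : Q, ∃ u : U K 𝔤, u • q = m := by
    refine ⟨ModuleCat.of (U K 𝔤) (U K 𝔤 ⧸ J), J.mkQ 1, fun u => ?_, fun m => ?_⟩
    · rw [← map_smul, smul_eq_mul, mul_one]; exact Submodule.Quotient.mk_eq_zero J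
    · obtain ⟨u, rfl⟩ := J.mkQ_surjective m
      exact ⟨u, by rw [← map_smul, smul_eq_mul, mul_one]⟩
  have hkq : ∀ y ∈ 𝔨, ⁅y, q⁆ = 0 := fun y hy => (hq0 _).mpr (Submodule.subset_span ⟨y, hy, rfl⟩)
  let f : triv K 𝔤 →ₗ⁅K,𝔨⁆ Q :=
    { (LinearMap.toSpanSingleton K Q q) ∘ₗ trivVal K 𝔤 with
      map_lie' := by
        intro y t
        change trivVal K 𝔤 ⁅(y : 𝔤), t⁆ • q = ⁅(y : 𝔤), trivVal K 𝔤 t • q⁆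
        rw [triv_lie, map_zero, zero_smul, lie_smul, hkq y y.2, smul_zero] }
  have hQ : isGK 𝔨 Q := by
    refine isGK_of_iSup 𝔨 (ι := Unit) (fun _ => gkIncl 𝔨 Q) ?_ fun _ => isGK_gkPart 𝔨 Q
    rw [iSup_const, eq_top_iff]
    rintro m -
    obtain ⟨u, rfl⟩ := hq m
    have h1 : q ∈ gkPart 𝔨 Q := by
      have := mem_gkPart_of_lieHom 𝔨 h𝔤 (isGK_triv 𝔨) f (1 : K)
      rwa [show f (1 : K) = q from one_smul K q] at this
    exact ⟨⟨u • q, Submodule.smul_mem _ u h1⟩, rfl⟩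
  obtain ⟨p, hp⟩ := h𝔤.exists_isCompl 𝔨.toLieSubmodule
  have hdec : ∀ x : 𝔤, ∃ y ∈ 𝔨, ∃ w ∈ p, y + w = x := by
    intro x
    have hx : x ∈ 𝔨.toLieSubmodule ⊔ p := by rw [hp.sup_eq_top]; trivial
    exact (LieSubmodule.mem_sup _ _ _).mp hx
  let i : p →ₗ⁅K,𝔨⁆ Q :=
    { toFun := fun w => ⁅(w : 𝔤), q⁆
      map_add' := fun v w => add_lie (v : 𝔤) (w : 𝔤) q
      map_smul' := fun c w => smul_lie c (w : 𝔤) q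
      map_lie' := fun {y w} => by
        change ⁅⁅(y : 𝔤), (w : 𝔤)⁆, q⁆ = ⁅(y : 𝔤), ⁅(w : 𝔤), q⁆⁆
        rw [lie_lie, hkq y y.2, lie_zero, sub_zero] }
  have hi : ∀ w, i w = ⁅(w : 𝔤), q⁆ := fun w => rfl
  have hkey : ∀ (c : K) (w : p), c • q + i w = 0 → c = 0 ∧ w = 0 := by
    intro c w h
    rw [hi, lie_def, ← algebraMap_smul (U K 𝔤) c q, ← add_smul, hq0] at h
    obtain ⟨h1, h2⟩ := eq_zero_and_mem_of_mem_span 𝔨 h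
    refine ⟨h1, Subtype.ext ?_⟩
    have : (w : 𝔤) ∈ 𝔨.toLieSubmodule ⊓ p := ⟨h2, w.2⟩
    rwa [hp.inf_eq_bot, LieSubmodule.mem_bot] at this
  obtain ⟨r, hr, hr0⟩ := exists_retraction hQ.semisimple i
    (fun v w hvw => sub_eq_zero.mp (hkey 0 (v - w) (by rw [map_sub, hvw]; simp)).2) f.range (by
      rw [disjoint_iff, LieSubmodule.eq_bot_iff]
      rintro _ ⟨⟨w, rfl⟩, t, ht⟩
      have := hkey (-trivVal K 𝔤 t) w (by
        have ht' : trivVal K 𝔤 t • q = i w := ht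
        rw [← ht', neg_smul, neg_add_cancel])
      rw [show w = 0 from this.2]; exact map_zero i)
  refine ⟨p.toSubmodule.subtype ∘ₗ (r : Q →ₗ[K] p) ∘ₗ
    (LinearMap.toSpanSingleton (U K 𝔤) Q q).restrictScalars K, ?_, ?_, ?_, ?_⟩
  · change ((r ((1 : U K 𝔤) • q) : p) : 𝔤) = 0
    rw [one_smul, hr0 q ⟨(1 : K), one_smul K q⟩]; rfl
  · intro x
    obtain ⟨y, hy, w, hw, rfl⟩ := hdec x
    change ((r ⁅y + w, q⁆ : p) : 𝔤) - (y + w) ∈ 𝔨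
    rw [add_lie, hkq y hy, zero_add, show ⁅w, q⁆ = i ⟨w, hw⟩ from rfl, hr]
    simpa using hy
  · intro u y hy
    change ((r ((u * UniversalEnvelopingAlgebra.ι K y) • q) : p) : 𝔤) = 0
    rw [mul_smul, ← lie_def, hkq y hy, smul_zero, map_zero]; rfl
  · intro u y hy
    change ((r ((UniversalEnvelopingAlgebra.ι K y * u) • q) : p) : 𝔤) = ⁅y, ((r (u • q) : p) : 𝔤)⁆
    rw [mul_smul, ← lie_def]
    exact congrArg Subtype.val (r.map_lie ⟨y, hy⟩ (u • q))

end Coordinate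

/-! ### Words in the enveloping algebra and cochains determined by them -/

section Words

variable {K 𝔤 : Type u} [Field K] [LieRing 𝔤] [LieAlgebra K 𝔤]

variable (K) in
/-- The product in `U(𝔤)` of a word in elements of `𝔤`. -/
def word (L : List 𝔤) : U K 𝔤 := (L.map (UniversalEnvelopingAlgebra.ι K)).prod

@[simp] theorem word_nil : word K ([] : List 𝔤) = 1 := rfl

theorem word_cons (x : 𝔤) (L : List 𝔤) :
    word K (x :: L) = UniversalEnvelopingAlgebra.ι K x * word K L := List.prod_cons

theorem word_append (L L' : List 𝔤) : word K (L ++ L') = word K L * word K L' := by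
  simp [word]

theorem word_concat (L : List 𝔤) (x : 𝔤) :
    word K (L ++ [x]) = word K L * UniversalEnvelopingAlgebra.ι K x := by
  rw [word_append, word_cons, word_nil, mul_one]

theorem mem_span_word (u : U K 𝔤) : u ∈ Submodule.span K (Set.range (word K : List 𝔤 → U K 𝔤)) := by
  set W := Submodule.span K (Set.range (word K : List 𝔤 → U K 𝔤))
  have h : ∀ u : U K 𝔤, ∀ v ∈ W, u * v ∈ W := by
    intro u
    induction u using U_induction with
    | scalar c => intro v hv; rw [← Algebra.smul_def]; exact W.smul_mem c hv
    | lie x =>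
      intro v hv
      induction hv using Submodule.span_induction with
      | mem _ h => obtain ⟨L, rfl⟩ := h; exact Submodule.subset_span ⟨x :: L, word_cons x L⟩
      | zero => rw [mul_zero]; exact W.zero_mem
      | add a b _ _ ha hb => rw [mul_add]; exact W.add_mem ha hb
      | smul c a _ ha => rw [mul_smul_comm]; exact W.smul_mem c ha
    | mul a b ha hb => intro v hv; rw [mul_assoc]; exact ha _ (hb v hv)
    | add a b ha hb => intro v hv; rw [add_mul]; exact W.add_mem (ha v hv) (hb v hv)
  rw [← mul_one u]
  exact h u 1 (Submodule.subset_span ⟨[], rfl⟩)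

variable {V : ModuleCat.{u} (U K 𝔤)}

theorem Coeff.ext_word {F G : Coeff V} (h : ∀ L, F (word K L) = G (word K L)) : F = G := by
  ext u
  induction mem_span_word u using Submodule.span_induction with
  | mem _ h' => obtain ⟨L, rfl⟩ := h'; exact h L
  | zero => rw [map_zero, map_zero]
  | add a b _ _ ha hb => rw [map_add, map_add, ha, hb]
  | smul c a _ ha => rw [map_smul, map_smul, ha]

@[simp] theorem Coeff.sub_apply (F G : Coeff V) (u : U K 𝔤) : (F - G) u = F u - G u := rfl

theorem Coeff.sum_apply {ι : Type*} (s : Finset ι) (F : ι → Coeff V) (u : U K 𝔤) :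
    (∑ i ∈ s, F i) u = ∑ i ∈ s, F i u :=
  map_sum (⟨⟨fun F => F u, fun _ _ => rfl⟩, fun _ _ => rfl⟩ : Coeff V →ₗ[K] V) F s

@[simp] theorem Coeff.zsmul_apply (k : ℤ) (F : Coeff V) (u : U K 𝔤) : (k • F) u = k • F u :=
  map_zsmul (⟨⟨fun F => F u, fun _ _ => rfl⟩, fun _ _ => rfl⟩ : Coeff V →ₗ[K] V) k F

variable (V) in
/-- The functions on `U(𝔤)` that vanish on words of length less than `i`. -/
def vanishBelow (i : ℕ) : Submodule K (Coeff V) where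
  carrier := {F | ∀ L : List 𝔤, L.length < i → F (word K L) = 0}
  zero_mem' _ _ := rfl
  add_mem' hF hG L hL := by rw [Coeff.add_apply, hF L hL, hG L hL, add_zero]
  smul_mem' c F hF L hL := by rw [Coeff.smul_apply, hF L hL, smul_zero]

theorem vanishBelow_anti {i j : ℕ} (h : i ≤ j) : vanishBelow V j ≤ vanishBelow V i :=
  fun _ hF L hL => hF L (hL.trans_le h)

/-- Modulo shorter words, the factors of a word may be permuted. -/
theorem apply_word_perm {F : Coeff V} {L L' : List 𝔤} (h : L.Perm L') :
    ∀ L₀ : List 𝔤, F ∈ vanishBelow V (L₀.length + L.length) →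
      F (word K (L₀ ++ L)) = F (word K (L₀ ++ L')) := by
  induction h with
  | nil => intro L₀ _; rfl
  | cons x h ih =>
    intro L₀ hF
    have := ih (L₀ ++ [x]) (by simpa [add_assoc, add_comm, add_left_comm] using hF)
    simpa using this
  | swap x y l =>
    intro L₀ hF
    have h1 : F (word K (L₀ ++ (⁅y, x⁆ :: l))) = 0 := hF _ (by simp)
    rw [word_append, word_cons, ι_lie, sub_mul, mul_sub, map_sub, sub_eq_zero] at h1
    rw [word_append, word_append, word_cons, word_cons, word_cons, word_cons]
    simpa only [mul_assoc] using h1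
  | trans h h' ih ih' =>
    intro L₀ hF
    rw [ih L₀ hF, ih' L₀ (by rwa [← h.length_eq])]

theorem apply_word_getElem_cons {F : Coeff V} {L : List 𝔤} (hF : F ∈ vanishBelow V L.length)
    (l : Fin L.length) : F (word K (L[l] :: L.eraseIdx l)) = F (word K L) := by
  have h := List.getElem_cons_eraseIdx_perm (l := L) l.2
  exact apply_word_perm (F := F) h [] (by rw [h.length_eq]; simpa using hF)

/-- A sequence of functions that vanish on longer and longer words can be summed up. -/
theorem exists_sum (F : ℕ → Coeff V) (hF : ∀ m, F m ∈ vanishBelow V m) :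
    ∃ G : Coeff V, ∀ (N : ℕ) (L : List 𝔤), L.length < N →
      G (word K L) = ∑ m ∈ Finset.range N, F m (word K L) := by
  have hfin : ∀ u : U K 𝔤, (Function.support fun m => F m u).Finite := by
    intro u
    suffices h : ∃ N, ∀ m, N ≤ m → F m u = 0 by
      obtain ⟨N, hN⟩ := h
      refine (Set.finite_lt_nat N).subset fun m hm => ?_
      by_contra h
      exact hm (hN m (not_lt.mp h))
    induction mem_span_word u using Submodule.span_induction with
    | mem _ h =>
      obtain ⟨L, rfl⟩ := h
      exact ⟨L.length + 1, fun m hm => hF m L hm⟩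
    | zero => exact ⟨0, fun m _ => map_zero _⟩
    | add a b _ _ ha hb =>
      obtain ⟨M, hM⟩ := ha
      obtain ⟨N, hN⟩ := hb
      exact ⟨max M N, fun m hm => by
        rw [map_add, hM m (le_of_max_le_left hm), hN m (le_of_max_le_right hm), add_zero]⟩
    | smul c a _ ha =>
      obtain ⟨M, hM⟩ := ha
      exact ⟨M, fun m hm => by rw [map_smul, hM m hm, smul_zero]⟩
  let G : U K 𝔤 →ₗ[K] V :=
    { toFun := fun u => ∑ᶠ m, F m u
      map_add' := fun u v => by
        simp only [map_add]
        exact finsum_add_distrib (hfin u) (hfin v)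
      map_smul' := fun c u => by
        simp only [map_smul]
        exact (smul_finsum c _).symm }
  refine ⟨G, fun N L hL => ?_⟩
  refine finsum_eq_sum_of_support_subset _ fun m hm => ?_
  by_contra h
  exact hm (hF m L (hL.trans_le (not_lt.mp fun h' => h (by simpa using h'))))

end Words

/-! ### Contraction with the radial vector field -/

section Homotopy

open scoped TensorProduct

variable {K 𝔤 : Type u} [Field K] [LieRing 𝔤] [LieAlgebra K 𝔤]

section
attribute [local instance 100] LieRing.ofAssociativeRing

variable (K 𝔤) in
/-- The comultiplication of `U(𝔤)`. -/
noncomputable def comul : U K 𝔤 →ₐ[K] U K 𝔤 ⊗[K] U K 𝔤 :=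
  UniversalEnvelopingAlgebra.lift K
    { toFun := fun x => UniversalEnvelopingAlgebra.ι K x ⊗ₜ 1 + 1 ⊗ₜ UniversalEnvelopingAlgebra.ι K x
      map_add' := fun x y => by
        rw [map_add, TensorProduct.add_tmul, TensorProduct.tmul_add]; abel
      map_smul' := fun c x => by
        rw [map_smul, RingHom.id_apply, TensorProduct.tmul_smul, ← TensorProduct.smul_tmul',
          smul_add]
      map_lie' := fun {x y} => by
        rw [LieRing.of_associative_ring_bracket, ι_lie]
        simp only [mul_add, add_mul, Algebra.TensorProduct.tmul_mul_tmul, one_mul, mul_one,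
          TensorProduct.sub_tmul, TensorProduct.tmul_sub]
        abel }

theorem comul_ι (x : 𝔤) : comul K 𝔤 (UniversalEnvelopingAlgebra.ι K x) =
    UniversalEnvelopingAlgebra.ι K x ⊗ₜ 1 + 1 ⊗ₜ UniversalEnvelopingAlgebra.ι K x := by
  rw [comul, UniversalEnvelopingAlgebra.lift_ι_apply]; rfl

end

/-- The leading terms of the comultiplication of a word. -/
theorem apply_comul_word {W : Type*} [AddCommGroup W] [Module K W] (L : List 𝔤) :
    ∀ Ψ : U K 𝔤 ⊗[K] U K 𝔤 →ₗ[K] W,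
      ((∀ L' : List 𝔤, L'.length < L.length → ∀ u, Ψ (word K L' ⊗ₜ u) = 0) →
        Ψ (comul K 𝔤 (word K L)) = Ψ (word K L ⊗ₜ 1)) ∧
      ((∀ L' : List 𝔤, L'.length + 1 < L.length → ∀ u, Ψ (word K L' ⊗ₜ u) = 0) →
        Ψ (comul K 𝔤 (word K L)) = Ψ (word K L ⊗ₜ 1) +
          ∑ l : Fin L.length, Ψ (word K (L.eraseIdx l) ⊗ₜ UniversalEnvelopingAlgebra.ι K L[l])) := by
  induction L with
  | nil =>
    intro Ψ
    have h : comul K 𝔤 (word K []) = word K [] ⊗ₜ 1 := by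
      rw [word_nil, map_one]; rfl
    refine ⟨fun _ => by rw [h], fun _ => ?_⟩
    rw [h]
    exact (add_zero _).symm
  | cons x L ih =>
    intro Ψ
    let Ψ₁ := Ψ ∘ₗ LinearMap.mulLeft K (UniversalEnvelopingAlgebra.ι K x ⊗ₜ[K] (1 : U K 𝔤))
    let Ψ₂ := Ψ ∘ₗ LinearMap.mulLeft K ((1 : U K 𝔤) ⊗ₜ[K] UniversalEnvelopingAlgebra.ι K x)
    have h₁ : ∀ L' u, Ψ₁ (word K L' ⊗ₜ u) = Ψ (word K (x :: L') ⊗ₜ u) := fun L' u => by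
      rw [word_cons]; simp [Ψ₁]
    have h₂ : ∀ L' u, Ψ₂ (word K L' ⊗ₜ u) =
        Ψ (word K L' ⊗ₜ (UniversalEnvelopingAlgebra.ι K x * u)) := fun L' u => by simp [Ψ₂]
    have hsplit : Ψ (comul K 𝔤 (word K (x :: L))) =
        Ψ₁ (comul K 𝔤 (word K L)) + Ψ₂ (comul K 𝔤 (word K L)) := by
      rw [word_cons, map_mul, comul_ι, add_mul, map_add]; rfl
    refine ⟨fun hΨ => ?_, fun hΨ => ?_⟩
    · rw [hsplit, (ih Ψ₁).1 fun L' hL' u => by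
          rw [h₁]; exact hΨ _ (by simpa using hL') u,
        (ih Ψ₂).1 fun L' hL' u => by
          rw [h₂]; exact hΨ _ (by simp only [List.length_cons]; omega) _,
        h₁, h₂, hΨ L (by simp), add_zero]
    · rw [hsplit, (ih Ψ₁).2 fun L' hL' u => by
          rw [h₁]; exact hΨ _ (by simpa using hL') u,
        (ih Ψ₂).1 fun L' hL' u => by
          rw [h₂]; exact hΨ _ (by simpa using hL') _,
        h₁, h₂, mul_one]
      simp only [h₁]
      change _ = _ + ∑ l : Fin (L.length + 1), _
      rw [Fin.sum_univ_succ]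
      simp
      abel

variable {V : ModuleCat.{u} (U K 𝔤)} (e : U K 𝔤 →ₗ[K] 𝔤)

/-- The bilinear map `(a, b) ↦ θ(e(b))(a)`. -/
noncomputable def pairing : (𝔤 →ₗ[K] Coeff V) →ₗ[K] (U K 𝔤 ⊗[K] U K 𝔤 →ₗ[K] V) where
  toFun θ := TensorProduct.lift (LinearMap.flip (θ ∘ₗ e : U K 𝔤 →ₗ[K] (U K 𝔤 →ₗ[K] V)))
  map_add' _ _ := TensorProduct.ext' fun _ _ => rfl
  map_smul' _ _ := TensorProduct.ext' fun _ _ => rfl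

theorem pairing_tmul (θ : 𝔤 →ₗ[K] Coeff V) (a b : U K 𝔤) : pairing e θ (a ⊗ₜ b) = θ (e b) a := rfl

/-- The contraction of a one-form on `𝔤` with coefficients in `Hom_K(U(𝔤), V)` with the "radial
vector field": `(∑ θ(e(u₂))(u₁))`, where `Δ(u) = ∑ u₁ ⊗ u₂`. -/
noncomputable def contr : (𝔤 →ₗ[K] Coeff V) →ₗ[K] Coeff V where
  toFun θ := (pairing e θ ∘ₗ (comul K 𝔤).toLinearMap : U K 𝔤 →ₗ[K] V)
  map_add' θ η := by rw [map_add]; rfl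
  map_smul' c θ := by rw [map_smul]; rfl

theorem contr_apply (θ : 𝔤 →ₗ[K] Coeff V) (u : U K 𝔤) :
    contr e θ u = pairing e θ (comul K 𝔤 u) := rfl

theorem contr_word (he : e 1 = 0) {θ : 𝔤 →ₗ[K] Coeff V} {L : List 𝔤}
    (hθ : ∀ x, θ x ∈ vanishBelow V (L.length - 1)) :
    contr e θ (word K L) = ∑ l : Fin L.length,
      θ (e (UniversalEnvelopingAlgebra.ι K L[l])) (word K (L.eraseIdx l)) := by
  rw [contr_apply, (apply_comul_word L _).2 fun L' hL' u => by
    rw [pairing_tmul]; exact hθ _ L' (by omega), pairing_tmul, he, map_zero, Coeff.zero_apply,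
    zero_add]
  rfl

theorem contr_rightTrans {y : 𝔤} (hy : ∀ u, e (u * UniversalEnvelopingAlgebra.ι K y) = 0)
    (θ : 𝔤 →ₗ[K] Coeff V) :
    contr e (rightTrans (UniversalEnvelopingAlgebra.ι K y) ∘ₗ θ) =
      rightTrans (UniversalEnvelopingAlgebra.ι K y) (contr e θ) := by
  ext u
  rw [rightTrans_apply, contr_apply, contr_apply, map_mul, comul_ι]
  generalize comul K 𝔤 u = t
  induction t with
  | zero => simp
  | add s t hs ht => rw [map_add, add_mul, map_add, hs, ht]
  | tmul a b =>
    rw [mul_add, Algebra.TensorProduct.tmul_mul_tmul, Algebra.TensorProduct.tmul_mul_tmul, map_add,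
      pairing_tmul, pairing_tmul, pairing_tmul, hy, mul_one, map_zero]
    simp

theorem lie_contr {y : 𝔤} (hy : ∀ u, e (UniversalEnvelopingAlgebra.ι K y * u) = ⁅y, e u⁆)
    (θ : 𝔤 →ₗ[K] Coeff V) : ⁅y, contr e θ⁆ = contr e ⁅y, θ⁆ := by
  ext u
  rw [Coeff.lie_apply, contr_apply, contr_apply, contr_apply, map_mul, comul_ι]
  generalize comul K 𝔤 u = t
  induction t with
  | zero => simp
  | add s t hs ht => rw [map_add, mul_add, map_add, map_add, lie_add, ← hs, ← ht]; abel
  | tmul a b =>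
    rw [add_mul, Algebra.TensorProduct.tmul_mul_tmul, Algebra.TensorProduct.tmul_mul_tmul, map_add,
      pairing_tmul, pairing_tmul, pairing_tmul, pairing_tmul, hy, one_mul, one_mul,
      LieHom.lie_apply, Coeff.sub_apply, Coeff.lie_apply]
    abel

/-- The one-form obtained from a cochain by fixing all arguments but the first. -/
def firstArg {n : ℕ} (w : Fin n → 𝔤) :
    (𝔤 [⋀^Fin (n + 1)]→ₗ[K] Coeff V) →ₗ[K] (𝔤 →ₗ[K] Coeff V) where
  toFun φ := { toFun := fun x => φ.curryLeft x w
               map_add' := fun x y => by rw [map_add]; rfl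
               map_smul' := fun c x => by rw [map_smul]; rfl }
  map_add' φ ψ := rfl
  map_smul' c φ := rfl

theorem firstArg_apply {n : ℕ} (w : Fin n → 𝔤) (φ : 𝔤 [⋀^Fin (n + 1)]→ₗ[K] Coeff V) (x : 𝔤) :
    firstArg w φ x = φ.curryLeft x w := rfl

/-- The contraction of a cochain with the "radial vector field". -/
noncomputable def homot (n : ℕ) :
    (𝔤 [⋀^Fin (n + 1)]→ₗ[K] Coeff V) →ₗ[K] (𝔤 [⋀^Fin n]→ₗ[K] Coeff V) where
  toFun φ :=
    { toFun := fun w => contr e (firstArg w φ)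
      map_update_add' := fun w i x y => by
        rw [← map_add]
        congr 1
        ext1 z
        exact (φ.curryLeft z).map_update_add w i x y
      map_update_smul' := fun w i c x => by
        rw [← map_smul]
        congr 1
        ext1 z
        exact (φ.curryLeft z).map_update_smul w i c x
      map_eq_zero_of_eq' := fun w i j hij hne => by
        have : firstArg w φ = 0 := by
          ext1 z
          exact (φ.curryLeft z).map_eq_zero_of_eq w hij hne
        rw [this, map_zero] }
  map_add' φ ψ := by
    ext1 w
    exact map_add (contr e) (firstArg w φ) (firstArg w ψ)
  map_smul' c φ := by
    ext1 w
    exact map_smul (contr e) c (firstArg w φ)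

theorem homot_apply {n : ℕ} (φ : 𝔤 [⋀^Fin (n + 1)]→ₗ[K] Coeff V) (w : Fin n → 𝔤) :
    homot e n φ w = contr e (firstArg w φ) := rfl

theorem homot_rightTrans {y : 𝔤} (hy : ∀ u, e (u * UniversalEnvelopingAlgebra.ι K y) = 0) {n : ℕ}
    (φ : 𝔤 [⋀^Fin (n + 1)]→ₗ[K] Coeff V) :
    homot e n ((rightTrans (UniversalEnvelopingAlgebra.ι K y)).compAlternatingMap φ) =
      (rightTrans (UniversalEnvelopingAlgebra.ι K y)).compAlternatingMap (homot e n φ) := by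
  ext1 w
  exact contr_rightTrans e hy (firstArg w φ)

theorem lieDer_homot {y : 𝔤} (hy : ∀ u, e (UniversalEnvelopingAlgebra.ι K y * u) = ⁅y, e u⁆) {n : ℕ}
    (φ : 𝔤 [⋀^Fin (n + 1)]→ₗ[K] Coeff V) : lieDer y (homot e n φ) = homot e n (lieDer y φ) := by
  ext1 w
  rw [lieDer_apply, homot_apply, lie_contr e hy]
  simp only [homot_apply]
  rw [← map_sum, ← map_sub]
  congr 1
  ext1 x
  rw [firstArg_apply, curryLeft_lieDer, AlternatingMap.sub_apply, lieDer_apply, LinearMap.sub_apply,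
    LieHom.lie_apply, LinearMap.sum_apply]
  simp only [firstArg_apply]
  abel

theorem homot_mem (𝔨 : LieSubalgebra K 𝔤)
    (he : ∀ u, ∀ y ∈ 𝔨, e (UniversalEnvelopingAlgebra.ι K y * u) = ⁅y, e u⁆) {n : ℕ}
    {φ : 𝔤 [⋀^Fin (n + 1)]→ₗ[K] Coeff V} (hφ : φ ∈ relCochain 𝔨 (Coeff V) (n + 1)) :
    homot e n φ ∈ relCochain 𝔨 (Coeff V) n := by
  refine ⟨fun w hw => ?_, fun y hy => ?_⟩
  · have : firstArg w φ = 0 := by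
      ext1 z
      obtain ⟨i, hi⟩ := hw
      exact hφ.1 _ ⟨i.succ, hi⟩
    rw [homot_apply, this, map_zero]
  · rw [lieDer_homot e (fun u => he u y hy), hφ.2 y hy, map_zero]

/-- The leading term of the coboundary. -/
theorem ceD_apply_word {n i : ℕ} {φ : 𝔤 [⋀^Fin n]→ₗ[K] Coeff V}
    (hφ : ∀ w, φ w ∈ vanishBelow V i) {L : List 𝔤} (hL : L.length < i) (v : Fin (n + 1) → 𝔤) :
    ceD n φ v (word K L) =
      -∑ j : Fin (n + 1), (-1 : ℤ) ^ (j : ℕ) • φ (j.removeNth v) (word K (v j :: L)) := by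
  rw [ceD_apply, ceFun, Coeff.sum_apply, ← Finset.sum_neg_distrib]
  refine Finset.sum_congr rfl fun j _ => ?_
  rw [Coeff.zsmul_apply, Coeff.sub_apply, Coeff.sum_apply, Coeff.lie_apply, hφ _ L hL,
    Finset.sum_eq_zero fun k _ => hφ _ L hL, lie_zero, zero_sub, sub_zero, smul_neg, word_cons]

theorem ceD_mem_vanishBelow {n i : ℕ} {φ : 𝔤 [⋀^Fin n]→ₗ[K] Coeff V}
    (hφ : ∀ w, φ w ∈ vanishBelow V i) (v : Fin (n + 1) → 𝔤) :
    ceD n φ v ∈ vanishBelow V (i - 1) := by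
  intro L hL
  rw [ceD_apply_word hφ (by omega), Finset.sum_eq_zero, neg_zero]
  intro j _
  rw [hφ _ (v j :: L) (by simp; omega), smul_zero]

variable {e}

theorem homot_apply_word {𝔨 : LieSubalgebra K 𝔤} (he : e 1 = 0)
    (he' : ∀ x, e (UniversalEnvelopingAlgebra.ι K x) - x ∈ 𝔨) {n : ℕ}
    {φ : 𝔤 [⋀^Fin (n + 1)]→ₗ[K] Coeff V} (hφ𝔨 : φ ∈ relCochain 𝔨 (Coeff V) (n + 1)) {L : List 𝔤}
    (hφ : ∀ w, φ w ∈ vanishBelow V (L.length - 1)) (w : Fin n → 𝔤) :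
    homot e n φ w (word K L) = ∑ l : Fin L.length, φ (Fin.cons L[l] w) (word K (L.eraseIdx l)) := by
  rw [homot_apply, contr_word e he fun x => hφ _]
  refine Finset.sum_congr rfl fun l _ => ?_
  have h := curryLeft_eq_zero 𝔨 hφ𝔨 (he' L[l])
  rw [map_sub, sub_eq_zero] at h
  rw [firstArg_apply, h]
  rfl

theorem homot_mem_vanishBelow {𝔨 : LieSubalgebra K 𝔤} (he : e 1 = 0)
    (he' : ∀ x, e (UniversalEnvelopingAlgebra.ι K x) - x ∈ 𝔨) {n i : ℕ}
    {φ : 𝔤 [⋀^Fin (n + 1)]→ₗ[K] Coeff V} (hφ𝔨 : φ ∈ relCochain 𝔨 (Coeff V) (n + 1))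
    (hφ : ∀ w, φ w ∈ vanishBelow V i) (w : Fin n → 𝔤) :
    homot e n φ w ∈ vanishBelow V (i + 1) := by
  intro L hL
  rw [homot_apply_word he he' hφ𝔨 fun w => vanishBelow_anti (by omega) (hφ w)]
  refine Finset.sum_eq_zero fun l _ => hφ _ _ ?_
  rw [List.length_eraseIdx_of_lt l.2]
  have := l.2
  omega

end Homotopy

/-! ### The equivariant Poincaré lemma -/

section Homotopy

variable {K 𝔤 : Type u} [Field K] [LieRing 𝔤] [LieAlgebra K 𝔤]
variable {V : ModuleCat.{u} (U K 𝔤)} {e : U K 𝔤 →ₗ[K] 𝔤}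

theorem map_cons_removeNth {W : Type*} [AddCommGroup W] [Module K W] {n : ℕ}
    (φ : 𝔤 [⋀^Fin (n + 1)]→ₗ[K] W) (w : Fin (n + 1) → 𝔤) (j : Fin (n + 1)) :
    φ (Fin.cons (w j) (j.removeNth w)) = (-1 : ℤ) ^ (j : ℕ) • φ w := by
  have h : w = Fin.cons (w j) (j.removeNth w) ∘ j.cycleRange := by
    rw [Fin.cons_comp_cycleRange, Fin.insertNth_self_removeNth]
  conv_rhs => rw [h, φ.map_perm, Fin.sign_cycleRange]
  rw [Units.smul_def]
  simp [smul_smul, ← mul_pow]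

theorem succ_removeNth_cons {n : ℕ} (x : 𝔤) (w : Fin (n + 1) → 𝔤) (j : Fin (n + 1)) :
    j.succ.removeNth (Fin.cons x w : Fin (n + 2) → 𝔤) = Fin.cons x (j.removeNth w) := by
  ext k
  refine Fin.cases ?_ (fun k => ?_) k
  · simp [Fin.removeNth]
  · simp [Fin.removeNth]

variable (e) in
/-- The anticommutator of the coboundary and the contraction with the "radial vector field". -/
noncomputable def euler (n : ℕ) :
    (𝔤 [⋀^Fin (n + 1)]→ₗ[K] Coeff V) →ₗ[K] (𝔤 [⋀^Fin (n + 1)]→ₗ[K] Coeff V) :=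
  ceD n ∘ₗ homot e n + homot e (n + 1) ∘ₗ ceD (n + 1)

theorem euler_apply {n : ℕ} (φ : 𝔤 [⋀^Fin (n + 1)]→ₗ[K] Coeff V) :
    euler e n φ = ceD n (homot e n φ) + homot e (n + 1) (ceD (n + 1) φ) := rfl

/-- **Euler's formula**: on the leading terms, the anticommutator is multiplication by the total degree,
with a negative sign. -/
theorem euler_apply_word {𝔨 : LieSubalgebra K 𝔤} (he : e 1 = 0)
    (he' : ∀ x, e (UniversalEnvelopingAlgebra.ι K x) - x ∈ 𝔨) {n : ℕ}
    {φ : 𝔤 [⋀^Fin (n + 1)]→ₗ[K] Coeff V} (hφ𝔨 : φ ∈ relCochain 𝔨 (Coeff V) (n + 1)) {L : List 𝔤}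
    (hφ : ∀ w, φ w ∈ vanishBelow V L.length) (w : Fin (n + 1) → 𝔤) :
    euler e n φ w (word K L) = -((n + 1 + L.length : ℕ) : K) • φ w (word K L) := by
  -- The terms that move a letter of the word into the cochain and an argument into the word; they
  -- cancel in the anticommutator.
  set S : V := ∑ j : Fin (n + 1), ∑ l : Fin L.length, (-1 : ℤ) ^ (j : ℕ) •
    φ (Fin.cons L[l] (j.removeNth w)) (word K (w j :: L.eraseIdx l)) with hS
  have h1 : ceD n (homot e n φ) w (word K L) = -((n + 1) • φ w (word K L) + S) := by
    rw [ceD_apply_word (homot_mem_vanishBelow he he' hφ𝔨 hφ) (Nat.lt_succ_self _)]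
    congr 1
    have h : ∀ j : Fin (n + 1), (-1 : ℤ) ^ (j : ℕ) •
        homot e n φ (j.removeNth w) (word K (w j :: L)) = φ w (word K L) +
        ∑ l : Fin L.length, (-1 : ℤ) ^ (j : ℕ) •
          φ (Fin.cons L[l] (j.removeNth w)) (word K (w j :: L.eraseIdx l)) := by
      intro j
      rw [homot_apply_word he he' hφ𝔨 (by simpa using hφ)]
      change _ • ∑ l : Fin (L.length + 1), _ = _
      rw [Fin.sum_univ_succ, smul_add, Finset.smul_sum]
      congr 1
      change (-1 : ℤ) ^ (j : ℕ) • φ (Fin.cons (w j) (j.removeNth w)) (word K L) = _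
      rw [map_cons_removeNth, Coeff.zsmul_apply, smul_smul, ← mul_pow]
      simp
    rw [Finset.sum_congr rfl fun j _ => h j, Finset.sum_add_distrib]
    simp [hS]
  have h2 : homot e (n + 1) (ceD (n + 1) φ) w (word K L) = -(L.length • φ w (word K L) - S) := by
    rw [homot_apply_word he he' (ceD_mem 𝔨 hφ𝔨) (ceD_mem_vanishBelow hφ)]
    have h : ∀ l : Fin L.length, ceD (n + 1) φ (Fin.cons L[l] w) (word K (L.eraseIdx l)) =
        -(φ w (word K L) - ∑ j : Fin (n + 1), (-1 : ℤ) ^ (j : ℕ) •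
          φ (Fin.cons L[l] (j.removeNth w)) (word K (w j :: L.eraseIdx l))) := by
      intro l
      rw [ceD_apply_word hφ (by
        rw [List.length_eraseIdx_of_lt l.2]
        have := l.2
        omega)]
      congr 1
      rw [Fin.sum_univ_succ, sub_eq_add_neg, ← Finset.sum_neg_distrib]
      congr 1
      · rw [Fin.cons_zero, apply_word_getElem_cons (hφ _) l]
        simp [Fin.removeNth_zero]
      · refine Finset.sum_congr rfl fun j _ => ?_
        rw [succ_removeNth_cons, Fin.cons_succ, Fin.val_succ, pow_succ, mul_neg, mul_one, neg_smul]
    rw [Finset.sum_congr rfl fun l _ => h l, Finset.sum_neg_distrib, Finset.sum_sub_distrib, hS,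
      Finset.sum_comm]
    simp
  rw [euler_apply, AlternatingMap.add_apply, Coeff.add_apply, h1, h2, neg_smul, Nat.cast_smul_eq_nsmul,
    add_smul, add_smul, add_smul]
  abel

theorem euler_mem {𝔨 : LieSubalgebra K 𝔤}
    (he : ∀ u, ∀ y ∈ 𝔨, e (UniversalEnvelopingAlgebra.ι K y * u) = ⁅y, e u⁆) {n : ℕ}
    {φ : 𝔤 [⋀^Fin (n + 1)]→ₗ[K] Coeff V} (hφ : φ ∈ relCochain 𝔨 (Coeff V) (n + 1)) :
    euler e n φ ∈ relCochain 𝔨 (Coeff V) (n + 1) :=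
  Submodule.add_mem _ (ceD_mem 𝔨 (homot_mem e 𝔨 he hφ)) (homot_mem e 𝔨 he (ceD_mem 𝔨 hφ))

theorem euler_rightTrans {y : 𝔤} (hy : ∀ u, e (u * UniversalEnvelopingAlgebra.ι K y) = 0) {n : ℕ}
    (φ : 𝔤 [⋀^Fin (n + 1)]→ₗ[K] Coeff V) :
    euler e n ((rightTrans (UniversalEnvelopingAlgebra.ι K y)).compAlternatingMap φ) =
      (rightTrans (UniversalEnvelopingAlgebra.ι K y)).compAlternatingMap (euler e n φ) := by
  rw [euler_apply, euler_apply, homot_rightTrans e hy, ceD_comp _ (rightTrans_lie _),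
    ceD_comp _ (rightTrans_lie _), homot_rightTrans e hy]
  rfl

variable (e) in
/-- The successive approximations `∏ (1 + T / (n + i + 1))`, `i < m`, of zero, where `T` is the
anticommutator `euler`. The `m`-th one maps relative cochains to cochains that vanish on words of
length less than `m`. -/
noncomputable def approx (n : ℕ) :
    ℕ → ((𝔤 [⋀^Fin (n + 1)]→ₗ[K] Coeff V) →ₗ[K] (𝔤 [⋀^Fin (n + 1)]→ₗ[K] Coeff V))
  | 0 => LinearMap.id
  | m + 1 => approx n m + ((n + 1 + m : ℕ) : K)⁻¹ • (euler e n ∘ₗ approx n m)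

theorem approx_succ_apply (n m : ℕ) (φ : 𝔤 [⋀^Fin (n + 1)]→ₗ[K] Coeff V) :
    approx e n (m + 1) φ =
      approx e n m φ + ((n + 1 + m : ℕ) : K)⁻¹ • euler e n (approx e n m φ) := rfl

theorem approx_mem {𝔨 : LieSubalgebra K 𝔤}
    (he : ∀ u, ∀ y ∈ 𝔨, e (UniversalEnvelopingAlgebra.ι K y * u) = ⁅y, e u⁆) {n : ℕ}
    {φ : 𝔤 [⋀^Fin (n + 1)]→ₗ[K] Coeff V} (hφ : φ ∈ relCochain 𝔨 (Coeff V) (n + 1)) (m : ℕ) :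
    approx e n m φ ∈ relCochain 𝔨 (Coeff V) (n + 1) := by
  induction m with
  | zero => exact hφ
  | succ m ih => exact Submodule.add_mem _ ih (Submodule.smul_mem _ _ (euler_mem he ih))

theorem approx_rightTrans {y : 𝔤} (hy : ∀ u, e (u * UniversalEnvelopingAlgebra.ι K y) = 0) {n : ℕ}
    (φ : 𝔤 [⋀^Fin (n + 1)]→ₗ[K] Coeff V) (m : ℕ) :
    approx e n m ((rightTrans (UniversalEnvelopingAlgebra.ι K y)).compAlternatingMap φ) =
      (rightTrans (UniversalEnvelopingAlgebra.ι K y)).compAlternatingMap (approx e n m φ) := by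
  induction m with
  | zero => rfl
  | succ m ih =>
    rw [approx_succ_apply, approx_succ_apply, ih, euler_rightTrans hy]
    rfl

theorem ceD_approx {n : ℕ} {φ : 𝔤 [⋀^Fin (n + 1)]→ₗ[K] Coeff V} (hφ : ceD (n + 1) φ = 0) (m : ℕ) :
    ceD (n + 1) (approx e n m φ) = 0 := by
  induction m with
  | zero => exact hφ
  | succ m ih =>
    rw [approx_succ_apply, map_add, map_smul, euler_apply, ih, map_zero, add_zero, ceD_ceD,
      smul_zero, zero_add]

variable [CharZero K]

theorem approx_mem_vanishBelow {𝔨 : LieSubalgebra K 𝔤} (he : e 1 = 0)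
    (he' : ∀ x, e (UniversalEnvelopingAlgebra.ι K x) - x ∈ 𝔨)
    (he'' : ∀ u, ∀ y ∈ 𝔨, e (UniversalEnvelopingAlgebra.ι K y * u) = ⁅y, e u⁆) {n : ℕ}
    {φ : 𝔤 [⋀^Fin (n + 1)]→ₗ[K] Coeff V} (hφ : φ ∈ relCochain 𝔨 (Coeff V) (n + 1)) (m : ℕ) :
    ∀ w, approx e n m φ w ∈ vanishBelow V m := by
  induction m with
  | zero => exact fun w L hL => absurd hL (Nat.not_lt_zero _)
  | succ m ih =>
    intro w L hL
    rw [approx_succ_apply, AlternatingMap.add_apply, AlternatingMap.smul_apply, Coeff.add_apply,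
      Coeff.smul_apply, euler_apply_word he he' (approx_mem he'' hφ m)
        fun w => vanishBelow_anti (by omega) (ih w)]
    rcases Nat.lt_or_ge L.length m with h | h
    · rw [ih w L h, smul_zero, smul_zero, add_zero]
    · obtain rfl : L.length = m := by omega
      rw [neg_smul, smul_neg, smul_smul, inv_mul_cancel₀ (Nat.cast_ne_zero.mpr (by omega)),
        one_smul, add_neg_cancel]

theorem sum_cochain_apply {n : ℕ} {ι : Type*} (s : Finset ι) (χ : ι → 𝔤 [⋀^Fin n]→ₗ[K] Coeff V)
    (w : Fin n → 𝔤) : (∑ m ∈ s, χ m) w = ∑ m ∈ s, χ m w :=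
  map_sum (⟨⟨fun φ => φ w, fun _ _ => rfl⟩, fun _ _ => rfl⟩ :
    (𝔤 [⋀^Fin n]→ₗ[K] Coeff V) →ₗ[K] Coeff V) χ s

theorem exists_sum_cochain {n : ℕ} (χ : ℕ → 𝔤 [⋀^Fin n]→ₗ[K] Coeff V)
    (hχ : ∀ m w, χ m w ∈ vanishBelow V m) :
    ∃ σ : 𝔤 [⋀^Fin n]→ₗ[K] Coeff V, ∀ (N : ℕ) (w : Fin n → 𝔤) (L : List 𝔤), L.length < N →
      σ w (word K L) = (∑ m ∈ Finset.range N, χ m) w (word K L) := by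
  choose G hG using fun w => exists_sum (fun m => χ m w) fun m => hχ m w
  have hG' : ∀ w L, G w (word K L) =
      (∑ m ∈ Finset.range (L.length + 1), χ m) w (word K L) := fun w L => by
    rw [hG w _ L (Nat.lt_succ_self _), sum_cochain_apply, Coeff.sum_apply]
  refine ⟨{ toFun := G
            map_update_add' := fun w i x y => Coeff.ext_word fun L => ?_
            map_update_smul' := fun w i c x => Coeff.ext_word fun L => ?_
            map_eq_zero_of_eq' := fun w i j hij hne => Coeff.ext_word fun L => ?_ },
    fun N w L hL => ?_⟩
  · simp only [Coeff.add_apply, hG', AlternatingMap.map_update_add]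
  · simp only [Coeff.smul_apply, hG', AlternatingMap.map_update_smul]
  · rw [hG', AlternatingMap.map_eq_zero_of_eq _ w hij hne]
  · change G w (word K L) = _
    rw [hG w N L hL, sum_cochain_apply, Coeff.sum_apply]

theorem sum_mem_relCochain {𝔨 : LieSubalgebra K 𝔤} {n : ℕ} {χ : ℕ → 𝔤 [⋀^Fin n]→ₗ[K] Coeff V}
    {σ : 𝔤 [⋀^Fin n]→ₗ[K] Coeff V}
    (hσ : ∀ (N : ℕ) (w : Fin n → 𝔤) (L : List 𝔤), L.length < N →
      σ w (word K L) = (∑ m ∈ Finset.range N, χ m) w (word K L))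
    (hχ : ∀ m, χ m ∈ relCochain 𝔨 (Coeff V) n) : σ ∈ relCochain 𝔨 (Coeff V) n := by
  have hsum : ∀ N, ∑ m ∈ Finset.range N, χ m ∈ relCochain 𝔨 (Coeff V) n :=
    fun N => Submodule.sum_mem _ fun m _ => hχ m
  refine ⟨fun w hw => Coeff.ext_word fun L => ?_, fun y hy => ?_⟩
  · rw [hσ (L.length + 1) w L (Nat.lt_succ_self _), (hsum _).1 w hw]
  · ext1 w
    refine Coeff.ext_word fun L => ?_
    have h := congrArg (fun α : 𝔤 [⋀^Fin n]→ₗ[K] Coeff V => α w (word K L))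
      ((hsum (L.length + 2)).2 y hy)
    refine Eq.trans ?_ h
    simp only [lieDer_apply, Coeff.sub_apply, Coeff.lie_apply, Coeff.sum_apply]
    rw [hσ (L.length + 2) w L (by omega), ← word_cons, hσ (L.length + 2) w _ (by simp)]
    simp only [hσ (L.length + 2) _ L (by omega)]

variable {𝔨 : LieSubalgebra K 𝔤}

/-- The homotopy: it is minus the sum of the contractions of the successive approximations, with
coefficients. It is a primitive of each cocycle because the sum telescopes. -/
theorem exists_primitive (he : e 1 = 0)
    (he' : ∀ x, e (UniversalEnvelopingAlgebra.ι K x) - x ∈ 𝔨)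
    (he'' : ∀ u, ∀ y ∈ 𝔨, e (UniversalEnvelopingAlgebra.ι K y * u) = ⁅y, e u⁆)
    (hr : ∀ u, ∀ y ∈ 𝔨, e (u * UniversalEnvelopingAlgebra.ι K y) = 0) (n : ℕ) :
    ∃ S : relCochain 𝔨 (Coeff V) (n + 1) →ₗ[K] relCochain 𝔨 (Coeff V) n,
      (∀ φ, ceD (n + 1) φ.1 = 0 → ceD n (S φ).1 = φ.1) ∧
      ∀ y ∈ 𝔨, ∀ φ ψ : relCochain 𝔨 (Coeff V) (n + 1),
        ψ.1 = (rightTrans (UniversalEnvelopingAlgebra.ι K y)).compAlternatingMap φ.1 →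
        (S ψ).1 = (rightTrans (UniversalEnvelopingAlgebra.ι K y)).compAlternatingMap (S φ).1 := by
  let χ : ℕ → (𝔤 [⋀^Fin (n + 1)]→ₗ[K] Coeff V) →ₗ[K] (𝔤 [⋀^Fin n]→ₗ[K] Coeff V) :=
    fun m => -(((n + 1 + m : ℕ) : K)⁻¹ • (homot e n ∘ₗ approx e n m))
  have hχ : ∀ m φ, χ m φ = -(((n + 1 + m : ℕ) : K)⁻¹ • homot e n (approx e n m φ)) :=
    fun m φ => rfl
  have hχv : ∀ (φ : relCochain 𝔨 (Coeff V) (n + 1)) m w, χ m φ.1 w ∈ vanishBelow V m := by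
    intro φ m w
    rw [hχ, AlternatingMap.neg_apply, AlternatingMap.smul_apply]
    refine Submodule.neg_mem _ (Submodule.smul_mem _ _ ?_)
    exact vanishBelow_anti (Nat.le_succ m) (homot_mem_vanishBelow he he' (approx_mem he'' φ.2 m)
      (approx_mem_vanishBelow he he' he'' φ.2 m) w)
  choose σ hσ using fun φ : relCochain 𝔨 (Coeff V) (n + 1) =>
    exists_sum_cochain (fun m => χ m φ.1) (hχv φ)
  have hmem : ∀ φ, σ φ ∈ relCochain 𝔨 (Coeff V) n := fun φ =>
    sum_mem_relCochain (hσ φ) fun m => Submodule.neg_mem _ (Submodule.smul_mem _ _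
      (homot_mem e 𝔨 he'' (approx_mem he'' φ.2 m)))
  refine ⟨{ toFun := fun φ => ⟨σ φ, hmem φ⟩
            map_add' := fun φ ψ => Subtype.ext ?_
            map_smul' := fun c φ => Subtype.ext ?_ }, fun φ hφ => ?_, fun y hy φ ψ hψ => ?_⟩
  · ext1 w
    refine Coeff.ext_word fun L => ?_
    change σ (φ + ψ) w (word K L) = σ φ w (word K L) + σ ψ w (word K L)
    simp only [hσ _ _ w L (Nat.lt_succ_self _), Submodule.coe_add, map_add, Finset.sum_add_distrib]
    rfl
  · ext1 w
    refine Coeff.ext_word fun L => ?_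
    change σ (c • φ) w (word K L) = c • σ φ w (word K L)
    simp only [hσ _ _ w L (Nat.lt_succ_self _), Submodule.coe_smul, map_smul, ← Finset.smul_sum]
    rfl
  · ext1 w
    refine Coeff.ext_word fun L => ?_
    change ceD n (σ φ) w (word K L) = φ.1 w (word K L)
    set N := L.length + 2
    have h1 : ∀ w, (σ φ - ∑ m ∈ Finset.range N, χ m φ.1) w ∈ vanishBelow V N := by
      intro w L' hL'
      rw [AlternatingMap.sub_apply, Coeff.sub_apply, hσ φ N w L' hL', sub_self]
    have h2 := ceD_mem_vanishBelow h1 w L (by omega)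
    have h3 : ceD n (∑ m ∈ Finset.range N, χ m φ.1) = φ.1 - approx e n N φ.1 := by
      have h4 : ∀ m, ceD n (χ m φ.1) = approx e n m φ.1 - approx e n (m + 1) φ.1 := by
        intro m
        rw [hχ, map_neg, map_smul, approx_succ_apply, euler_apply, ceD_approx hφ, map_zero,
          add_zero, sub_add_cancel_left]
      rw [map_sum, Finset.sum_congr rfl fun m _ => h4 m, Finset.sum_range_sub']
      rfl
    rw [map_sub, h3, AlternatingMap.sub_apply, AlternatingMap.sub_apply, Coeff.sub_apply,
      Coeff.sub_apply, approx_mem_vanishBelow he he' he'' φ.2 N w L (by omega), sub_zero] at h2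
    exact sub_eq_zero.mp h2
  · ext1 w
    refine Coeff.ext_word fun L => ?_
    change σ ψ w (word K L) = σ φ w (word K L * UniversalEnvelopingAlgebra.ι K y)
    rw [← word_concat, hσ φ (L.length + 2) w (L ++ [y]) (by simp), hσ ψ (L.length + 2) w L (by omega)]
    simp only [sum_cochain_apply, Coeff.sum_apply, hχ, hψ,
      approx_rightTrans (fun u => hr u y hy), homot_rightTrans e (fun u => hr u y hy), word_concat]
    rfl

end Homotopy

/-! ### The injective resolution -/

section Injective

variable {K 𝔤 : Type u} [Field K] [LieRing 𝔤] [LieAlgebra K 𝔤] (𝔨 : LieSubalgebra K 𝔤)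
variable {V : ModuleCat.{u} (U K 𝔤)}

/-- The value of an element of the coinduced module at `1 ∈ U(𝔤)`. -/
def evalOne {n : ℕ} (c : Coind 𝔨 V n) : 𝔤 [⋀^Fin n]→ₗ[K] V :=
  (⟨⟨fun F => F 1, fun _ _ => rfl⟩, fun _ _ => rfl⟩ : Coeff V →ₗ[K] V).compAlternatingMap c.1

theorem evalOne_apply {n : ℕ} (c : Coind 𝔨 V n) (v : Fin n → 𝔤) : evalOne 𝔨 c v = (c.1 v : Coeff V) 1 :=
  rfl

theorem evalOne_smul {n : ℕ} (u : U K 𝔤) (c : Coind 𝔨 V n) (v : Fin n → 𝔤) :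
    evalOne 𝔨 (u • c) v = (c.1 v : Coeff V) u := by
  change (c.1 v : Coeff V) (1 * u) = _
  rw [one_mul]

theorem lieDer_evalOne {n : ℕ} (c : Coind 𝔨 V n) {z : 𝔤} (hz : z ∈ 𝔨) :
    lieDer z (evalOne 𝔨 c) = evalOne 𝔨 (UniversalEnvelopingAlgebra.ι K z • c) := by
  ext v
  have h := congrArg (fun α : 𝔤 [⋀^Fin n]→ₗ[K] Coeff V => (α v : Coeff V) 1) (c.2.2 z hz)
  simp only [lieDer_apply, Coeff.sub_apply, Coeff.lie_apply, Coeff.sum_apply, mul_one] at h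
  rw [evalOne_smul, lieDer_apply]
  simp only [evalOne_apply]
  have h' : ⁅z, (c.1 v : Coeff V) 1⁆ - (c.1 v : Coeff V) (UniversalEnvelopingAlgebra.ι K z) -
    ∑ j, (c.1 (Function.update v j ⁅z, v j⁆) : Coeff V) 1 = 0 := h
  rw [sub_right_comm, sub_eq_zero] at h'
  exact h'

/-- **Frobenius reciprocity** for the coinduced module: a `𝔨`-equivariant map from a `𝔤`-module to
the alternating maps that vanish on `𝔨` gives a `𝔤`-equivariant map to the coinduced module. -/
def coindLift {Y : ModuleCat.{u} (U K 𝔤)} {n : ℕ} (θ : Y →ₗ[K] (𝔤 [⋀^Fin n]→ₗ[K] V))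
    (hθ : ∀ y (v : Fin n → 𝔤), (∃ i, v i ∈ 𝔨) → θ y v = 0)
    (hθ' : ∀ z ∈ 𝔨, ∀ y, lieDer z (θ y) = θ ⁅z, y⁆) : Y ⟶ coind 𝔨 V n :=
  ModuleCat.ofHom
    { toFun := fun y =>
        ⟨{ toFun := fun v => (⟨⟨fun u => θ (u • y) v, fun u w => by
              rw [add_smul, map_add]; rfl⟩, fun c u => by
              change θ ((c • u) • y) v = c • θ (u • y) v
              rw [smul_assoc, map_smul]; rfl⟩ : U K 𝔤 →ₗ[K] V)
           map_update_add' := fun v i a b => Coeff.ext fun u => (θ (u • y)).map_update_add v i a b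
           map_update_smul' := fun v i c a => Coeff.ext fun u => (θ (u • y)).map_update_smul v i c a
           map_eq_zero_of_eq' := fun v i j hij hne => Coeff.ext fun u =>
             (θ (u • y)).map_eq_zero_of_eq v hij hne },
          fun v hv => Coeff.ext fun u => hθ (u • y) v hv, fun z hz => by
            ext v u
            rw [lieDer_apply, Coeff.sub_apply, Coeff.lie_apply, Coeff.sum_apply]
            have h : ⁅z, θ (u • y) v⁆ - ∑ j, θ (u • y) (Function.update v j ⁅z, v j⁆) =
                θ ((UniversalEnvelopingAlgebra.ι K z * u) • y) v := by
              rw [mul_smul, ← lie_def, ← hθ' z hz, lieDer_apply]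
            change ⁅z, θ (u • y) v⁆ - θ ((UniversalEnvelopingAlgebra.ι K z * u) • y) v -
              ∑ j, θ (u • y) (Function.update v j ⁅z, v j⁆) = 0
            rw [sub_right_comm, h, sub_self]⟩
      map_add' := fun y y' => Subtype.ext <| by
        ext v u
        change θ (u • (y + y')) v = θ (u • y) v + θ (u • y') v
        rw [smul_add, map_add]; rfl
      map_smul' := fun w y => Subtype.ext <| by
        ext v u
        change θ (u • w • y) v = θ ((u * w) • y) v
        rw [mul_smul] }

theorem injective_of_mono {X Y : GKMod 𝔨} (f : X ⟶ Y) [Mono f] : Function.Injective f.hom := by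
  have := (isGK 𝔨).preservesMonomorphisms_ι_of_isNormalEpiCategory
  exact (ModuleCat.mono_iff_injective _).mp (inferInstanceAs (Mono ((isGK 𝔨).ι.map f)))

/-- The `𝔨`-finite part of a coinduced module is injective: a morphism to it corresponds to a
`𝔨`-equivariant map, which extends because `(𝔤, 𝔨)`-modules are semisimple over `𝔨`. -/
theorem injective_gkObj_coind (n : ℕ) : Injective (gkObj 𝔨 (coind 𝔨 V n)) where
  factors {X Y} g f _ := by
    obtain ⟨r, hr, -⟩ := exists_retraction Y.property.semisimple (resHom 𝔨 f.hom)
      (injective_of_mono 𝔨 f) ⊥ disjoint_bot_right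
    let G : X.obj ⟶ coind 𝔨 V n := g.hom ≫ gkIncl 𝔨 _
    have hG : ∀ (u : U K 𝔤) x, G (u • x) = u • G x := fun u x => map_smul G.hom u x
    let θ : Y.obj →ₗ[K] (𝔤 [⋀^Fin n]→ₗ[K] V) :=
      { toFun := fun y => evalOne 𝔨 (G (r y))
        map_add' := fun y y' => by rw [map_add, map_add]; rfl
        map_smul' := fun c y => by
          ext v
          rw [map_smul, ← algebraMap_smul (U K 𝔤) c (r y), hG, evalOne_smul, RingHom.id_apply,
            Algebra.algebraMap_eq_smul_one, map_smul]
          rfl }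
    have hθ : ∀ y, θ y = evalOne 𝔨 (G (r y)) := fun y => rfl
    refine ⟨gkLift 𝔨 (coindLift 𝔨 θ (fun y v hv => ?_) fun z hz y => ?_), gkHom_ext 𝔨 ?_⟩
    · rw [hθ, evalOne_apply, (G (r y)).2.1 v hv]; rfl
    · rw [hθ, hθ, lieDer_evalOne 𝔨 _ hz, ← hG, ← lie_def]
      exact congrArg (fun x => evalOne 𝔨 (G x)) (r.map_lie ⟨z, hz⟩ y).symm
    · ext x
      refine Subtype.ext ?_
      ext v u
      change evalOne 𝔨 (G (r (u • f.hom x))) v = ((G x).1 v : Coeff V) u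
      rw [← map_smul f.hom.hom, show r (f.hom.hom (u • x)) = u • x from hr (u • x), hG, evalOne_smul]

end Injective

section Exact

variable {K 𝔤 : Type u} [Field K] [LieRing 𝔤] [LieAlgebra K 𝔤] (𝔨 : LieSubalgebra K 𝔤)
variable {V : ModuleCat.{u} (U K 𝔤)}

/-- Exactness of a sequence of `(𝔤, 𝔨)`-modules may be checked on elements, as the inclusion into the
`𝔤`-modules is faithful and exact. -/
theorem exact_of_forall (S : ShortComplex (GKMod 𝔨))
    (h : ∀ x : S.X₂.obj, S.g.hom x = 0 → ∃ y : S.X₁.obj, S.f.hom y = x) : S.Exact := by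
  have : (isGK 𝔨).ι.PreservesHomology :=
    { preservesKernels := fun _ _ f => (isGK 𝔨).preservesKernels_ι f
      preservesCokernels := fun _ _ f => (isGK 𝔨).preservesCokernels_ι f }
  rw [← S.exact_map_iff_of_faithful (isGK 𝔨).ι, ShortComplex.moduleCat_exact_iff]
  exact h

/-- The cocycles of degree zero are the `U(𝔤)`-linear maps `U(𝔤) → V`. -/
theorem exact_augm {V : ModuleCat.{u} (U K 𝔤)} (c : coind 𝔨 V 0) (hc : coindD 𝔨 V 0 c = 0) :
    ∃ v : V, augm 𝔨 V v = c := by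
  have h : ∀ x u, ((c.1 ![] : Coeff V)) (UniversalEnvelopingAlgebra.ι K x * u) =
      UniversalEnvelopingAlgebra.ι K x • (c.1 ![] : Coeff V) u := by
    intro x u
    have h1 : ceD 0 c.1 = 0 := congrArg Subtype.val hc
    have h2 := congrArg (fun α : 𝔤 [⋀^Fin 0]→ₗ[K] Coeff V => (α ![] : Coeff V) u)
      (curryLeft_ceD_zero x c.1)
    rw [h1] at h2
    simp only [lieDer_apply, Finset.univ_eq_empty, Finset.sum_empty, sub_zero, Coeff.lie_apply] at h2
    exact (sub_eq_zero.mp h2.symm).symm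
  have h' : ∀ u w, ((c.1 ![] : Coeff V)) (u * w) = u • (c.1 ![] : Coeff V) w := by
    intro u
    induction u using U_induction with
    | scalar a => intro w; rw [algebraMap_smul, ← Algebra.smul_def, map_smul]
    | lie x => exact h x
    | mul a b ha hb => intro w; rw [mul_assoc, ha, hb, mul_smul]
    | add a b ha hb => intro w; rw [add_mul, map_add, ha, hb, add_smul]
  refine ⟨(c.1 ![] : Coeff V) 1, Subtype.ext ?_⟩
  ext w u
  rw [augm_apply, ← h', mul_one, Subsingleton.elim w ![]]

theorem augm_injective : Function.Injective (augm 𝔨 V) := by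
  intro v w h
  have := congrArg (fun c : Coind 𝔨 V 0 => (c.1 ![] : Coeff V) 1) h
  change (1 : U K 𝔤) • v = (1 : U K 𝔤) • w at this
  rwa [one_smul, one_smul] at this

theorem Coind.algebraMap_smul {n : ℕ} (a : K) (c : Coind 𝔨 V n) :
    (algebraMap K (U K 𝔤) a • c).1 = a • c.1 := by
  ext v u
  change (c.1 v : Coeff V) (u * algebraMap K (U K 𝔤) a) = a • (c.1 v : Coeff V) u
  rw [← Algebra.commutes, ← Algebra.smul_def, map_smul]

theorem resAugm_f_zero (V : GKMod 𝔨) :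
    (resAugm 𝔨 V).f 0 = (gkLift 𝔨 (augm 𝔨 V.obj) : V ⟶ gkObj 𝔨 (coind 𝔨 V.obj 0)) :=
  CochainComplex.fromSingle₀Equiv_symm_apply_f_zero _ (by
    rw [resComplex_d]
    exact gkHom_ext 𝔨 (augm_coindD 𝔨 V.obj))

variable [CharZero K] [FiniteDimensional K 𝔤]

theorem mem_gkPart_of_equivariant (h𝔤 : ComplementedLattice (LieSubmodule K 𝔨 𝔤))
    {X M : ModuleCat.{u} (U K 𝔤)} (hX : isGK 𝔨 X) (F : X →+ M)
    (hF : ∀ (c : K) x, F (algebraMap K (U K 𝔤) c • x) = algebraMap K (U K 𝔤) c • F x)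
    (hF' : ∀ y ∈ 𝔨, ∀ x, F (UniversalEnvelopingAlgebra.ι K y • x) =
      UniversalEnvelopingAlgebra.ι K y • F x) (x : X) : F x ∈ gkPart 𝔨 M :=
  mem_gkPart_of_lieHom 𝔨 h𝔤 hX
    ({ F with
        map_smul' := fun c x => by
          have := hF c x
          rwa [algebraMap_smul, algebraMap_smul] at this
        map_lie' := fun {y x} => hF' y y.2 x } : X →ₗ⁅K,𝔨⁆ M) x

/-- Cocycles in the `𝔨`-finite part of the coinduced modules are coboundaries: the homotopy commutes
with the action of `𝔨`, so it preserves the `𝔨`-finite parts. -/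
theorem exact_coindD (h𝔤 : ComplementedLattice (LieSubmodule K 𝔨 𝔤)) {n : ℕ}
    (c : Coind 𝔨 V (n + 1)) (hc : c ∈ gkPart 𝔨 (coind 𝔨 V (n + 1)))
    (hc' : ceD (n + 1) c.1 = 0) :
    ∃ b : Coind 𝔨 V n, b ∈ gkPart 𝔨 (coind 𝔨 V n) ∧ ceD n b.1 = c.1 := by
  obtain ⟨e, he, he', hr, he''⟩ := exists_coordinate 𝔨 h𝔤
  obtain ⟨S, hS, hS'⟩ := exists_primitive (V := V) he he' he'' hr n
  let F : (gkObj 𝔨 (coind 𝔨 V (n + 1))).obj →+ coind 𝔨 V n :=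
    { toFun := fun x => S x.1
      map_add' := fun x y => map_add S x.1 y.1
      map_zero' := map_zero S }
  refine ⟨S c, mem_gkPart_of_equivariant 𝔨 h𝔤 (gkObj 𝔨 (coind 𝔨 V (n + 1))).property F
    (fun a x => Subtype.ext ?_) (fun y hy x => Subtype.ext (hS' y hy _ _ rfl)) ⟨c, hc⟩, hS c hc'⟩
  refine Eq.trans ?_ (Coind.algebraMap_smul 𝔨 a (S x.1)).symm
  let z : relCochain 𝔨 (Coeff V) (n + 1) := x.1
  have : (S (a • z)).1 = a • (S z).1 := by rw [map_smul]; rfl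
  refine Eq.trans ?_ this
  exact congrArg (fun z => (S z).1) (Subtype.ext (Coind.algebraMap_smul 𝔨 a x.1))

theorem isHochschildResolution (h𝔤 : ComplementedLattice (LieSubmodule K 𝔨 𝔤)) (V : GKMod 𝔨) :
    IsHochschildResolution 𝔨 V where
  injective n := injective_gkObj_coind 𝔨 n
  quasiIso := ⟨fun n => by
    cases n with
    | zero =>
      rw [CochainComplex.quasiIsoAt₀_iff, ShortComplex.quasiIso_iff_of_zeros]
      · refine (ShortComplex.exact_and_mono_f_iff_of_iso (S₂ := ShortComplex.mk
          (gkLift 𝔨 (augm 𝔨 V.obj) : V ⟶ gkObj 𝔨 (coind 𝔨 V.obj 0)) (gkMap 𝔨 (coindD 𝔨 V.obj 0))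
          (gkHom_ext 𝔨 (augm_coindD 𝔨 V.obj))) ?_).2 ⟨exact_of_forall 𝔨 _ fun x hx => ?_, ?_⟩
        · refine ShortComplex.isoMk (Iso.refl _) (Iso.refl _) (Iso.refl _) ?_ ?_
          · refine (Category.id_comp _).trans (Eq.trans ?_ (Category.comp_id _).symm)
            exact (resAugm_f_zero 𝔨 V).symm
          · refine (Category.id_comp _).trans (Eq.trans ?_ (Category.comp_id _).symm)
            exact (resComplex_d 𝔨 V.obj 0).symm
        · obtain ⟨v, hv⟩ := exact_augm 𝔨 x.1 (congrArg Subtype.val hx)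
          exact ⟨v, Subtype.ext hv⟩
        · refine ConcreteCategory.mono_of_injective _ fun v w h => ?_
          exact augm_injective 𝔨 (congrArg Subtype.val h)
      all_goals rfl
    | succ n =>
      rw [quasiIsoAt_iff_exactAt]
      · rw [HomologicalComplex.exactAt_iff' _ n (n + 1) (n + 2) (by simp) (by simp)]
        refine exact_of_forall 𝔨 _ fun x hx => ?_
        have hx' : (gkMap 𝔨 (coindD 𝔨 V.obj (n + 1))).hom x = 0 := by
          rw [← resComplex_d]; exact hx
        obtain ⟨b, hb, hb'⟩ := exact_coindD 𝔨 h𝔤 x.1 x.2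
          (congrArg (fun z => (Subtype.val z).1) hx')
        refine ⟨⟨b, hb⟩, ?_⟩
        change ((resComplex 𝔨 V.obj).d n (n + 1)).hom _ = _
        rw [resComplex_d]
        exact Subtype.ext (Subtype.ext hb')
      · apply CochainComplex.exactAt_succ_single_obj⟩

end Exact

/-! ### Bijectivity of the comparison map -/

section ExtMk

open CochainComplex HomComplex

/-- In degree zero there are no coboundaries. -/
theorem eq_zero_of_extMk_eq_zero {C : Type*} [Category* C] [Abelian C] [HasExt C] {X Y : C}
    (R : InjectiveResolution Y) (f : X ⟶ R.cocomplex.X 0) (m : ℕ) (hm : 0 + 1 = m)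
    (hf : f ≫ R.cocomplex.d 0 m = 0) (h : R.extMk f m hm hf = 0) : f = 0 := by
  rw [← R.extEquivCohomologyClass.apply_eq_iff_eq, R.extEquivCohomologyClass_extMk,
    R.extEquivCohomologyClass_zero, CohomologyClass.mk_eq_zero_iff,
    Cocycle.fromSingleMk_mem_coboundaries_iff _ _ _ _ _ (-1) (by lia)] at h
  obtain ⟨g, hg⟩ := h
  have hz : Limits.IsZero (R.cochainComplex.X (-1)) :=
    CochainComplex.isZero_of_isStrictlyGE _ 0 _ (by lia)
  rw [hz.eq_of_tgt g 0, Limits.zero_comp] at hg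
  rw [← cancel_mono (R.cochainComplexXIso 0 0 rfl).inv, Limits.zero_comp]
  exact hg.symm

end ExtMk

section Comparison

variable {K 𝔤 : Type u} [Field K] [LieRing 𝔤] [LieAlgebra K 𝔤] (𝔨 : LieSubalgebra K 𝔤)
variable {V : ModuleCat.{u} (U K 𝔤)}

/-- The element `1` of the trivial module. -/
def trivOne (K 𝔤 : Type u) [Field K] [LieRing 𝔤] [LieAlgebra K 𝔤] : triv K 𝔤 := (1 : K)

theorem trivVal_trivOne : trivVal K 𝔤 (trivOne K 𝔤) = 1 := rfl

theorem smul_trivOne (u : U K 𝔤) : u • trivOne K 𝔤 = algebraMap K (U K 𝔤) (counit u) • trivOne K 𝔤 := by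
  have hinj : Function.Injective (trivVal K 𝔤) := fun _ _ h => h
  apply hinj
  rw [trivVal_smul, trivVal_smul, AlgHom.commutes, Algebra.algebraMap_self_apply]

theorem eq_smul_trivOne (t : triv K 𝔤) : t = algebraMap K (U K 𝔤) (trivVal K 𝔤 t) • trivOne K 𝔤 := by
  have hinj : Function.Injective (trivVal K 𝔤) := fun _ _ h => h
  apply hinj
  rw [trivVal_smul, AlgHom.commutes, Algebra.algebraMap_self_apply, trivVal_trivOne, mul_one]

theorem cochainHom_injective (n : ℕ) : Function.Injective (cochainHom 𝔨 V n) := by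
  rw [injective_iff_map_eq_zero]
  intro α h
  refine Subtype.ext ?_
  ext v
  have h1 := congrArg (fun g : trivGK 𝔨 ⟶ gkObj 𝔨 (coind 𝔨 V n) =>
    ((g.hom (trivOne K 𝔤)).1.1 v : Coeff V) 1) h
  change counit (1 : U K 𝔤) • trivVal K 𝔤 (trivOne K 𝔤) • α.1 v = 0 at h1
  rwa [map_one, trivVal_trivOne, one_smul, one_smul] at h1

/-- A morphism from the trivial module picks an invariant element of the coinduced module, and that
element is determined by its value at `1 ∈ U(𝔤)`, a relative cochain. -/
theorem cochainHom_surjective (n : ℕ) : Function.Surjective (cochainHom 𝔨 V n) := by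
  intro g
  let G : triv K 𝔤 ⟶ coind 𝔨 V n := g.hom ≫ gkIncl 𝔨 _
  have hG : ∀ (u : U K 𝔤) x, G (u • x) = u • G x := fun u x => map_smul G.hom u x
  let c : Coind 𝔨 V n := G (trivOne K 𝔤)
  have hc : ∀ u v, (c.1 v : Coeff V) u = counit u • evalOne 𝔨 c v := by
    intro u v
    have h1 : u • c = algebraMap K (U K 𝔤) (counit u) • c := by
      change u • G _ = _ • G _
      rw [← hG, smul_trivOne, hG]
    rw [← evalOne_smul, h1, evalOne_smul]
    change (c.1 v : Coeff V) _ = _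
    rw [Algebra.algebraMap_eq_smul_one, map_smul]
    rfl
  have key : ∀ (t : triv K 𝔤) v u,
      counit u • trivVal K 𝔤 t • evalOne 𝔨 c v = ((G t).1 v : Coeff V) u := by
    intro t v u
    have h1 : G t = algebraMap K (U K 𝔤) (trivVal K 𝔤 t) • c := by
      conv_lhs => rw [eq_smul_trivOne t, hG]
    rw [h1, Coind.algebraMap_smul, smul_comm, ← hc]
    rfl
  refine ⟨⟨evalOne 𝔨 c, fun v hv => ?_, fun z hz => ?_⟩, gkHom_ext 𝔨 ?_⟩
  · rw [evalOne_apply, c.2.1 v hv]; rfl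
  · ext v
    rw [lieDer_evalOne 𝔨 c hz, evalOne_smul, hc, counit_ι, zero_smul]; rfl
  · ext t
    refine Subtype.ext ?_
    ext v u
    exact key t v u

/-- Hochschild's map is bijective because the morphisms from the trivial module to the resolution
are the relative cochains. -/
theorem hochschildMap_bijective {V : GKMod 𝔨} (hV : IsHochschildResolution 𝔨 V) (n : ℕ) :
    Function.Bijective (hochschildMap 𝔨 hV n) := by
  constructor
  · rw [injective_iff_map_eq_zero]
    intro a ha
    obtain ⟨α, rfl⟩ := Submodule.Quotient.mk_surjective _ a
    refine (Submodule.Quotient.mk_eq_zero _).mpr ?_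
    change hochschildZ 𝔨 hV n α = 0 at ha
    change α.1 ∈ relB 𝔨 V.obj n
    cases n with
    | zero =>
      have h0 := eq_zero_of_extMk_eq_zero hV.resolution _ _ rfl (cochainHom_d_eq_zero α) ha
      have h1 : relZIncl 𝔨 V.obj 0 α = 0 := by
        apply cochainHom_injective 𝔨 0
        rw [map_zero]; exact h0
      exact congrArg Subtype.val h1
    | succ n =>
      obtain ⟨g, hg⟩ := (hV.resolution.extMk_eq_zero_iff _ (n + 1 + 1) rfl
        (cochainHom_d_eq_zero α) n rfl).mp ha
      obtain ⟨γ, rfl⟩ := cochainHom_surjective 𝔨 n g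
      refine ⟨γ.1, γ.2, ?_⟩
      exact congrArg Subtype.val
        (cochainHom_injective 𝔨 (n + 1) ((cochainHom_comp_d 𝔨 V.obj γ).symm.trans hg))
  · intro x
    obtain ⟨f, hf, rfl⟩ := hV.resolution.extMk_surjective x (n + 1) rfl
    obtain ⟨α, rfl⟩ := cochainHom_surjective 𝔨 n f
    have h0 : ceD n α.1 = 0 := by
      have h1 : cochainHom 𝔨 V.obj (n + 1) ⟨ceD n α.1, ceD_mem 𝔨 α.2⟩ = 0 :=
        (cochainHom_comp_d 𝔨 V.obj α).symm.trans hf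
      rw [← map_zero (cochainHom 𝔨 V.obj (n + 1))] at h1
      exact congrArg Subtype.val (cochainHom_injective 𝔨 (n + 1) h1)
    exact ⟨Submodule.Quotient.mk ⟨α.1, α.2, h0⟩, rfl⟩

end Comparison

/-! ### The composition product on injective resolutions -/

section Yoneda

open CochainComplex HomComplex Abelian

variable {C : Type*} [Category* C]

theorem iso_cancel {A B D E F G : C} (a : A ⟶ B) (f : B ⟶ D) (e : E ≅ D) (m : D ⟶ F) (i : F ⟶ G) :
    (a ≫ f ≫ e.inv) ≫ e.hom ≫ m ≫ i = a ≫ (f ≫ m) ≫ i := by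
  simp

/-- In a composition of shifted morphisms `a F s i t G c`, a middle part `s i t` of degree zero equal to
the identity cancels. -/
theorem shiftedHom_comp_cancel {M : Type*} [AddMonoid M] [HasShift C M] {A B Z Y Z' T : C}
    {q p n : M} (h : p + q = n) (a : A ⟶ B) (F : ShiftedHom B Z q) (s : Z ⟶ Y) (i : Y ⟶ Y)
    (t : Y ⟶ Z) (G : ShiftedHom Z Z' p) (c : Z' ⟶ T) (hs : s ≫ i ≫ t = 𝟙 Z) :
    ((ShiftedHom.mk₀ (0 : M) rfl a).comp (F.comp (ShiftedHom.mk₀ (0 : M) rfl s) (zero_add q))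
        (add_zero q)).comp
      ((ShiftedHom.mk₀ (0 : M) rfl i).comp
        (((ShiftedHom.mk₀ (0 : M) rfl t).comp G (add_zero p)).comp
          (ShiftedHom.mk₀ (0 : M) rfl c) (zero_add p)) (add_zero p)) h =
    (ShiftedHom.mk₀ (0 : M) rfl a).comp ((F.comp G h).comp (ShiftedHom.mk₀ (0 : M) rfl c)
      (zero_add n)) (add_zero n) := by
  have hs' : s⟦q⟧' ≫ i⟦q⟧' ≫ t⟦q⟧' = 𝟙 (Z⟦q⟧) := by
    rw [← Functor.map_comp, ← Functor.map_comp, hs, CategoryTheory.Functor.map_id]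
  simp only [ShiftedHom.mk₀_comp, ShiftedHom.comp_mk₀]
  simp only [ShiftedHom.comp, Functor.map_comp, Category.assoc]
  rw [reassoc_of% hs']
  have := (shiftFunctorAdd' C p q n h).inv.naturality c
  dsimp at this
  rw [this]

theorem equivHomShift_symm_f [Preadditive C] {K L : CochainComplex C ℤ} {n : ℤ} (z : Cocycle K L n)
    (i : ℤ) : (Cocycle.equivHomShift.symm z).f i = z.1.v i (i + n) rfl := by
  simp only [Cocycle.equivHomShift_symm_apply, Cocycle.rightShift_coe, Cochain.rightShift_v _ _ _ _ _ _ _ (i + n) rfl,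
    Cocycle.homOf_f]
  exact Category.comp_id _

/-- The composition of cocycles is the composition of the corresponding shifted morphisms. -/
theorem equivHomShift_symm_comp [Preadditive C] {K L N : CochainComplex C ℤ} {a b c : ℤ}
    (z₁ : Cocycle K L a) (z₂ : Cocycle L N b) (z : Cocycle K N c) (h : a + b = c)
    (hz : z.1 = z₁.1.comp z₂.1 h) :
    ShiftedHom.comp (Cocycle.equivHomShift.symm z₁) (Cocycle.equivHomShift.symm z₂)
      (by rw [add_comm, h]) = Cocycle.equivHomShift.symm z := by
  ext i
  have key : ∀ (j : ℤ) (hj : i + a + b = j) (e : N.X (i + a + b) ≅ N.X j)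
      (_ : e.hom = (N.XIsoOfEq hj).hom),
      z₂.1.v (i + a) (i + a + b) rfl ≫ e.hom = z₂.1.v (i + a) j hj := by
    rintro j rfl e he
    rw [he]
    exact Category.comp_id _
  rw [ShiftedHom.comp, HomologicalComplex.comp_f, HomologicalComplex.comp_f,
    CochainComplex.shiftFunctorAdd'_inv_app_f', equivHomShift_symm_f, equivHomShift_symm_f, hz,
    CochainComplex.shiftFunctor_map_f', equivHomShift_symm_f,
    Cochain.comp_v _ _ h i (i + a) (i + c) rfl (by lia)]
  congr 1
  exact key (i + c) (by lia) _ rfl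

section

variable [Abelian C]  {Y Y' : C} (R : InjectiveResolution Y)
  (R' : InjectiveResolution Y') {p : ℕ} (m : ∀ k, R.cocomplex.X k ⟶ R'.cocomplex.X (p + k))

/-- A family of morphisms `R^k → R'^{p + k}` as a cochain of degree `p`. -/
noncomputable def familyCochain : Cochain R.cochainComplex R'.cochainComplex p :=
  Cochain.mk fun i j hij =>
    if h : 0 ≤ i then
      (R.cochainComplexXIso i i.toNat (Int.toNat_of_nonneg h)).hom ≫ m i.toNat ≫
        (R'.cochainComplexXIso j (p + i.toNat) (by lia)).inv
    else 0

theorem familyCochain_v (k : ℕ) (i j : ℤ) (hij : i + p = j) (hi : k = i) :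
    (familyCochain R R' m).v i j hij = (R.cochainComplexXIso i k hi).hom ≫ m k ≫
      (R'.cochainComplexXIso j (p + k) (by lia)).inv := by
  subst hi
  rw [familyCochain, Cochain.mk_v]
  exact dif_pos (Int.natCast_nonneg k)

/-- A family of morphisms `R^k → R'^{p + k}` that commutes with the differentials up to the sign
`(-1)^p` is a cocycle, i.e. a morphism to the shifted resolution. -/
noncomputable def familyCocycle
    (hm : ∀ k, m k ≫ R'.cocomplex.d (p + k) (p + k + 1) =
      (-1 : ℤ) ^ p • R.cocomplex.d k (k + 1) ≫ m (k + 1)) :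
    Cocycle R.cochainComplex R'.cochainComplex p :=
  Cocycle.mk (familyCochain R R' m) (p + 1) rfl (by
    ext i j hij
    by_cases hi : 0 ≤ i
    · obtain ⟨k, rfl⟩ := Int.eq_ofNat_of_zero_le hi
      rw [δ_v p (p + 1) rfl _ (k : ℤ) j hij ((p + k : ℕ) : ℤ) ((k + 1 : ℕ) : ℤ) (by push_cast; lia)
          (by push_cast; lia), familyCochain_v R R' m k _ _ _ rfl,
        familyCochain_v R R' m (k + 1) _ _ _ rfl,
        R'.cochainComplex_d _ j (p + k) (p + k + 1) rfl (by push_cast; lia),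
        R.cochainComplex_d _ _ k (k + 1) rfl rfl]
      simp only [Category.assoc, Iso.inv_hom_id_assoc, Cochain.zero_v]
      rw [reassoc_of% (hm k)]
      rw [Int.negOnePow_succ, Units.neg_smul, Units.smul_def, Int.coe_negOnePow_natCast]
      simp only [Linear.smul_comp, Linear.comp_smul, Category.assoc]
      exact add_neg_cancel _
    · exact (CochainComplex.isZero_of_isStrictlyGE R.cochainComplex 0 i (by lia)).eq_of_src _ _)

end

variable [Abelian C] {X Y Y' : C} {R : InjectiveResolution Y} {R' : InjectiveResolution Y'}

/-- The cocycle of degree `n` from `X` to an injective resolution given by a morphism `X → Rⁿ`. -/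
noncomputable def singleCocycle {n : ℕ} (f : X ⟶ R.cocomplex.X n)
    (hf : f ≫ R.cocomplex.d n (n + 1) = 0) :
    Cocycle ((singleFunctor C 0).obj X) R.cochainComplex n :=
  Cocycle.fromSingleMk (f ≫ (R.cochainComplexXIso n n rfl).inv) (zero_add _) ((n + 1 : ℕ) : ℤ)
    (by lia) (by
      rw [R.cochainComplex_d _ _ n (n + 1) rfl rfl, Category.assoc, Iso.inv_hom_id_assoc,
        reassoc_of% hf, Limits.zero_comp])

theorem singleCocycle_v {n : ℕ} (f : X ⟶ R.cocomplex.X n)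
    (hf : f ≫ R.cocomplex.d n (n + 1) = 0) (h : (0 : ℤ) + n = n) :
    (singleCocycle f hf).1.v 0 n h = (HomologicalComplex.singleObjXSelf (.up ℤ) 0 X).hom ≫
      f ≫ (R.cochainComplexXIso n n rfl).inv :=
  Cochain.fromSingleMk_v _ _

/-- A cochain on a complex concentrated in degree zero is determined by its component there. -/
theorem single_ext {K : CochainComplex C ℤ} {n q : ℤ} {α β : Cochain ((singleFunctor C 0).obj X) K n}
    (h : 0 + n = q) (hv : α.v 0 q h = β.v 0 q h) : α = β :=
  (Cochain.fromSingleEquiv h).injective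
    (congrArg ((HomologicalComplex.singleObjXSelf (.up ℤ) 0 X).inv ≫ ·) hv)

theorem singleCocycle_comp {p q : ℕ} {m : ∀ k, R.cocomplex.X k ⟶ R'.cocomplex.X (p + k)}
    (hm : ∀ k, m k ≫ R'.cocomplex.d (p + k) (p + k + 1) =
      (-1 : ℤ) ^ p • R.cocomplex.d k (k + 1) ≫ m (k + 1))
    (f : X ⟶ R.cocomplex.X q) (hf : f ≫ R.cocomplex.d q (q + 1) = 0)
    (hfm : (f ≫ m q) ≫ R'.cocomplex.d (p + q) (p + q + 1) = 0) :
    (singleCocycle (f ≫ m q) hfm).1 =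
      (singleCocycle f hf).1.comp (familyCocycle R R' m hm).1 (by push_cast; rw [add_comm]) := by
  refine single_ext (zero_add _) ((singleCocycle_v _ _ _).trans ?_)
  refine Eq.trans ?_ (Cochain.comp_v _ _ _ 0 (q : ℤ) _ (by lia) (by lia)).symm
  refine Eq.trans ?_ (congrArg₂ (· ≫ ·) (singleCocycle_v _ _ _)
    (familyCochain_v R R' m q _ _ _ rfl)).symm
  exact (iso_cancel _ f (R.cochainComplexXIso q q rfl) (m q) _).symm

theorem singleCocycle_eq_precomp {p : ℕ} {m : ∀ k, R.cocomplex.X k ⟶ R'.cocomplex.X (p + k)}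
    (hm : ∀ k, m k ≫ R'.cocomplex.d (p + k) (p + k + 1) =
      (-1 : ℤ) ^ p • R.cocomplex.d k (k + 1) ≫ m (k + 1))
    (g : Y ⟶ R'.cocomplex.X p) (hg : g ≫ R'.cocomplex.d p (p + 1) = 0)
    (hgm : R.ι.f 0 ≫ m 0 = g) :
    singleCocycle g hg = (familyCocycle R R' m hm).precomp R.ι' := by
  ext : 1
  refine single_ext (zero_add _) ((singleCocycle_v _ _ _).trans ?_)
  refine Eq.trans ?_ (Cochain.zero_cochain_comp_v _ _ _ _ _).symm
  refine Eq.trans ?_ (congrArg₂ (· ≫ ·) ((Cochain.ofHom_v _ _).trans R.ι'_f_zero)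
    (familyCochain_v R R' m 0 0 p _ rfl)).symm
  subst hgm
  exact (iso_cancel _ (R.ι.f 0) (R.cochainComplexXIso 0 0 rfl) (m 0) _).symm

/-- The composition product of extension classes, computed on injective resolutions: a cocycle that
extends to the resolution `R` of `Y` up to the sign `(-1)^p` acts by composition. -/
theorem extMk_comp_extMk [HasExt C] {p q : ℕ} (m : ∀ k, R.cocomplex.X k ⟶ R'.cocomplex.X (p + k))
    (hm : ∀ k, m k ≫ R'.cocomplex.d (p + k) (p + k + 1) =
      (-1 : ℤ) ^ p • R.cocomplex.d k (k + 1) ≫ m (k + 1))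
    (f : X ⟶ R.cocomplex.X q) (hf : f ≫ R.cocomplex.d q (q + 1) = 0)
    (g : Y ⟶ R'.cocomplex.X p) (hg : g ≫ R'.cocomplex.d p (p + 1) = 0)
    (hgm : R.ι.f 0 ≫ m 0 = g) (hfm : (f ≫ m q) ≫ R'.cocomplex.d (p + q) (p + q + 1) = 0) :
    (R.extMk f (q + 1) rfl hf).comp (R'.extMk g (p + 1) rfl hg) (add_comm q p) =
      R'.extMk (f ≫ m q) (p + q + 1) rfl hfm := by
  have := HasDerivedCategory.standard C
  let M := familyCocycle R R' m hm
  have hF : Cocycle.equivHomShift.symm (singleCocycle (f ≫ m q) hfm) =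
      ShiftedHom.comp (Cocycle.equivHomShift.symm (singleCocycle f hf))
        (Cocycle.equivHomShift.symm M) (by push_cast; rfl) := by
    exact (equivHomShift_symm_comp _ _ _ (by push_cast; rw [add_comm])
      (singleCocycle_comp hm f hf hfm)).symm
  have hG : Cocycle.equivHomShift.symm (singleCocycle g hg) =
      R.ι' ≫ Cocycle.equivHomShift.symm M := by
    rw [← Cocycle.equivHomShift_symm_precomp]
    rw [singleCocycle_eq_precomp hm g hg hgm]
  ext
  rw [Ext.comp_hom, R.extMk_hom, R'.extMk_hom, R'.extMk_hom]
  change _ = ShiftedHom.comp _ (ShiftedHom.comp (ShiftedHom.map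
    (Cocycle.equivHomShift.symm (singleCocycle (f ≫ m q) hfm)) _) _ _) _
  change ShiftedHom.comp (ShiftedHom.comp _ (ShiftedHom.comp (ShiftedHom.map
    (Cocycle.equivHomShift.symm (singleCocycle f hf)) _) _ _) _) (ShiftedHom.comp _ (ShiftedHom.comp (ShiftedHom.map
    (Cocycle.equivHomShift.symm (singleCocycle g hg)) _) _ _) _) _ = _
  rw [hF, hG, ShiftedHom.map_comp, ← ShiftedHom.mk₀_comp 0 rfl R.ι', ShiftedHom.map_comp,
    ShiftedHom.map_mk₀]
  refine shiftedHom_comp_cancel _ _ _ _ _ _ _ _ ?_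
  rw [Category.assoc, IsIso.inv_comp_eq, Category.comp_id]
  exact Iso.inv_hom_id_app_assoc _ _ _

end Yoneda

/-! ### Multiplicativity -/

section WedgeNaturality

variable {K 𝔤 V W W' Z Z' : Type*} [Field K] [LieRing 𝔤] [LieAlgebra K 𝔤]
  [AddCommGroup V] [Module K V] [AddCommGroup W] [Module K W] [AddCommGroup W'] [Module K W']
  [AddCommGroup Z] [Module K Z] [AddCommGroup Z'] [Module K Z']

theorem wedge_zero_left [CharZero K] (B : V →ₗ[K] W →ₗ[K] Z) {p q n : ℕ} (h : p + q = n)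
    (β : 𝔤 [⋀^Fin q]→ₗ[K] W) : wedge B h (0 : 𝔤 [⋀^Fin p]→ₗ[K] V) β = 0 := by
  rw [← wedgeₗ_apply, map_zero, LinearMap.zero_apply]

theorem wedge_comp_right {B : V →ₗ[K] W →ₗ[K] Z} {B' : V →ₗ[K] W' →ₗ[K] Z'} (a : W →ₗ[K] W')
    (c : Z →ₗ[K] Z') (hB : ∀ v w, B' v (a w) = c (B v w)) {p q n : ℕ} (h : p + q = n)
    (α : 𝔤 [⋀^Fin p]→ₗ[K] V) (β : 𝔤 [⋀^Fin q]→ₗ[K] W) :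
    wedge B' h α (a.compAlternatingMap β) = c.compAlternatingMap (wedge B h α β) := by
  ext v
  simp only [wedge, AlternatingMap.smul_apply, MultilinearMap.alternatization_apply,
    LinearMap.compAlternatingMap_apply, map_smul, map_sum, MultilinearMap.domDomCongr_apply,
    tensorMul_apply, hB, Units.smul_def, map_zsmul]

/-- The exterior product with a cochain of degree zero is the pairing with a constant: all `p!`
permutations contribute the same term. -/
theorem wedge_degree_zero_right [CharZero K] (B : V →ₗ[K] W →ₗ[K] Z) {p : ℕ} (h : p + 0 = p)
    (α : 𝔤 [⋀^Fin p]→ₗ[K] V) (β : 𝔤 [⋀^Fin 0]→ₗ[K] W) (v : Fin p → 𝔤) :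
    wedge B h α β v = B (α v) (β ![]) := by
  have key : ∀ σ : Equiv.Perm (Fin p), Equiv.Perm.sign σ •
      (tensorMul B h α β).domDomCongr σ v = B (α v) (β ![]) := by
    intro σ
    rw [MultilinearMap.domDomCongr_apply, tensorMul_apply]
    have h1 : (α fun i => v (σ (Fin.cast h (Fin.castAdd 0 i)))) = Equiv.Perm.sign σ • α v :=
      α.map_perm v σ
    rw [h1, Subsingleton.elim (fun j => v (σ (Fin.cast h (Fin.natAdd p j)))) ![], Units.smul_def,
      Units.smul_def, map_zsmul, LinearMap.smul_apply, smul_smul, ← Units.val_mul,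
      Int.units_mul_self, Units.val_one, one_smul]
  rw [wedge, AlternatingMap.smul_apply, MultilinearMap.alternatization_apply,
    Finset.sum_congr rfl fun σ _ => key σ, Finset.sum_const, Finset.card_univ, Fintype.card_perm,
    Fintype.card_fin, Nat.factorial_zero, mul_one, ← Nat.cast_smul_eq_nsmul K, smul_smul,
    inv_mul_cancel₀ (Nat.cast_ne_zero.mpr p.factorial_ne_zero), one_smul]

end WedgeNaturality

section Multiplicativity

variable {K 𝔤 : Type u} [Field K] [CharZero K] [LieRing 𝔤] [LieAlgebra K 𝔤] (𝔨 : LieSubalgebra K 𝔤)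
variable (V : ModuleCat.{u} (U K 𝔤))

/-- The pairing `V × Hom_K(U(𝔤), K) → Hom_K(U(𝔤), V)`, `(v, f) ↦ (u ↦ f(u) v)`. -/
def coeffPairing : V →ₗ[K] Coeff (triv K 𝔤) →ₗ[K] Coeff V :=
  LinearMap.mk₂ K (fun v f => ((trivVal K 𝔤 ∘ₗ f).smulRight v : U K 𝔤 →ₗ[K] V))
    (fun v v' f => Coeff.ext fun u => smul_add (trivVal K 𝔤 (f u)) v v')
    (fun c v f => Coeff.ext fun u => smul_comm (trivVal K 𝔤 (f u)) c v)
    (fun v f f' => Coeff.ext fun u => by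
      change trivVal K 𝔤 (f u + f' u) • v = trivVal K 𝔤 (f u) • v + trivVal K 𝔤 (f' u) • v
      rw [map_add, add_smul])
    (fun c v f => Coeff.ext fun u => by
      change trivVal K 𝔤 (c • f u) • v = c • trivVal K 𝔤 (f u) • v
      rw [map_smul, smul_assoc])

theorem coeffPairing_apply (v : V) (f : Coeff (triv K 𝔤)) (u : U K 𝔤) :
    coeffPairing V v f u = trivVal K 𝔤 (f u) • v := rfl

theorem coeffPairing_lie (x : 𝔤) (v : V) (f : Coeff (triv K 𝔤)) :
    ⁅x, coeffPairing V v f⁆ = coeffPairing V ⁅x, v⁆ f + coeffPairing V v ⁅x, f⁆ := by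
  ext u
  rw [Coeff.lie_apply, Coeff.add_apply, coeffPairing_apply, coeffPairing_apply, coeffPairing_apply,
    coeffPairing_apply, Coeff.lie_apply, triv_lie, zero_sub, map_neg, neg_smul, lie_smul,
    sub_eq_add_neg]

variable {V}

/-- The exterior product `F ↦ α ∧ F` with a relative cochain, as a morphism between coinduced
modules. -/
noncomputable def wedgeHom {p : ℕ} (α : relCochain 𝔨 V p) (k : ℕ) :
    coind 𝔨 (triv K 𝔤) k ⟶ coind 𝔨 V (p + k) :=
  ModuleCat.ofHom
    { toFun := fun F => ⟨wedge (coeffPairing V) rfl α.1 F.1,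
        wedge_mem 𝔨 _ (coeffPairing_lie V) rfl α.2 F.2⟩
      map_add' := fun _ _ => Subtype.ext (wedge_add_right _ _ _ _ _)
      map_smul' := fun w F => Subtype.ext
        (wedge_comp_right (rightTrans w) (rightTrans w) (fun _ _ => rfl) rfl α.1 F.1) }

theorem wedgeHom_comp_d {p : ℕ} (α : relZ 𝔨 V p) (k : ℕ) :
    gkMap 𝔨 (wedgeHom 𝔨 (relZIncl 𝔨 V p α) k) ≫ (resComplex 𝔨 V).d (p + k) (p + k + 1) =
      (-1 : ℤ) ^ p • (resComplex 𝔨 (triv K 𝔤)).d k (k + 1) ≫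
        gkMap 𝔨 (wedgeHom 𝔨 (relZIncl 𝔨 V p α) (k + 1)) := by
  rw [resComplex_d, resComplex_d]
  refine gkHom_ext 𝔨 ?_
  ext F
  refine Subtype.ext ?_
  have h1 := ceD_wedge (coeffPairing V) (coeffPairing_lie V) rfl (by omega) rfl α.1 F.1.1
  rw [ceD_relZ α, wedge_zero_left, zero_add] at h1
  refine h1.trans ?_
  rcases Nat.even_or_odd p with hp | hp
  · rw [hp.neg_one_pow, hp.neg_one_pow, one_smul, one_smul]
    rfl
  · rw [hp.neg_one_pow, hp.neg_one_pow, neg_smul, one_smul, neg_smul, one_smul]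
    rfl

theorem augm_wedgeHom {p : ℕ} (α : relCochain 𝔨 V p) :
    (gkLift 𝔨 (augm 𝔨 (triv K 𝔤)) : trivGK 𝔨 ⟶ gkObj 𝔨 (coind 𝔨 (triv K 𝔤) 0)) ≫
      gkMap 𝔨 (wedgeHom 𝔨 α 0) = cochainHom 𝔨 V p α := by
  refine gkHom_ext 𝔨 ?_
  ext t
  refine Subtype.ext ?_
  ext v u
  refine (congrArg (fun f : Coeff V => f u)
    (wedge_degree_zero_right (coeffPairing V) rfl α.1 _ v)).trans ?_
  exact mul_smul (counit u) (trivVal K 𝔤 t) (α.1 v)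

theorem cochainHom_wedgeHom {p q : ℕ} (α : relCochain 𝔨 V p) (β : relCochain 𝔨 (triv K 𝔤) q) :
    cochainHom 𝔨 (triv K 𝔤) q β ≫ gkMap 𝔨 (wedgeHom 𝔨 α q) =
      cochainHom 𝔨 V (p + q) ⟨wedge (trivPairing V) rfl α.1 β.1,
        wedge_mem 𝔨 _ (trivPairing_lie V) rfl α.2 β.2⟩ := by
  refine gkHom_ext 𝔨 ?_
  ext t
  refine Subtype.ext ?_
  refine (wedge_comp_right (B := trivPairing V) (constMap (triv K 𝔤)) (constMap V) (fun v s => Coeff.ext fun u => ?_) rfl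
    α.1 (trivVal K 𝔤 t • β.1)).trans ?_
  · change trivVal K 𝔤 (counit u • s) • v = counit u • trivVal K 𝔤 s • v
    rw [map_smul, smul_assoc]
  · exact congrArg _ (wedge_smul_right (trivPairing V) rfl (trivVal K 𝔤 t) α.1 β.1)

/-- Hochschild's map is multiplicative, because the exterior product with a cocycle `α` is a morphism
from the resolution of `K` to the shifted resolution of `V` that lifts the class of `α`. -/
theorem hochschildMap_cupHCE {V : GKMod 𝔨} (hV : IsHochschildResolution 𝔨 V)
    (hK : IsHochschildResolution 𝔨 (trivGK 𝔨)) {p q : ℕ} (a : HCE 𝔨 V.obj p)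
    (b : HCE 𝔨 (triv K 𝔤) q) :
    hochschildMap 𝔨 hV (p + q) (cupHCE 𝔨 (trivPairing V.obj) (trivPairing_lie V.obj) rfl a b) =
      (hochschildMap 𝔨 hK q b).comp (hochschildMap 𝔨 hV p a) (add_comm q p) := by
  obtain ⟨α, rfl⟩ := Submodule.Quotient.mk_surjective _ a
  obtain ⟨β, rfl⟩ := Submodule.Quotient.mk_surjective _ b
  have h := cochainHom_wedgeHom 𝔨 (relZIncl 𝔨 V.obj p α) (relZIncl 𝔨 (triv K 𝔤) q β)
  have hfm : (cochainHom 𝔨 (triv K 𝔤) q (relZIncl 𝔨 (triv K 𝔤) q β) ≫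
      gkMap 𝔨 (wedgeHom 𝔨 (relZIncl 𝔨 V.obj p α) q)) ≫
        (resComplex 𝔨 V.obj).d (p + q) (p + q + 1) = 0 := by
    rw [h]
    exact cochainHom_d_eq_zero (V := V.obj)
      ⟨wedge (trivPairing V.obj) rfl α.1 β.1, wedge_mem_relZ 𝔨 _ (trivPairing_lie V.obj) rfl α.2 β.2⟩
  refine Eq.trans ?_ (extMk_comp_extMk (R := hK.resolution) (R' := hV.resolution)
    (fun k => gkMap 𝔨 (wedgeHom 𝔨 (relZIncl 𝔨 V.obj p α) k)) (wedgeHom_comp_d 𝔨 α)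
    (cochainHom 𝔨 (triv K 𝔤) q (relZIncl 𝔨 (triv K 𝔤) q β)) (cochainHom_d_eq_zero β)
    (cochainHom 𝔨 V.obj p (relZIncl 𝔨 V.obj p α)) (cochainHom_d_eq_zero α) ?_ hfm).symm
  · change hochschildZ 𝔨 hV (p + q) _ = _
    change hV.resolution.extMk _ _ rfl (cochainHom_d_eq_zero (V := V.obj)
      ⟨wedge (trivPairing V.obj) rfl α.1 β.1,
        wedge_mem_relZ 𝔨 _ (trivPairing_lie V.obj) rfl α.2 β.2⟩) = _
    congr 1
    exact h.symm
  · refine Eq.trans ?_ (augm_wedgeHom 𝔨 (relZIncl 𝔨 V.obj p α))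
    exact congrArg (· ≫ gkMap 𝔨 (wedgeHom 𝔨 (relZIncl 𝔨 V.obj p α) 0)) (resAugm_f_zero 𝔨 (trivGK 𝔨))

end Multiplicativity

end RelLie

theorem mainTheorem2 {K 𝔤 : Type u} [Field K] [CharZero K] [LieRing 𝔤] [LieAlgebra K 𝔤]
    [FiniteDimensional K 𝔤] (𝔨 : LieSubalgebra K 𝔤)
    (h𝔤 : ComplementedLattice (LieSubmodule K 𝔨 𝔤)) :
    ∃ hres : ∀ V : GKMod 𝔨, IsHochschildResolution 𝔨 V,
      (∀ (V : GKMod 𝔨) (n : ℕ), Function.Bijective (hochschildMap 𝔨 (hres V) n)) ∧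
      ∀ (V : GKMod 𝔨) (p q : ℕ) (a : HCE 𝔨 V.obj p) (b : HCE 𝔨 (triv K 𝔤) q),
        hochschildMap 𝔨 (hres V) (p + q)
            (cupHCE 𝔨 (trivPairing V.obj) (trivPairing_lie V.obj) rfl a b) =
          (hochschildMap 𝔨 (hres (trivGK 𝔨)) q b).comp (hochschildMap 𝔨 (hres V) p a)
            (add_comm q p) :=
  ⟨isHochschildResolution 𝔨 h𝔤, fun _ n => hochschildMap_bijective 𝔨 _ n,
    fun _ _ _ a b => hochschildMap_cupHCE 𝔨 _ _ a b⟩
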